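/- Let $\mathbb K=\mathbb R$ or $\mathbb C$, and let $(M,\omega)$ be a $\mathbb K$-analytic symplectic manifold of dimension $2n$ over $\mathbb K$ (that is, $\omega$ is a closed, non-degenerate, $\mathbb K$-analytic $2$-form), with structure sheaf $\mathcal O_M$ of $\mathbb K$-analytic functions and Poisson bracket $\{\,,\}$. Let $L\subset M$ be a reduced analytic subspace of dimension $n$, given by a locally finitely generated ideal sheaf $\mathcal I\subset\mathcal O_M$ which is involutive, i.e. $\{\mathcal I,\mathcal I\}\subset\mathcal I$. Put $\mathcal O_L=\mathcal O_M/\mathcal I$. Let $\Omega^1_L$ be the cokernel of $\mathcal I/\mathcal I^2\to\Omega^1_M\otimes\mathcal O_L$, $f\mapsto df\otimes 1$, and for $p\ge 0$ put $$\Omega^p_L=\bigwedge\nolimits^p_{\mathcal O_L}\Omega^1_L,\qquad \mathcal C^p_L=\mathcal Hom_{\mathcal O_L}\Bigl(\bigwedge\nolimits^p_{\mathcal O_L}\mathcal I/\mathcal I^2,\ \mathcal O_L\Bigr),\qquad \mathcal F^*=\mathcal Hom_{\mathcal O_L}(\mathcal F,\mathcal O_L).$$ Suppose that $L$ is Cohen--Macaulay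 and regular in codimension one: for every $x\in L$ the local ring $\mathcal O_{L,x}$ is Cohen--Macaulay, and its localizations at prime ideals of height at most one are regular. Then for every $p\ge 0$ there is an isomorphism of sheaves of $\mathcal O_L$-modules $$(\Omega^p_L)^{**}\ \cong\ \mathcal C^p_L .$$ -/

import Mathlib

open CategoryTheory Opposite TopologicalSpace Filter Topology
open scoped Manifold ContDiff

noncomputable section

namespace SingularLagrangian

universe u

/-! ### Germs of analytic functions and of analytic one-forms -/

section Ambient

/-- The model space `𝕂^(2n)`. -/
abbrev Model (𝕂 : Type) [RCLike 𝕂] (n : ℕ) : Type := EuclideanSpace 𝕂 (Fin (2 * n))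

variable (𝕂 : Type) [RCLike 𝕂] (n : ℕ) {M : Type u} [TopologicalSpace M]
  [ChartedSpace (Model 𝕂 n) M]

/-- `𝒪_{M,x}`: the ring of germs at `x` of `𝕂`-analytic functions (holomorphic functions for
`𝕂 = ℂ`, real-analytic functions for `𝕂 = ℝ`). -/
def AnalyticGerm (x : M) : Subring (Germ (𝓝 x) 𝕂) where
  carrier := {g | ∃ f : M → 𝕂,
    ContMDiffAt 𝓘(𝕂, Model 𝕂 n) 𝓘(𝕂, 𝕂) ω f x ∧ (f : Germ (𝓝 x) 𝕂) = g}
  mul_mem' := by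
    rintro _ _ ⟨f, hf, rfl⟩ ⟨g, hg, rfl⟩
    exact ⟨f * g, hf.mul hg, rfl⟩
  one_mem' := ⟨fun _ => 1, contMDiffAt_const, rfl⟩
  add_mem' := by
    rintro _ _ ⟨f, hf, rfl⟩ ⟨g, hg, rfl⟩
    exact ⟨f + g, hf.add hg, rfl⟩
  zero_mem' := ⟨fun _ => 0, contMDiffAt_const, rfl⟩
  neg_mem' := by
    rintro _ ⟨f, hf, rfl⟩
    exact ⟨-f, hf.neg, rfl⟩

/-- An element of `𝒪_M(V)`, extended arbitrarily outside `V`; only its germs at the points of `V`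
are ever used. -/
structure LocalFunction (V : Opens M) where
  toFun : M → 𝕂
  contMDiffOn : ContMDiffOn 𝓘(𝕂, Model 𝕂 n) 𝓘(𝕂, 𝕂) ω toFun V

variable {𝕂 n}

/-- The germ in `𝒪_{M,x}` of a function analytic on an open set containing `x`. -/
def LocalFunction.germ {V : Opens M} (f : LocalFunction 𝕂 n V) (x : V) :
    AnalyticGerm 𝕂 n (x : M) :=
  ⟨(f.toFun : Germ (𝓝 (x : M)) 𝕂),
    f.toFun, f.contMDiffOn.contMDiffAt (V.isOpen.mem_nhds x.2), rfl⟩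

/-- Restriction of analytic functions to a smaller open set. -/
def LocalFunction.res {V W : Opens M} (h : W ≤ V) (f : LocalFunction 𝕂 n V) :
    LocalFunction 𝕂 n W :=
  ⟨f.toFun, f.contMDiffOn.mono h⟩

variable (𝕂 n)

/-- Germs at `x` of arbitrary fields of covectors on `M`. The tangent space of `M` at each point
is, in Mathlib, a copy of the model space, so that a field of covectors is a function with values
in the dual of the model space. -/
def CovectorGerm (x : M) : Type u := Germ (𝓝 x) (Model 𝕂 n →L[𝕂] 𝕂)

instance (x : M) : AddCommGroup (CovectorGerm 𝕂 n x) :=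
  inferInstanceAs (AddCommGroup (Germ (𝓝 x) (Model 𝕂 n →L[𝕂] 𝕂)))

instance (x : M) : Module (Germ (𝓝 x) 𝕂) (CovectorGerm 𝕂 n x) :=
  inferInstanceAs (Module (Germ (𝓝 x) 𝕂) (Germ (𝓝 x) (Model 𝕂 n →L[𝕂] 𝕂)))

/-- The exterior derivative `f ↦ df` from germs of functions to germs of fields of covectors. -/
def dGerm (x : M) : Germ (𝓝 x) 𝕂 → CovectorGerm 𝕂 n x :=
  Germ.map' (fun f y => mfderiv 𝓘(𝕂, Model 𝕂 n) 𝓘(𝕂, 𝕂) f y) fun _ _ h =>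
    (eventually_eventually_nhds.2 h).mono fun _ hy => EventuallyEq.mfderiv_eq hy

/-- `Ω¹_{M,x}`: the `𝒪_{M,x}`-module of germs at `x` of analytic one-forms. It is generated by the
differentials of germs of analytic functions (it is free on `dx₁, …, dx₂ₙ` for a chart). -/
def FormGerm (x : M) : Submodule (AnalyticGerm 𝕂 n x) (CovectorGerm 𝕂 n x) :=
  Submodule.span (AnalyticGerm 𝕂 n x)
    (Set.range fun f : AnalyticGerm 𝕂 n x => dGerm 𝕂 n x f)

variable {𝕂 n}

/-- The differential `d : 𝒪_{M,x} → Ω¹_{M,x}`. -/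
def d {x : M} (f : AnalyticGerm 𝕂 n x) : FormGerm 𝕂 n x :=
  ⟨dGerm 𝕂 n x f, Submodule.subset_span ⟨f, rfl⟩⟩

/-! ### Symplectic forms and Poisson brackets -/

/-- The pull-back of a field of alternating two-forms on `M` along the inverse of a chart. -/
def pullbackToChart (σ : ∀ x : M, TangentSpace 𝓘(𝕂, Model 𝕂 n) x [⋀^Fin 2]→L[𝕂] 𝕂)
    (e : OpenPartialHomeomorph M (Model 𝕂 n)) (z : Model 𝕂 n) :
    Model 𝕂 n [⋀^Fin 2]→L[𝕂] 𝕂 :=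
  (σ (e.symm z)).compContinuousLinearMap
    (mfderiv 𝓘(𝕂, Model 𝕂 n) 𝓘(𝕂, Model 𝕂 n) e.symm z)

variable (𝕂 n) in
/-- An analytic symplectic form on `M`: an analytic two-form which is closed and non-degenerate. -/
structure SymplecticForm (M : Type u) [TopologicalSpace M] [ChartedSpace (Model 𝕂 n) M] where
  form : ∀ x : M, TangentSpace 𝓘(𝕂, Model 𝕂 n) x [⋀^Fin 2]→L[𝕂] 𝕂
  analytic : ∀ e ∈ atlas (Model 𝕂 n) M, ContDiffOn 𝕂 ω (pullbackToChart form e) e.target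
  closed : ∀ e ∈ atlas (Model 𝕂 n) M, ∀ z ∈ e.target, extDeriv (pullbackToChart form e) z = 0
  nondegenerate : ∀ (x : M) (v : TangentSpace 𝓘(𝕂, Model 𝕂 n) x),
    (∀ w, form x ![v, w] = 0) → v = 0

/-- An alternating two-form as a bilinear form. -/
def toBilin (B : Model 𝕂 n [⋀^Fin 2]→L[𝕂] 𝕂) : Model 𝕂 n →ₗ[𝕂] Module.Dual 𝕂 (Model 𝕂 n) :=
  have h₀ (a v w : Model 𝕂 n) : Function.update ![v, w] 0 a = ![a, w] := by
    ext i : 1; fin_cases i <;> rfl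
  have h₁ (a v w : Model 𝕂 n) : Function.update ![v, w] 1 a = ![v, a] := by
    ext i : 1; fin_cases i <;> rfl
  LinearMap.mk₂ 𝕂 (fun v w => B ![v, w])
    (fun v v' w => by have := B.map_update_add ![v, w] 0 v v'; rwa [h₀, h₀, h₀] at this)
    (fun c v w => by have := B.map_update_smul ![v, w] 0 c v; rwa [h₀, h₀] at this)
    (fun v w w' => by have := B.map_update_add ![v, w] 1 w w'; rwa [h₁, h₁, h₁] at this)
    (fun c v w => by have := B.map_update_smul ![v, w] 1 c w; rwa [h₁, h₁] at this)

/-- The isomorphism `v ↦ σ(v, ·)` from tangent vectors to covectors at `x`. -/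
def SymplecticForm.flat (σ : SymplecticForm 𝕂 n M) (x : M) :
    Model 𝕂 n ≃ₗ[𝕂] Module.Dual 𝕂 (Model 𝕂 n) :=
  LinearMap.linearEquivOfInjective (toBilin (σ.form x))
    ((injective_iff_map_eq_zero _).2 fun v hv =>
      σ.nondegenerate x v fun w => LinearMap.congr_fun hv w)
    Subspace.dual_finrank_eq.symm

/-- The hamiltonian vector field `H_f`, determined by `σ(H_f, ·) = df`. -/
def SymplecticForm.hamiltonian (σ : SymplecticForm 𝕂 n M) (f : M → 𝕂) (x : M) :
    TangentSpace 𝓘(𝕂, Model 𝕂 n) x :=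
  (σ.flat x).symm (mfderiv 𝓘(𝕂, Model 𝕂 n) 𝓘(𝕂, 𝕂) f x).toLinearMap

/-- The Poisson bracket `{f, g} = H_f(g) = dg(H_f)`. -/
def SymplecticForm.poisson (σ : SymplecticForm 𝕂 n M) (f g : M → 𝕂) (x : M) : 𝕂 :=
  mfderiv 𝓘(𝕂, Model 𝕂 n) 𝓘(𝕂, 𝕂) g x (σ.hamiltonian f x)

/-! ### Analytic subspaces -/

variable (𝕂 n) in
/-- A closed analytic subspace `L ⊂ M`, given by an ideal sheaf `𝓘 ⊂ 𝒪_M` which is locally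
generated by finitely many functions. The ideal sheaf is recorded by its stalks:
`𝓘(V)` consists of the analytic functions on `V` all of whose germs lie in the stalks. -/
structure AnalyticSubspace (M : Type u) [TopologicalSpace M] [ChartedSpace (Model 𝕂 n) M] where
  ideal : ∀ x : M, Ideal (AnalyticGerm 𝕂 n x)
  locally_fg : ∀ x : M, ∃ V : Opens M, x ∈ V ∧ ∃ (k : ℕ) (f : Fin k → LocalFunction 𝕂 n V),
    ∀ y : V, ideal y = Ideal.span (Set.range fun i => (f i).germ y)

variable (L : AnalyticSubspace 𝕂 n M)

namespace AnalyticSubspace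

/-- The underlying set of `L`, i.e. the support of `𝒪_M / 𝓘`. -/
def carrier : Set M := {x | L.ideal x ≠ ⊤}

/-- The stalk `𝒪_{L,x} = 𝒪_{M,x} / 𝓘_x`. -/
def Stalk (x : M) : Type u := AnalyticGerm 𝕂 n x ⧸ L.ideal x

instance (x : M) : CommRing (L.Stalk x) :=
  inferInstanceAs (CommRing (AnalyticGerm 𝕂 n x ⧸ L.ideal x))

/-- The quotient map `𝒪_{M,x} → 𝒪_{L,x}`. -/
def toStalk (x : M) : AnalyticGerm 𝕂 n x →+* L.Stalk x := Ideal.Quotient.mk (L.ideal x)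

/-- `L` is reduced. -/
def IsReduced : Prop := ∀ x ∈ L.carrier, _root_.IsReduced (L.Stalk x)

/-- The dimension of `L`: the supremum of the local dimensions `dim 𝒪_{L,x}`, `x ∈ L`. -/
def dim : WithBot ℕ∞ := ⨆ x : L.carrier, ringKrullDim (L.Stalk x)

/-- The ideal sheaf of `L` is involutive: `{𝓘, 𝓘} ⊂ 𝓘`. -/
def IsInvolutive (σ : SymplecticForm 𝕂 n M) : Prop :=
  ∀ (V : Opens M) (f g : LocalFunction 𝕂 n V),
    (∀ x : V, f.germ x ∈ L.ideal x) → (∀ x : V, g.germ x ∈ L.ideal x) →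
    ∀ x : V, ∃ h ∈ L.ideal (x : M),
      (h : Germ (𝓝 (x : M)) 𝕂) = (σ.poisson f.toFun g.toFun : M → 𝕂)

end AnalyticSubspace

/-- A (noetherian) local ring is Cohen-Macaulay if it has a regular sequence whose length is its
Krull dimension. -/
def IsCohenMacaulayLocal (A : Type*) [CommRing A] : Prop :=
  ∃ rs : List A, RingTheory.Sequence.IsRegular A rs ∧ (rs.length : WithBot ℕ∞) = ringKrullDim A

/-- A ring is regular in codimension one if its localizations at the prime ideals of height at
most one are regular. -/
def IsRegularInCodimOne (A : Type*) [CommRing A] : Prop :=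
  ∀ (P : Ideal A) [P.IsPrime], P.height ≤ 1 → IsRegularLocalRing (Localization.AtPrime P)

namespace AnalyticSubspace

/-- `L` is Cohen-Macaulay. -/
def IsCohenMacaulay : Prop := ∀ x ∈ L.carrier, IsCohenMacaulayLocal (L.Stalk x)

/-- `L` is regular in codimension one. -/
def IsRegularInCodimOne : Prop :=
  ∀ x ∈ L.carrier, SingularLagrangian.IsRegularInCodimOne (L.Stalk x)

/-! ### The structure sheaf and sheaves of modules given by their stalks

Sheaves on `L` are regarded as sheaves on `M` with support in `L`. -/

/-- The class in `∏ 𝒪_{L,x}` of an analytic function. -/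
def ofFunction {V : Opens M} (f : LocalFunction 𝕂 n V) (x : V) : L.Stalk (x : M) :=
  L.toStalk x (f.germ x)

/-- `𝒪_L(U)`, where `𝒪_L = 𝒪_M / 𝓘`: families of elements of the stalks which are locally
given by analytic functions. -/
def sections (U : Opens M) : Subring (∀ x : U, L.Stalk (x : M)) where
  carrier := {s | ∀ x : U, ∃ (V : Opens M) (h : V ≤ U) (f : LocalFunction 𝕂 n V), (x : M) ∈ V ∧
    ∀ y : V, s ⟨y, h y.2⟩ = L.ofFunction f y}
  mul_mem' {s t} hs ht x := by
    obtain ⟨V, hV, f, hx, hf⟩ := hs x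
    obtain ⟨W, hW, g, hx', hg⟩ := ht x
    refine ⟨V ⊓ W, inf_le_left.trans hV,
      ⟨f.toFun * g.toFun, (f.res inf_le_left).contMDiffOn.mul (g.res inf_le_right).contMDiffOn⟩,
      ⟨hx, hx'⟩, fun y => ?_⟩
    exact congrArg₂ (· * ·) (hf ⟨y, y.2.1⟩) (hg ⟨y, y.2.2⟩)
  one_mem' x := ⟨U, le_rfl, ⟨fun _ => 1, contMDiffOn_const⟩, x.2, fun _ => rfl⟩
  add_mem' {s t} hs ht x := by
    obtain ⟨V, hV, f, hx, hf⟩ := hs x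
    obtain ⟨W, hW, g, hx', hg⟩ := ht x
    refine ⟨V ⊓ W, inf_le_left.trans hV,
      ⟨f.toFun + g.toFun, (f.res inf_le_left).contMDiffOn.add (g.res inf_le_right).contMDiffOn⟩,
      ⟨hx, hx'⟩, fun y => ?_⟩
    exact congrArg₂ (· + ·) (hf ⟨y, y.2.1⟩) (hg ⟨y, y.2.2⟩)
  zero_mem' x := ⟨U, le_rfl, ⟨fun _ => 0, contMDiffOn_const⟩, x.2, fun _ => rfl⟩
  neg_mem' {s} hs x := by
    obtain ⟨V, hV, f, hx, hf⟩ := hs x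
    refine ⟨V, hV, ⟨-f.toFun, f.contMDiffOn.neg⟩, hx, fun y => ?_⟩
    exact congrArg (- ·) (hf y)

/-- Restriction maps of `𝒪_L`. -/
def resSections {U V : Opens M} (h : V ≤ U) : L.sections U →+* L.sections V where
  toFun s := ⟨fun x => s.1 ⟨x, h x.2⟩, fun x => by
    obtain ⟨W, hW, f, hx, hf⟩ := s.2 ⟨x, h x.2⟩
    exact ⟨V ⊓ W, inf_le_left, f.res inf_le_right, ⟨x.2, hx⟩, fun y => hf ⟨y, y.2.2⟩⟩⟩
  map_one' := rfl
  map_mul' _ _ := rfl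
  map_zero' := rfl
  map_add' _ _ := rfl

/-- The sheaf of rings `𝒪_L`. -/
def structureSheaf : (Opens M)ᵒᵖ ⥤ CommRingCat.{u} where
  obj U := CommRingCat.of (L.sections U.unop)
  map i := CommRingCat.ofHom (L.resSections i.unop.le)

/-- The underlying sheaf of (not necessarily commutative) rings of `𝒪_L`. -/
abbrev ringSheaf : (Opens M)ᵒᵖ ⥤ RingCat.{u} := L.structureSheaf ⋙ forget₂ CommRingCat RingCat

/-- Data for a sheaf of `𝒪_L`-modules: its stalks, and for every open set a set of sections, given
by their germs, which generate it locally. -/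
structure StalkSheaf (L : AnalyticSubspace 𝕂 n M) where
  stalk : M → Type u
  [addCommGroup : ∀ x, AddCommGroup (stalk x)]
  [module : ∀ x, Module (L.Stalk x) (stalk x)]
  gens : ∀ V : Opens M, Set (∀ x : V, stalk x)
  gens_res : ∀ {V W : Opens M} (h : W ≤ V), ∀ s ∈ gens V, (fun x : W => s ⟨x, h x.2⟩) ∈ gens W

attribute [instance] StalkSheaf.addCommGroup StalkSheaf.module

namespace StalkSheaf

variable {L} (F : StalkSheaf L)

theorem res_mem_span {V W : Opens M} (h : W ≤ V) {s : ∀ x : V, F.stalk x}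
    (hs : s ∈ Submodule.span (L.sections V) (F.gens V)) :
    (fun x : W => s ⟨x, h x.2⟩) ∈ Submodule.span (L.sections W) (F.gens W) := by
  induction hs using Submodule.span_induction with
  | mem s hs => exact Submodule.subset_span (F.gens_res h s hs)
  | zero => exact Submodule.zero_mem _
  | add s t _ _ hs ht => exact Submodule.add_mem _ hs ht
  | smul a s _ hs => exact Submodule.smul_mem _ (L.resSections h a) hs

/-- Sections over `U`: families of elements of the stalks which are, locally, `𝒪_L`-linear
combinations of the generating sections. -/
def sections (U : Opens M) : Submodule (L.sections U) (∀ x : U, F.stalk x) where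
  carrier := {s | ∀ x : U, ∃ (V : Opens M) (h : V ≤ U), (x : M) ∈ V ∧
    (fun y : V => s ⟨y, h y.2⟩) ∈ Submodule.span (L.sections V) (F.gens V)}
  add_mem' {s t} hs ht x := by
    obtain ⟨V, hV, hx, hs⟩ := hs x
    obtain ⟨W, hW, hx', ht⟩ := ht x
    exact ⟨V ⊓ W, inf_le_left.trans hV, ⟨hx, hx'⟩,
      Submodule.add_mem _ (F.res_mem_span inf_le_left hs) (F.res_mem_span inf_le_right ht)⟩
  zero_mem' x := ⟨U, le_rfl, x.2, Submodule.zero_mem _⟩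
  smul_mem' a s hs x := by
    obtain ⟨V, hV, hx, hs⟩ := hs x
    exact ⟨V, hV, hx, Submodule.smul_mem _ (L.resSections hV a) hs⟩

/-- Restriction of sections. -/
def res {U V : Opens M} (h : V ≤ U) : F.sections U →+ F.sections V where
  toFun s := ⟨fun x => s.1 ⟨x, h x.2⟩, fun x => by
    obtain ⟨W, hW, hx, hs⟩ := s.2 ⟨x, h x.2⟩
    exact ⟨V ⊓ W, inf_le_left, ⟨x.2, hx⟩, F.res_mem_span inf_le_right hs⟩⟩
  map_zero' := rfl
  map_add' _ _ := rfl

/-- The underlying sheaf of abelian groups. -/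
def abSheaf : (Opens M)ᵒᵖ ⥤ Ab.{u} where
  obj U := AddCommGrpCat.of (F.sections U.unop)
  map i := AddCommGrpCat.ofHom (F.res i.unop.le)

instance (U : (Opens M)ᵒᵖ) : Module (L.ringSheaf.obj U) (F.abSheaf.obj U) :=
  inferInstanceAs (Module (L.sections U.unop) (F.sections U.unop))

/-- The sheaf of `𝒪_L`-modules with the given stalks and local generators. -/
def toModules : PresheafOfModules.{u} L.ringSheaf :=
  PresheafOfModules.ofPresheaf F.abSheaf fun _ _ _ _ _ => rfl

/-- The exterior power `⋀^p 𝓕`, with stalks `⋀^p 𝓕_x`. -/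
def exteriorPower (p : ℕ) : StalkSheaf L where
  stalk x := ⋀[L.Stalk x]^p (F.stalk x)
  gens V := {s | ∃ t : Fin p → ∀ x : V, F.stalk x, (∀ i, t i ∈ F.gens V) ∧
    s = fun x : V => _root_.exteriorPower.ιMulti (L.Stalk (x : M)) p fun i => t i x}
  gens_res h := by
    rintro _ ⟨t, ht, rfl⟩
    exact ⟨fun i x => t i ⟨x, h x.2⟩, fun i => F.gens_res h _ (ht i), rfl⟩

end StalkSheaf

instance (x : M) : Module (L.Stalk x) (L.ideal x).Cotangent :=
  inferInstanceAs (Module (AnalyticGerm 𝕂 n x ⧸ L.ideal x) (L.ideal x).Cotangent)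

/-- The conormal sheaf `𝓘 / 𝓘²`. -/
def conormal : StalkSheaf L where
  stalk x := (L.ideal x).Cotangent
  gens V := {s | ∃ (f : LocalFunction 𝕂 n V) (hf : ∀ x : V, f.germ x ∈ L.ideal x),
    s = fun x : V => (L.ideal (x : M)).toCotangent ⟨f.germ x, hf x⟩}
  gens_res h := by
    rintro _ ⟨f, hf, rfl⟩
    exact ⟨f.res h, fun x => hf ⟨x, h x.2⟩, rfl⟩

/-- The stalk `(Ω¹_M ⊗ 𝒪_L)_x = Ω¹_{M,x} / 𝓘_x Ω¹_{M,x}`. -/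
def AmbientForms (x : M) : Type u :=
  FormGerm 𝕂 n x ⧸ (L.ideal x • (⊤ : Submodule (AnalyticGerm 𝕂 n x) (FormGerm 𝕂 n x)))

instance (x : M) : AddCommGroup (L.AmbientForms x) :=
  inferInstanceAs (AddCommGroup
    (FormGerm 𝕂 n x ⧸ (L.ideal x • (⊤ : Submodule (AnalyticGerm 𝕂 n x) (FormGerm 𝕂 n x)))))

instance (x : M) : Module (L.Stalk x) (L.AmbientForms x) :=
  inferInstanceAs (Module (AnalyticGerm 𝕂 n x ⧸ L.ideal x)
    (FormGerm 𝕂 n x ⧸ (L.ideal x • (⊤ : Submodule (AnalyticGerm 𝕂 n x) (FormGerm 𝕂 n x)))))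

/-- The class of `df` in `(Ω¹_M ⊗ 𝒪_L)_x`. -/
def dAmbient {x : M} (f : AnalyticGerm 𝕂 n x) : L.AmbientForms x :=
  Submodule.Quotient.mk (d f)

/-- The image of `𝓘_x / 𝓘_x² → (Ω¹_M ⊗ 𝒪_L)_x`, `f ↦ df`. -/
def conormalForms (x : M) : Submodule (L.Stalk x) (L.AmbientForms x) :=
  Submodule.span (L.Stalk x) {θ | ∃ f ∈ L.ideal x, θ = L.dAmbient f}

/-- The sheaf `Ω¹_L` of analytic (Kähler) differentials, the cokernel of
`𝓘 / 𝓘² → Ω¹_M ⊗ 𝒪_L`. -/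
def oneForms : StalkSheaf L where
  stalk x := L.AmbientForms x ⧸ L.conormalForms x
  gens V := {s | ∃ f : LocalFunction 𝕂 n V, s = fun x : V =>
    (L.conormalForms (x : M)).mkQ (L.dAmbient (f.germ x))}
  gens_res h := by
    rintro _ ⟨f, rfl⟩
    exact ⟨f.res h, rfl⟩

end AnalyticSubspace
end Ambient

/-! ### The dual of a sheaf of modules -/

section Dual

variable {X : Type u} [TopologicalSpace X] {R : (Opens X)ᵒᵖ ⥤ CommRingCat.{u}}
  (F : PresheafOfModules.{u} (R ⋙ forget₂ CommRingCat RingCat))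

/-- Sections over `U` of `𝓗om_R(F, R)`: morphisms of sheaves of modules from `F|_U` to `R|_U`. -/
def dualSections (U : Opens X) :
    AddSubgroup (∀ V : Set.Iic U, F.obj (op V.1) →ₗ[R.obj (op V.1)] R.obj (op V.1)) where
  carrier := {φ | ∀ (V W : Set.Iic U) (h : W.1 ≤ V.1) (s : F.obj (op V.1)),
    R.map (homOfLE h).op (φ V s) = φ W (F.map (homOfLE h).op s)}
  add_mem' {φ ψ} hφ hψ V W h s := by
    exact (map_add (R.map (homOfLE h).op).hom _ _).trans
      (congrArg₂ (· + ·) (hφ V W h s) (hψ V W h s))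
  zero_mem' V W h s := map_zero (R.map (homOfLE h).op).hom
  neg_mem' {φ} hφ V W h s := by
    exact (map_neg (R.map (homOfLE h).op).hom _).trans (congrArg (- ·) (hφ V W h s))

instance (U : Opens X) : SMul (R.obj (op U)) (dualSections F U) where
  smul r φ := ⟨fun V => R.map (homOfLE V.2).op r • φ.1 V, fun V W h s => by
    have := φ.2 V W h s
    simp only [LinearMap.smul_apply, smul_eq_mul, map_mul, this]
    congr 1
    exact (ConcreteCategory.congr_hom (R.map_comp (homOfLE V.2).op (homOfLE h).op) r).symm⟩

theorem smul_dualSections_val {U : Opens X} (r : R.obj (op U)) (φ : dualSections F U)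
    (V : Set.Iic U) : (r • φ).1 V = R.map (homOfLE V.2).op r • φ.1 V := rfl

/-- `𝓗om_R(F, R)(U)` is an `R(U)`-module. -/
instance (U : Opens X) : Module (R.obj (op U)) (dualSections F U) where
  one_smul φ := Subtype.ext <| funext fun V => by
    rw [smul_dualSections_val, map_one, one_smul]
  mul_smul r s φ := Subtype.ext <| funext fun V => by
    simp only [smul_dualSections_val, map_mul, mul_smul]
  smul_zero r := Subtype.ext <| funext fun V => smul_zero _
  smul_add r φ ψ := Subtype.ext <| funext fun V => smul_add _ _ _
  add_smul r s φ := Subtype.ext <| funext fun V =>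
    (congrArg (· • φ.1 V) (map_add _ r s)).trans (add_smul _ _ _)
  zero_smul φ := Subtype.ext <| funext fun V =>
    (congrArg (· • φ.1 V) (map_zero _)).trans (zero_smul _ _)

/-- Restriction of morphisms to a smaller open set. -/
def resDual {U V : Opens X} (h : V ≤ U) : dualSections F U →+ dualSections F V where
  toFun φ := ⟨fun W => φ.1 ⟨W.1, le_trans W.2 h⟩, 
    fun W W' h' s => φ.2 ⟨W.1, le_trans W.2 h⟩ ⟨W'.1, le_trans W'.2 h⟩ h' s⟩
  map_zero' := rfl
  map_add' _ _ := rfl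

/-- The underlying sheaf of abelian groups of the dual. -/
def dualAb : (Opens X)ᵒᵖ ⥤ Ab.{u} where
  obj U := AddCommGrpCat.of (dualSections F U.unop)
  map i := AddCommGrpCat.ofHom (resDual F i.unop.le)
  map_id _ := rfl
  map_comp _ _ := rfl

instance (U : (Opens X)ᵒᵖ) :
    Module ((R ⋙ forget₂ CommRingCat RingCat).obj U) ((dualAb F).obj U) :=
  inferInstanceAs (Module (R.obj (op U.unop)) (dualSections F U.unop))

/-- The dual `F* = 𝓗om_R(F, R)`, with its structure of sheaf of `R`-modules. -/
def dual : PresheafOfModules.{u} (R ⋙ forget₂ CommRingCat RingCat) :=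
  PresheafOfModules.ofPresheaf (dualAb F) fun U V i r φ => Subtype.ext <| funext fun W => by
    have h := congrArg (· • φ.1 ⟨W.1, le_trans W.2 i.unop.le⟩)
      (ConcreteCategory.congr_hom (R.map_comp i (homOfLE W.2).op) r)
    exact h

end Dual

namespace AnalyticSubspace

variable {𝕂 : Type} [RCLike 𝕂] {n : ℕ} {M : Type u} [TopologicalSpace M]
  [ChartedSpace (Model 𝕂 n) M] (L : AnalyticSubspace 𝕂 n M)

/-- The sheaf of differential forms `Ω^p_L = ⋀^p Ω¹_L`. -/
def forms (p : ℕ) : PresheafOfModules.{u} L.ringSheaf :=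
  (L.oneForms.exteriorPower p).toModules

/-- The sheaf `𝓒^p_L = 𝓗om(⋀^p (𝓘 / 𝓘²), 𝒪_L)`. -/
def cochains (p : ℕ) : PresheafOfModules.{u} L.ringSheaf :=
  dual (L.conormal.exteriorPower p).toModules

end AnalyticSubspace
end SingularLagrangian
end

/-! The bracket pairs I/I² with Ω¹_L by (f, dg) ↦ {f, g}. Involutivity says that {f, g} vanishes on
L when f and g both lie in I, which is what lets the pairing descend to the cokernel Ω¹_L
(`stalkPairing`). Determinants of such brackets give a map α from ⋀^p(I/I²) to (Ω^p_L)^*, and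
dualizing α gives the map `pullback` from (Ω^p_L)^{**} to C^p_L. This map is the isomorphism.

In codimension at most one, α is invertible for practical purposes. At a prime Q of height at most
one L is regular, so the Jacobian criterion provides n equations f_i whose differentials are
independent over the residue field of Q (`exists_linearIndependent_differentials`). They span an
isotropic subspace of dimension n in a symplectic space of dimension 2n, so suitable one-forms dual
to the f_i, together with the df_i, generate all one-forms near Q; the df_i die in Ω¹_L
(`exists_minor_notMem`). Cramer's rule turns this into explicit multipliers m_i = p! h^p g^p that
carry every functional θ on p-forms into the image of α and have no common zero in codimension one
(`exists_multipliers`).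

Injectivity: if Φ vanishes on the image of α, then m_i Φ(θ) = 0 for all i, and the ideal of the m_i
contains a nonzerodivisor since L is reduced.

Surjectivity: given ψ on ⋀^p(I/I²) and m_i θ = α(ν_i), the value Φ(θ) has to be the s with m_i s =
ψ(ν_i). The right-hand sides are compatible because m_i ν_j - m_j ν_i lies in the kernel of α, and ψ
kills this kernel: in a reduced ring this can be tested at minimal primes, where the pairing can be
inverted on generators of I (`ev_eq_zero_of_pairing_eq_zero`). The solution s exists because the
ideal of the m_i has height at least two in a Cohen-Macaulay ring, a Hartogs-type extension
(`mem_span_singleton_of_isCohenMacaulay`, `IsDense.exists_mul_eq`). Uniqueness makes s additive,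
linear and glueable.

The Jacobian criterion rests on `PowerGerm.hasLocalEquations`, a description of the primes of the
ring of convergent power series. It is proved by induction on the number of variables from
Weierstrass division, and division is proved by estimates on absolutely convergent series that work
alike over both fields. Characteristic zero is used for separability of minimal polynomials and for
inverting p!. -/

/-! ### Depth and associated primes of local rings -/

section LocalAlgebra

variable {R : Type*} [CommRing R]

/-- `r` is a nonzerodivisor modulo the ideal `I`. -/
def RegularModulo (I : Ideal R) (r : R) : Prop := ∀ a, r * a ∈ I → a ∈ I

/-- There is a regular sequence of length `k` on `R ⧸ I` inside the ideal `m`. -/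
def DepthGE (m : Ideal R) : Ideal R → ℕ → Prop
  -- The base case records that the quotient by the whole sequence does not collapse when m is
  -- proper.
  | I, 0 => I ≤ m
  | I, k + 1 => ∃ r ∈ m, RegularModulo I r ∧ DepthGE m (I ⊔ Ideal.span {r}) k

theorem DepthGE.le {m : Ideal R} : ∀ {k : ℕ} {I : Ideal R}, DepthGE m I k → I ≤ m
  | 0, _, h => h
  | _ + 1, _, ⟨_, _, _, h⟩ => le_sup_left.trans h.le

theorem mem_sup_span_singleton {I : Ideal R} {r a : R} :
    a ∈ I ⊔ Ideal.span {r} ↔ ∃ i ∈ I, ∃ b, a = i + r * b := by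
  constructor
  · intro h
    obtain ⟨i, hi, c, hc, rfl⟩ := Submodule.mem_sup.1 h
    obtain ⟨b, rfl⟩ := Ideal.mem_span_singleton'.1 hc
    exact ⟨i, hi, b, by ring⟩
  · rintro ⟨i, hi, b, rfl⟩
    exact add_mem (Ideal.mem_sup_left hi)
      (Ideal.mem_sup_right (Ideal.mul_mem_right _ _ (Ideal.mem_span_singleton_self r)))

/-- The half of permutability of regular sequences that needs no local hypothesis: if r a = i + z b,
then z b lies in I + (r), so b = i' + r b', and r can be cancelled from r (a - z b') modulo I. -/
theorem RegularModulo.swap {I : Ideal R} {r z : R}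
    (hzr : RegularModulo (I ⊔ Ideal.span {r}) z) (hr : RegularModulo I r) :
    RegularModulo (I ⊔ Ideal.span {z}) r := by
  intro a ha
  obtain ⟨i, hi, b, hb⟩ := mem_sup_span_singleton.1 ha
  have hb' : b ∈ I ⊔ Ideal.span {r} := by
    apply hzr
    rw [mem_sup_span_singleton]
    exact ⟨-i, neg_mem hi, a, by rw [hb]; ring⟩
  obtain ⟨i', hi', b', rfl⟩ := mem_sup_span_singleton.1 hb'
  rw [mem_sup_span_singleton]
  refine ⟨a - z * b', hr _ ?_, b', by ring⟩
  have : r * (a - z * b') = i + z * i' := by rw [mul_sub, hb]; ring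
  rw [this]
  exact add_mem hi (Ideal.mul_mem_left _ _ hi')

/-- The new class z' is read off from h' z = i + h z'. This is the elementwise trace of comparing
the P-torsion modulo h and modulo h' through Ext¹(R/P, R/I). -/
theorem exists_colon_transfer {I P : Ideal R} {h h' z : R} (hh : RegularModulo I h)
    (hh' : RegularModulo I h') (hP : h' ∈ P)
    (hz : z ∉ I ⊔ Ideal.span {h}) (hPz : ∀ p ∈ P, p * z ∈ I ⊔ Ideal.span {h}) :
    ∃ z' ∉ I ⊔ Ideal.span {h'}, ∀ p ∈ P, p * z' ∈ I ⊔ Ideal.span {h'} := by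
  obtain ⟨i, hi, z', hz'⟩ := mem_sup_span_singleton.1 (hPz h' hP)
  refine ⟨z', fun hmem => hz ?_, fun p hp => ?_⟩
  · obtain ⟨i₂, hi₂, w, rfl⟩ := mem_sup_span_singleton.1 hmem
    refine mem_sup_span_singleton.2 ⟨z - h * w, hh' _ ?_, w, by ring⟩
    have : h' * (z - h * w) = i + h * i₂ := by rw [mul_sub, hz']; ring
    rw [this]
    exact add_mem hi (Ideal.mul_mem_left _ _ hi₂)
  · obtain ⟨i', hi', w, hw⟩ := mem_sup_span_singleton.1 (hPz p hp)
    refine mem_sup_span_singleton.2 ⟨p * z' - h' * w, hh _ ?_, w, by ring⟩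
    have : h * (p * z' - h' * w) = h' * i' - p * i := by
      linear_combination h' * hw - p * hz'
    rw [this]
    exact sub_mem (Ideal.mul_mem_left _ _ hi') (Ideal.mul_mem_left _ _ hi)

/-- An annihilator in R/I is contained in an associated prime. The elementwise form allows the ideal
I to vary without changing modules. -/
theorem exists_prime_colon [IsNoetherianRing R] {I : Ideal R} {u : R} (hu : u ∉ I) :
    ∃ P : Ideal R, P.IsPrime ∧ (∀ a, a * u ∈ I → a ∈ P) ∧
      ∃ z ∉ I, ∀ p ∈ P, p * z ∈ I := by
  have hu' : (Ideal.Quotient.mk I u : R ⧸ I) ≠ 0 := fun h => hu (Ideal.Quotient.eq_zero_iff_mem.1 h)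
  obtain ⟨P, hP, hle⟩ := exists_le_isAssociatedPrime_of_isNoetherianRing R _ hu'
  obtain ⟨hp, x, hx⟩ := isAssociatedPrime_iff.1 hP
  obtain ⟨z, rfl⟩ := Ideal.Quotient.mk_surjective x
  have key : ∀ a w : R, a • (Ideal.Quotient.mk I w : R ⧸ I) = 0 ↔ a * w ∈ I := fun a w => by
    rw [← Ideal.Quotient.eq_zero_iff_mem, map_mul]; rfl
  refine ⟨P, hp, fun a ha => hle ?_, z, fun hz => hp.ne_top ?_, fun p hp' => ?_⟩
  · rw [Submodule.mem_colon_singleton, Submodule.mem_bot, key]; exact ha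
  · rw [hx, Ideal.eq_top_iff_one, Submodule.mem_colon_singleton, Submodule.mem_bot, key, one_mul]
    exact hz
  · rw [hx, Submodule.mem_colon_singleton, Submodule.mem_bot, key] at hp'; exact hp'

/-- The associated primes of `R ⧸ I` have coheight at least the depth of `R ⧸ I`. -/
theorem DepthGE.le_coheight [IsNoetherianRing R] [IsLocalRing R] :
    ∀ {k : ℕ} {I : Ideal R}, DepthGE (IsLocalRing.maximalIdeal R) I k →
      ∀ (P : PrimeSpectrum R) (z : R), z ∉ I → (∀ p ∈ P.asIdeal, p * z ∈ I) →
        (k : ℕ∞) ≤ Order.coheight P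
  | 0, _, _, _, _, _, _ => by simp
  | k + 1, I, ⟨r, hrm, hr, hd⟩, P, z, hz, hPz => by
    -- The colon ideal (I : P). It contains z, so it is not inside I.
    set U : Ideal R :=
      { carrier := {u | ∀ p ∈ P.asIdeal, p * u ∈ I}
        add_mem' := fun {a b} ha hb p hp => by rw [mul_add]; exact add_mem (ha p hp) (hb p hp)
        zero_mem' := fun p _ => by simp
        smul_mem' := fun c u hu p hp => by
          have := Ideal.mul_mem_left I c (hu p hp)
          simpa [mul_left_comm] using this } with hU
    have hU' : ∀ u, u ∈ U ↔ ∀ p ∈ P.asIdeal, p * u ∈ I := fun _ => Iff.rfl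
    -- If U were inside I + (r), cancelling r would give U ⊆ I + mU, and Nakayama would force U ⊆ I.
    have hnot : ¬ U ≤ I ⊔ Ideal.span {r} := by
      intro hle
      have hUle : U ≤ I ⊔ IsLocalRing.maximalIdeal R • U := by
        intro u hu
        obtain ⟨i, hi, b, rfl⟩ := mem_sup_span_singleton.1 (hle hu)
        refine add_mem (Ideal.mem_sup_left hi)
          (Ideal.mem_sup_right (Submodule.smul_mem_smul hrm ?_))
        intro p hp
        apply hr
        have h1 := sub_mem (hu p hp) (Ideal.mul_mem_left I p hi)
        have h2 : p * (i + r * b) - p * i = r * (p * b) := by ring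
        rwa [h2] at h1
      have := Submodule.le_of_le_smul_of_le_jacobson_bot (IsNoetherian.noetherian U)
        (IsLocalRing.maximalIdeal_le_jacobson ⊥) hUle
      exact hz (this hPz)
    obtain ⟨u, hu, hu'⟩ := SetLike.not_le_iff_exists.1 hnot
    -- An associated prime P' of R/(I, r) above P. It contains r, whereas r ∉ P because r is regular
    -- modulo I and P kills z. So P < P' adds one link to the chain found by recursion.
    obtain ⟨P', hP', hle, z', hz', hPz'⟩ := exists_prime_colon hu'
    have ih := hd.le_coheight ⟨P', hP'⟩ z' hz' hPz'
    have hlt : P < ⟨P', hP'⟩ := by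
      refine lt_of_le_of_ne (fun p hp => hle p (Ideal.mem_sup_left (hu p hp))) ?_
      intro heq
      have hrP' : r ∈ P.asIdeal := by
        rw [heq]
        exact hle r (Ideal.mem_sup_right
          (Ideal.mul_mem_right _ _ (Ideal.mem_span_singleton_self r)))
      exact hz (hr z (hPz r hrP'))
    calc ((k + 1 : ℕ) : ℕ∞) = k + 1 := by push_cast; rfl
      _ ≤ Order.coheight (⟨P', hP'⟩ : PrimeSpectrum R) + 1 := by gcongr
      _ ≤ Order.coheight P := Order.coheight_add_one_le hlt

/-- Prime avoidance over the associated primes of all the quotients R/I at once: m is contained in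
none of them, since no nonzero class is killed by m. -/
theorem exists_regularModulo [IsNoetherianRing R] (m : Ideal R) (s : Finset (Ideal R))
    (hs : ∀ I ∈ s, ∀ z, (∀ p ∈ m, p * z ∈ I) → z ∈ I) :
    ∃ r ∈ m, ∀ I ∈ s, RegularModulo I r := by
  set T : Set (Ideal R) := ⋃ I ∈ s, associatedPrimes R (R ⧸ I) with hT
  have hfin : T.Finite := s.finite_toSet.biUnion fun I _ => associatedPrimes.finite R _
  have hprime : ∀ P ∈ T, P.IsPrime := fun P hP => by
    simp only [hT, Set.mem_iUnion] at hP
    obtain ⟨I, _, h⟩ := hP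
    exact h.isPrime
  have key : ∀ (I : Ideal R) (a w : R), a • (Ideal.Quotient.mk I w : R ⧸ I) = 0 ↔ a * w ∈ I :=
    fun I a w => by rw [← Ideal.Quotient.eq_zero_iff_mem, map_mul]; rfl
  have hnot : ¬ (m : Set R) ⊆ ⋃ P ∈ T, (P : Set R) := by
    intro hsub
    obtain ⟨P, hP, hle⟩ := (Ideal.subset_union_prime_finite (f := id) hfin ⊥ ⊥
      fun P hP _ _ => hprime P hP).1 hsub
    simp only [hT, Set.mem_iUnion] at hP
    obtain ⟨I, hI, h⟩ := hP
    obtain ⟨hp, x, hx⟩ := isAssociatedPrime_iff.1 h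
    obtain ⟨z, rfl⟩ := Ideal.Quotient.mk_surjective x
    refine hp.ne_top ?_
    have hz := hs I hI z fun p hp' => by
      have h2 : p ∈ P := hle hp'
      rwa [hx, Submodule.mem_colon_singleton, Submodule.mem_bot, key] at h2
    rw [hx, Ideal.eq_top_iff_one, Submodule.mem_colon_singleton, Submodule.mem_bot, key, one_mul]
    exact hz
  obtain ⟨r, hr, hr'⟩ := Set.not_subset.1 hnot
  refine ⟨r, hr, fun I hI a ha => ?_⟩
  by_contra hcon
  have hu' : (Ideal.Quotient.mk I a : R ⧸ I) ≠ 0 :=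
    fun h => hcon (Ideal.Quotient.eq_zero_iff_mem.1 h)
  obtain ⟨P, hP, hle⟩ := exists_le_isAssociatedPrime_of_isNoetherianRing R _ hu'
  refine hr' (Set.mem_biUnion (Set.mem_biUnion hI hP) (hle ?_))
  rw [Submodule.mem_colon_singleton, Submodule.mem_bot, key]; exact ha

/-- Dividing by a nonzerodivisor lowers the depth by one. -/
theorem DepthGE.quotient [IsNoetherianRing R] [IsLocalRing R] :
    ∀ {k : ℕ} {I : Ideal R} {h : R}, DepthGE (IsLocalRing.maximalIdeal R) I k →
      h ∈ IsLocalRing.maximalIdeal R → RegularModulo I h →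
        DepthGE (IsLocalRing.maximalIdeal R) (I ⊔ Ideal.span {h}) (k - 1)
  | 0, I, h, hd, hm, _ => sup_le hd.le ((Ideal.span_singleton_le_iff_mem _).2 hm)
  | 1, I, h, hd, hm, _ => sup_le hd.le ((Ideal.span_singleton_le_iff_mem _).2 hm)
  | k + 2, I, h, ⟨r, hrm, hr, hd⟩, hm, hh => by
    classical
    -- The sequence beginning with r is compared with h through a third element z, regular both
    -- modulo (I, h) and modulo (I, r).
    obtain ⟨r₂, hr₂m, hr₂, -⟩ := id hd
    obtain ⟨z, hzm, hz⟩ := exists_regularModulo (IsLocalRing.maximalIdeal R)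
      {I ⊔ Ideal.span {h}, I ⊔ Ideal.span {r}} (by
        have hr' : ∀ w, (∀ p ∈ IsLocalRing.maximalIdeal R, p * w ∈ I ⊔ Ideal.span {r}) →
            w ∈ I ⊔ Ideal.span {r} := fun w hw => hr₂ w (hw r₂ hr₂m)
        simp only [Finset.mem_insert, Finset.mem_singleton, forall_eq_or_imp, forall_eq]
        refine ⟨fun w hw => ?_, hr'⟩
        by_contra hcon
        -- A class killed by m modulo (I, h) would yield one modulo (I, r), where r₂ excludes it.
        obtain ⟨z', hz', hPz'⟩ := exists_colon_transfer hh hr hrm hcon hw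
        exact hz' (hr' z' hPz'))
    simp only [Finset.mem_insert, Finset.mem_singleton, forall_eq_or_imp, forall_eq] at hz
    obtain ⟨hz₂, hz₃⟩ := hz
    -- Two recursive calls at length k + 1: the first bounds the depth of (I, r, z), hence that of
    -- (I, z) since r is regular there; the second then divides (I, z) by h.
    have e₁ := hd.quotient hzm hz₃
    have e₂ : DepthGE (IsLocalRing.maximalIdeal R) (I ⊔ Ideal.span {z}) (k + 1) :=
      ⟨r, hrm, hz₃.swap hr, by rwa [sup_right_comm]⟩
    have e₃ := e₂.quotient hm (hz₂.swap hh)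
    exact ⟨z, hzm, hz₂, by rwa [sup_right_comm]⟩

theorem DepthGE.of_isRegular [IsLocalRing R] {rs : List R}
    (h : RingTheory.Sequence.IsRegular R rs) :
    DepthGE (IsLocalRing.maximalIdeal R) ⊥ rs.length := by
  have htop : Ideal.ofList rs ≠ ⊤ := fun h' => h.top_ne_smul (by rw [h']; simp)
  have hle : Ideal.ofList rs ≤ IsLocalRing.maximalIdeal R := IsLocalRing.le_maximalIdeal htop
  -- Induction from the end: the last j elements form a regular sequence modulo the preceding ones.
  have hind : ∀ j ≤ rs.length,
      DepthGE (IsLocalRing.maximalIdeal R) (Ideal.ofList (rs.take (rs.length - j))) j := by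
    intro j
    induction j with
    | zero => intro _; simpa [DepthGE] using hle
    | succ j ih =>
      intro hj
      have hlt : rs.length - (j + 1) < rs.length := by omega
      refine ⟨rs[rs.length - (j + 1)], hle (Ideal.subset_span (List.getElem_mem hlt)),
        fun a ha => ?_, ?_⟩
      · have hreg := h.regular_mod_prev _ hlt
        have h1 := isSMulRegular_iff_right_eq_zero_of_smul.1 hreg
          (Submodule.Quotient.mk a)
        rw [← Submodule.Quotient.mk_smul, Submodule.Quotient.mk_eq_zero,
          Submodule.Quotient.mk_eq_zero] at h1
        simpa using h1 (by simpa using ha)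
      · have := ih (by omega)
        have e : rs.length - j = rs.length - (j + 1) + 1 := by omega
        rw [e, List.take_succ_eq_append_getElem hlt, Ideal.ofList_append,
          Ideal.ofList_singleton] at this
        exact this
  simpa using hind rs.length le_rfl

/-- In a Cohen-Macaulay local ring, an element which is divisible by a nonzerodivisor `h` outside
a closed set of codimension two is divisible by `h`. -/
theorem mem_span_singleton_of_isCohenMacaulay [IsNoetherianRing R] [IsLocalRing R]
    (hCM : SingularLagrangian.IsCohenMacaulayLocal R) {J : Ideal R}
    (hJ : ∀ P : Ideal R, P.IsPrime → P.height ≤ 1 → ¬ J ≤ P) {h c : R}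
    (hh : ∀ a, h * a = 0 → a = 0) (hc : ∀ j ∈ J, j * c ∈ Ideal.span {h}) :
    c ∈ Ideal.span {h} := by
  by_contra hcon
  obtain ⟨rs, hrs, hlen⟩ := hCM
  have hm : h ∈ IsLocalRing.maximalIdeal R := by
    by_contra hu
    rw [IsLocalRing.mem_maximalIdeal, mem_nonunits_iff, not_not] at hu
    rw [Ideal.span_singleton_eq_top.2 hu] at hcon
    exact hcon trivial
  have hd := (DepthGE.of_isRegular hrs).quotient hm
    (fun a ha => by simpa using hh a (by simpa using ha))
  rw [bot_sup_eq] at hd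
  -- An associated prime of R/(h) containing J. Its height is at least two because it contains J,
  -- and its coheight is at least dim R - 1 by the depth bound; together they exceed dim R.
  obtain ⟨P, hP, hle, z, hz, hPz⟩ := exists_prime_colon hcon
  have hco := hd.le_coheight ⟨P, hP⟩ z hz hPz
  have hht : ¬ P.height ≤ 1 := fun h1 => hJ P hP h1 fun j hj => hle j (hc j hj)
  have h2 : (2 : ℕ∞) ≤ P.height := by
    have := Order.add_one_le_of_lt (not_le.1 hht)
    simpa [one_add_one_eq_two] using this
  have h3 : P.height = Order.height (⟨P, hP⟩ : PrimeSpectrum R) :=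
    PrimeSpectrum.height_eq_orderHeight ⟨P, hP⟩
  have h4 : ringKrullDim R = ((⨆ a : PrimeSpectrum R, Order.height a + Order.coheight a : ℕ∞)) :=
    Order.krullDim_eq_iSup_height_add_coheight_of_nonempty
  rw [h4] at hlen
  have h5 : ((rs.length : ℕ) : ℕ∞) =
      (⨆ a : PrimeSpectrum R, Order.height a + Order.coheight a : ℕ∞) := by
    exact_mod_cast hlen
  have h6 := le_iSup (fun a : PrimeSpectrum R => Order.height a + Order.coheight a) ⟨P, hP⟩
  rw [← h5, ← h3] at h6
  have h7 : ((2 + (rs.length - 1) : ℕ) : ℕ∞) ≤ (rs.length : ℕ) := by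
    push_cast
    exact (add_le_add h2 (by exact_mod_cast hco)).trans h6
  -- With truncated subtraction this is absurd for the empty sequence as well.
  have h8 : 2 + (rs.length - 1) ≤ rs.length := by exact_mod_cast h7
  omega

/-- In a reduced noetherian ring, an ideal which is contained in no minimal prime contains a
nonzerodivisor. -/
theorem exists_nonzerodivisor_mem [IsNoetherianRing R] [IsReduced R] {J : Ideal R}
    (hJ : ∀ P ∈ minimalPrimes R, ¬ J ≤ P) : ∃ h ∈ J, ∀ a, h * a = 0 → a = 0 := by
  have hnot : ¬ (J : Set R) ⊆ ⋃ P ∈ minimalPrimes R, (P : Set R) := by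
    intro hsub
    obtain ⟨P, hP, hle⟩ := (Ideal.subset_union_prime_finite (f := id)
      (minimalPrimes.finite_of_isNoetherianRing R) ⊥ ⊥
      fun P hP _ _ => hP.1.1).1 hsub
    exact hJ P hP hle
  obtain ⟨h, hh, hh'⟩ := Set.not_subset.1 hnot
  refine ⟨h, hh, fun a ha => ?_⟩
  have : a ∈ sInf (minimalPrimes R) := by
    rw [Ideal.mem_sInf]
    intro P hP
    have hp : P.IsPrime := hP.1.1
    refine (hp.mem_or_mem (ha ▸ P.zero_mem : h * a ∈ P)).resolve_left fun h' => ?_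
    exact hh' (Set.mem_biUnion hP h')
  have hs : sInf (minimalPrimes R) = ⊥ := by
    rw [minimalPrimes, Ideal.sInf_minimalPrimes]; exact nilradical_eq_zero R
  rwa [hs] at this

end LocalAlgebra

/-! ### Alternating maps and dual families -/

section Alternating

variable {R : Type*} [CommRing R]

/-- The slots are released one at a time: `t` in the proof is the set of slots already allowed to
range over the span. -/
theorem MultilinearMap.map_mem_of_mem_span {ι M N : Type*} [Finite ι] [AddCommGroup M]
    [Module R M] [AddCommGroup N] [Module R N] (f : MultilinearMap R (fun _ : ι => M) N)
    (S : Set M) (T : Submodule R N) (hf : ∀ s : ι → M, (∀ i, s i ∈ S) → f s ∈ T) (v : ι → M)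
    (hv : ∀ i, v i ∈ Submodule.span R S) : f v ∈ T := by
  classical
  have := Fintype.ofFinite ι
  have key : ∀ (t : Finset ι) (w : ι → M), (∀ i ∈ t, w i ∈ Submodule.span R S) →
      (∀ i ∉ t, w i ∈ S) → f w ∈ T := by
    intro t
    induction t using Finset.induction_on with
    | empty => exact fun w _ hw => hf w fun i => hw i (Finset.notMem_empty i)
    | insert a t ha ih =>
      intro w hw hw'
      have hupd : ∀ x ∈ Submodule.span R S, f (Function.update w a x) ∈ T := by
        intro x hx
        induction hx using Submodule.span_induction with
        | mem x hx =>
          refine ih _ (fun i hi => ?_) (fun i hi => ?_)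
          · rw [Function.update_of_ne (by rintro rfl; exact ha hi)]
            exact hw i (Finset.mem_insert_of_mem hi)
          · by_cases h : i = a
            · subst h; simpa using hx
            · rw [Function.update_of_ne h]
              exact hw' i (by simp [h, hi])
        | zero => rw [f.map_update_zero]; exact T.zero_mem
        | add x y _ _ hx hy => rw [f.map_update_add]; exact T.add_mem hx hy
        | smul c x _ hx => rw [f.map_update_smul]; exact T.smul_mem c hx
      simpa using hupd (w a) (hw a (Finset.mem_insert_self a t))
  exact key Finset.univ v (fun i _ => hv i) (fun i hi => absurd (Finset.mem_univ i) hi)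

/-- In the Leibniz expansion only the K of the form K' ∘ s survive, and the sign of s occurs twice,
once from the determinant and once from θ. The factor p! appears because K runs over all maps and
not only over increasing ones. -/
theorem AlternatingMap.sum_mul_det {M : Type*} [AddCommGroup M] [Module R M] {p n : ℕ}
    (θ : M [⋀^Fin p]→ₗ[R] R) (u : Fin n → M) (h : R) (K' : Fin p → Fin n) :
    ∑ K : Fin p → Fin n, θ (fun i => u (K i)) *
        Matrix.det (Matrix.of fun i j : Fin p => if K j = K' i then h else 0) =
      (p.factorial : R) * h ^ p * θ (fun i => u (K' i)) := by
  have hdet : ∀ K : Fin p → Fin n,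
      Matrix.det (Matrix.of fun i j : Fin p => if K j = K' i then h else 0) =
        ∑ s : Equiv.Perm (Fin p), if K = K' ∘ s then ((Equiv.Perm.sign s : ℤ) : R) * h ^ p else 0 := by
    intro K
    rw [Matrix.det_apply']
    refine Finset.sum_congr rfl fun s _ => ?_
    by_cases hK : K = K' ∘ s
    · subst hK; simp
    · obtain ⟨j, hj⟩ := Function.ne_iff.1 hK
      rw [if_neg hK, Finset.prod_eq_zero (Finset.mem_univ j), mul_zero]
      simp [show ¬ K j = K' (s j) from hj]
  simp_rw [hdet, Finset.mul_sum]
  rw [Finset.sum_comm]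
  simp only [mul_ite, mul_zero, Finset.sum_ite_eq', Finset.mem_univ, if_true]
  have hs : ∀ s : Equiv.Perm (Fin p),
      θ (fun i => u ((K' ∘ s) i)) * (((Equiv.Perm.sign s : ℤ) : R) * h ^ p) =
        h ^ p * θ (fun i => u (K' i)) := by
    intro s
    have h1 := θ.map_perm (fun i => u (K' i)) s
    have h2 : (fun i => u ((K' ∘ s) i)) = (fun i => u (K' i)) ∘ s := rfl
    rw [h2, h1, Units.smul_def, zsmul_eq_mul]
    have h3 : ((Equiv.Perm.sign s : ℤ) : R) * ((Equiv.Perm.sign s : ℤ) : R) = 1 := by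
      rw [← Int.cast_mul, ← Units.val_mul, Int.units_mul_self]; simp
    linear_combination (h ^ p * θ (fun i => u (K' i))) * h3
  rw [Finset.sum_congr rfl fun s _ => hs s, Finset.sum_const, Finset.card_univ, Fintype.card_perm,
    Fintype.card_fin, nsmul_eq_mul, mul_assoc]

end Alternating

/-! ### Absolutely convergent power series and Weierstrass division -/

section Weierstrass

variable {𝕂 : Type} [RCLike 𝕂]

/-- The monomial function `x ↦ x^α`. -/
def monomialFun {m : ℕ} (α : Fin m → ℕ) (x : Fin m → 𝕂) : 𝕂 := ∏ i, x i ^ α i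

theorem norm_monomialFun_le {m : ℕ} (α : Fin m → ℕ) {x : Fin m → 𝕂} (hx : ‖x‖ ≤ 1) :
    ‖monomialFun α x‖ ≤ 1 := by
  rw [monomialFun, norm_prod]
  refine Finset.prod_le_one (fun i _ => norm_nonneg _) fun i _ => ?_
  rw [norm_pow]
  exact pow_le_one₀ (norm_nonneg _) ((norm_le_pi_norm x i).trans hx)

theorem monomialFun_add {m : ℕ} (α β : Fin m → ℕ) (x : Fin m → 𝕂) :
    monomialFun (α + β) x = monomialFun α x * monomialFun β x := by
  simp [monomialFun, pow_add, Finset.prod_mul_distrib]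

/-- On the closed unit polydisc, `g` is given by a power series, not necessarily reduced, the sum
of whose coefficients is absolutely bounded by `C`. -/
def HasSeries {m : ℕ} (g : (Fin m → 𝕂) → 𝕂) (C : ℝ) : Prop :=
  ∃ (J : Type) (c : J → 𝕂) (α : J → Fin m → ℕ), Summable (fun j => ‖c j‖) ∧
    ∑' j, ‖c j‖ ≤ C ∧ ∀ x, ‖x‖ ≤ 1 → HasSum (fun j => c j * monomialFun (α j) x) (g x)

namespace HasSeries

variable {m : ℕ} {g g' : (Fin m → 𝕂) → 𝕂} {C C' : ℝ}

theorem mono (h : HasSeries g C) (hC : C ≤ C') : HasSeries g C' := by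
  obtain ⟨J, c, α, h₁, h₂, h₃⟩ := h
  exact ⟨J, c, α, h₁, h₂.trans hC, h₃⟩

theorem nonneg (h : HasSeries g C) : 0 ≤ C := by
  obtain ⟨J, c, α, _, h₂, _⟩ := h
  exact (tsum_nonneg fun j => norm_nonneg _).trans h₂

theorem summable_of_norm {J : Type} {c : J → 𝕂} (hc : Summable fun j => ‖c j‖)
    (α : J → Fin m → ℕ) {x : Fin m → 𝕂} (hx : ‖x‖ ≤ 1) :
    Summable fun j => ‖c j * monomialFun (α j) x‖ := by
  refine hc.of_nonneg_of_le (fun _ => norm_nonneg _) fun j => ?_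
  rw [norm_mul]
  exact mul_le_of_le_one_right (norm_nonneg _) (norm_monomialFun_le _ hx)

theorem norm_le (h : HasSeries g C) {x : Fin m → 𝕂} (hx : ‖x‖ ≤ 1) : ‖g x‖ ≤ C := by
  obtain ⟨J, c, α, h₁, h₂, h₃⟩ := h
  rw [← (h₃ x hx).tsum_eq]
  refine (norm_tsum_le_tsum_norm (summable_of_norm h₁ α hx)).trans (le_trans ?_ h₂)
  refine (summable_of_norm h₁ α hx).tsum_le_tsum (fun j => ?_) h₁
  rw [norm_mul]
  exact mul_le_of_le_one_right (norm_nonneg _) (norm_monomialFun_le _ hx)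

/-- Products of terms are indexed by pairs. As `HasSeries` allows repeated exponents, no terms have
to be collected, here or for finite and infinite sums. -/
theorem mul (h : HasSeries g C) (h' : HasSeries g' C') :
    HasSeries (fun x => g x * g' x) (C * C') := by
  have hC := h.nonneg
  obtain ⟨J, c, α, h₁, h₂, h₃⟩ := h
  obtain ⟨J', c', α', h₁', h₂', h₃'⟩ := h'
  have hs : Summable fun j : J × J' => ‖c j.1 * c' j.2‖ := by
    simpa only [norm_mul] using h₁.mul_of_nonneg h₁' (fun _ => norm_nonneg _) fun _ => norm_nonneg _
  refine ⟨J × J', fun j => c j.1 * c' j.2, fun j => α j.1 + α' j.2, hs, ?_, fun x hx => ?_⟩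
  · simp only [norm_mul] at hs ⊢
    rw [← h₁.tsum_mul_tsum h₁' hs]
    exact mul_le_mul h₂ h₂' (tsum_nonneg fun j => norm_nonneg _) hC
  · have hs' := summable_mul_of_summable_norm
      (summable_of_norm h₁ α hx) (summable_of_norm h₁' α' hx)
    have := (h₃ x hx).mul (h₃' x hx) hs'
    have e : (fun j : J × J' => c j.1 * c' j.2 * monomialFun (α j.1 + α' j.2) x) =
        fun j => c j.1 * monomialFun (α j.1) x * (c' j.2 * monomialFun (α' j.2) x) := by
      funext j
      rw [monomialFun_add]
      ring
    exact e ▸ this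

theorem const_mul (h : HasSeries g C) (a : 𝕂) : HasSeries (fun x => a * g x) (‖a‖ * C) := by
  obtain ⟨J, c, α, h₁, h₂, h₃⟩ := h
  refine ⟨J, fun j => a * c j, α, ?_, ?_, fun x hx => ?_⟩
  · simpa only [norm_mul] using h₁.mul_left ‖a‖
  · simp only [norm_mul, tsum_mul_left]
    exact mul_le_mul_of_nonneg_left h₂ (norm_nonneg _)
  · simpa only [mul_assoc] using (h₃ x hx).mul_left a

theorem add (h : HasSeries g C) (h' : HasSeries g' C') :
    HasSeries (fun x => g x + g' x) (C + C') := by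
  obtain ⟨J, c, α, h₁, h₂, h₃⟩ := h
  obtain ⟨J', c', α', h₁', h₂', h₃'⟩ := h'
  have hn : HasSum (fun j : J ⊕ J' => ‖Sum.elim c c' j‖) (∑' j, ‖c j‖ + ∑' j, ‖c' j‖) :=
    HasSum.sum h₁.hasSum h₁'.hasSum
  refine ⟨J ⊕ J', Sum.elim c c', Sum.elim α α', hn.summable, ?_, fun x hx => ?_⟩
  · rw [hn.tsum_eq]; exact add_le_add h₂ h₂'
  · exact HasSum.sum (f := fun j => Sum.elim c c' j * monomialFun (Sum.elim α α' j) x)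
      (h₃ x hx) (h₃' x hx)

theorem tsum {g : ℕ → (Fin m → 𝕂) → 𝕂} {C : ℕ → ℝ} (h : ∀ n, HasSeries (g n) (C n))
    (hC : Summable C) : HasSeries (fun x => ∑' n, g n x) (∑' n, C n) := by
  choose J c α h₁ h₂ h₃ using h
  have hle : ∀ n, 0 ≤ ∑' j, ‖c n j‖ := fun n => tsum_nonneg fun j => norm_nonneg _
  have hs : Summable fun j : Σ n, J n => ‖c j.1 j.2‖ := by
    rw [summable_sigma_of_nonneg fun _ => norm_nonneg _]
    exact ⟨h₁, hC.of_nonneg_of_le hle h₂⟩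
  refine ⟨Σ n, J n, fun j => c j.1 j.2, fun j => α j.1 j.2, hs, ?_, fun x hx => ?_⟩
  · rw [hs.tsum_sigma' h₁]
    exact (hC.of_nonneg_of_le hle h₂).tsum_le_tsum h₂ hC
  · have hs' := (summable_of_norm hs (fun j => α j.1 j.2) hx).of_norm
    have := hs'.hasSum.sigma fun n => h₃ n x hx
    have h := hs'.hasSum
    rw [← this.tsum_eq] at h
    exact h

/-- Subseries. -/
theorem subseries {J : Type} {c : J → 𝕂} (h₁ : Summable fun j => ‖c j‖)
    (h₂ : ∑' j, ‖c j‖ ≤ C) {m' : ℕ} (s : Set J) (β : J → Fin m' → ℕ) :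
    HasSeries (fun x : Fin m' → 𝕂 => ∑' j : s, c j * monomialFun (β j) x) C := by
  refine ⟨s, fun j => c j, fun j => β j, h₁.subtype s, ?_, fun x hx => ?_⟩
  · exact (Summable.tsum_subtype_le _ s (fun _ => norm_nonneg _) h₁).trans h₂
  · exact (summable_of_norm (h₁.subtype s) (fun j : s => β j) hx).of_norm.hasSum

/-- Terms are sorted by whether they contain the first variable. Both parts are subseries, so the
bound C is not enlarged, however often the splitting is repeated. -/
theorem split (g : (Fin (m + 1) → 𝕂) → 𝕂) (h : HasSeries g C) :
    ∃ (q : (Fin (m + 1) → 𝕂) → 𝕂) (r : (Fin m → 𝕂) → 𝕂), HasSeries q C ∧ HasSeries r C ∧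
      ∀ x, ‖x‖ ≤ 1 → g x = x 0 * q x + r (Fin.tail x) := by
  obtain ⟨J, c, α, h₁, h₂, h₃⟩ := h
  set s : Set J := {j | α j 0 ≠ 0} with hs
  refine ⟨_, _, subseries h₁ h₂ s fun j => Function.update (α j) 0 (α j 0 - 1),
    subseries h₁ h₂ sᶜ fun j => Fin.tail (α j), fun x hx => ?_⟩
  have hsum := (summable_of_norm h₁ α hx).of_norm
  rw [← (h₃ x hx).tsum_eq, ← hsum.tsum_subtype_add_tsum_subtype_compl s, ← tsum_mul_left]
  congr 1
  · refine tsum_congr fun j => ?_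
    have hj : α j 0 ≠ 0 := j.2
    obtain ⟨e, he⟩ := Nat.exists_eq_succ_of_ne_zero hj
    simp only [monomialFun, Fin.prod_univ_succ, Function.update_self, ne_eq, Fin.succ_ne_zero,
      not_false_eq_true, Function.update_of_ne, he, Nat.succ_eq_add_one, Nat.add_sub_cancel,
      pow_succ]
    ring
  · refine tsum_congr fun j => ?_
    have hj : α j 0 = 0 := not_not.1 j.2
    simp [monomialFun, Fin.prod_univ_succ, hj, Fin.tail]

theorem split_pow (g : (Fin (m + 1) → 𝕂) → 𝕂) (h : HasSeries g C) (k : ℕ) :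
    ∃ (q : (Fin (m + 1) → 𝕂) → 𝕂) (r : ℕ → (Fin m → 𝕂) → 𝕂), HasSeries q C ∧
      (∀ i, HasSeries (r i) C) ∧
      ∀ x, ‖x‖ ≤ 1 → g x = x 0 ^ k * q x + ∑ i ∈ Finset.range k, r i (Fin.tail x) * x 0 ^ i := by
  induction k with
  | zero =>
    have hC := h.nonneg
    refine ⟨g, fun _ _ => 0, h, fun _ => ?_, fun x _ => by simp⟩
    exact ⟨Empty, fun j => j.elim, fun j => j.elim, summable_empty, by simpa using hC,
      fun x _ => by simp⟩
  | succ k ih =>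
    obtain ⟨q, r, hq, hr, hg⟩ := ih
    obtain ⟨q', r', hq', hr', hg'⟩ := split q hq
    refine ⟨q', fun i => if i = k then r' else r i, hq', fun i => ?_, fun x hx => ?_⟩
    · by_cases hi : i = k
      · simpa [hi] using hr'
      · simpa [hi] using hr i
    · rw [hg x hx, hg' x hx, Finset.sum_range_succ]
      have : ∑ i ∈ Finset.range k, (if i = k then r' else r i) (Fin.tail x) * x 0 ^ i =
          ∑ i ∈ Finset.range k, r i (Fin.tail x) * x 0 ^ i :=
        Finset.sum_congr rfl fun i hi => by rw [if_neg (Finset.mem_range.1 hi).ne]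
      simp only [this, if_true]
      ring

theorem scale (h : HasSeries g C) {a : Fin m → 𝕂} (ha : ‖a‖ ≤ 1) :
    HasSeries (fun x => g (a * x)) C := by
  obtain ⟨J, c, α, h₁, h₂, h₃⟩ := h
  have hle : ∀ j, ‖c j * monomialFun (α j) a‖ ≤ ‖c j‖ := fun j => by
    rw [norm_mul]
    exact mul_le_of_le_one_right (norm_nonneg _) (norm_monomialFun_le _ ha)
  have hs := summable_of_norm h₁ α ha
  refine ⟨J, fun j => c j * monomialFun (α j) a, α, hs,
    (hs.tsum_le_tsum hle h₁).trans h₂, fun x hx => ?_⟩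
  have hax : ‖a * x‖ ≤ 1 := (norm_mul_le a x).trans (mul_le_one₀ ha (norm_nonneg _) hx)
  convert h₃ _ hax using 2 with j
  simp [monomialFun, mul_pow, Finset.prod_mul_distrib, mul_assoc]

/-- A monomial takes the same value at a and b unless it involves a coordinate where b vanishes and
a is at most ε, and then it gains a factor ε. -/
theorem scale_sub_scale (h : HasSeries g C) {a b : Fin m → 𝕂} {ε : ℝ} (hε : 0 ≤ ε)
    (ha : ‖a‖ ≤ 1) (hb : ‖b‖ ≤ 1) (hab : ∀ i, a i = b i ∨ b i = 0 ∧ ‖a i‖ ≤ ε) :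
    HasSeries (fun x => g (a * x) - g (b * x)) (ε * C) := by
  obtain ⟨J, c, α, h₁, h₂, h₃⟩ := h
  have hmono : ∀ β : Fin m → ℕ, ‖(monomialFun β a : 𝕂) - monomialFun β b‖ ≤ ε := by
    intro β
    by_cases hβ : ∃ i, β i ≠ 0 ∧ a i ≠ b i
    · obtain ⟨i, hi, hne⟩ := hβ
      obtain ⟨hbi, hai⟩ := (hab i).resolve_left hne
      have h0 : monomialFun β b = 0 := by
        rw [monomialFun, Finset.prod_eq_zero (Finset.mem_univ i)]
        rw [hbi, zero_pow hi]
      rw [h0, sub_zero, monomialFun, norm_prod,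
        ← Finset.mul_prod_erase _ _ (Finset.mem_univ i)]
      have ha' : ∀ j, ‖a j ^ β j‖ ≤ 1 := fun j => by
        rw [norm_pow]
        exact pow_le_one₀ (norm_nonneg _) ((norm_le_pi_norm a j).trans ha)
      obtain ⟨e, he⟩ := Nat.exists_eq_succ_of_ne_zero hi
      have h1 : ‖a i ^ β i‖ ≤ ε := by
        rw [he, pow_succ, norm_mul, norm_pow]
        refine (mul_le_of_le_one_left (norm_nonneg _) ?_).trans hai
        exact pow_le_one₀ (norm_nonneg _) ((norm_le_pi_norm a i).trans ha)
      refine (mul_le_of_le_one_right (norm_nonneg _) ?_).trans h1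
      exact Finset.prod_le_one (fun j _ => norm_nonneg _) fun j _ => ha' j
    · push Not at hβ
      have : (monomialFun β a : 𝕂) = monomialFun β b := by
        refine Finset.prod_congr rfl fun i _ => ?_
        by_cases hi : β i = 0
        · simp [hi]
        · rw [hβ i hi]
      rw [this, sub_self, norm_zero]
      exact hε
  have hle : ∀ j, ‖c j * (monomialFun (α j) a - monomialFun (α j) b)‖ ≤ ε * ‖c j‖ := fun j => by
    rw [norm_mul, mul_comm]
    exact mul_le_mul_of_nonneg_right (hmono _) (norm_nonneg _)
  have hs : Summable fun j => ‖c j * (monomialFun (α j) a - monomialFun (α j) b)‖ :=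
    (h₁.mul_left ε).of_nonneg_of_le (fun _ => norm_nonneg _) hle
  refine ⟨J, fun j => c j * (monomialFun (α j) a - monomialFun (α j) b), α, hs, ?_,
    fun x hx => ?_⟩
  · refine (hs.tsum_le_tsum hle (h₁.mul_left ε)).trans ?_
    rw [tsum_mul_left]
    exact mul_le_mul_of_nonneg_left h₂ hε
  · have hax : ‖a * x‖ ≤ 1 := (norm_mul_le a x).trans (mul_le_one₀ ha (norm_nonneg _) hx)
    have hbx : ‖b * x‖ ≤ 1 := (norm_mul_le b x).trans (mul_le_one₀ hb (norm_nonneg _) hx)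
    have e : (fun j => c j * (monomialFun (α j) a - monomialFun (α j) b) * monomialFun (α j) x) =
        fun j => c j * monomialFun (α j) (a * x) - c j * monomialFun (α j) (b * x) := by
      funext j
      simp only [monomialFun, Pi.mul_apply, mul_pow, Finset.prod_mul_distrib]
      ring
    exact e ▸ (h₃ _ hax).sub (h₃ _ hbx)

theorem coord_pow (i : Fin m) (k : ℕ) : HasSeries (fun x : Fin m → 𝕂 => x i ^ k) 1 := by
  refine ⟨Unit, fun _ => 1, fun _ => Pi.single i k, Summable.of_finite, ?_, fun x _ => ?_⟩
  · simp
  · have h : monomialFun (Pi.single i k) x = x i ^ k := by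
      rw [monomialFun, Finset.prod_eq_single i]
      · simp
      · intro j _ hj; simp [hj]
      · simp
    simp [h]

/-- Division by a small perturbation of x₀^k. Writing G = x₀^k q + r, the error of dividing by x₀^k
+ f instead of x₀^k is -q f, which becomes the next G. Its bound is halved at each stage, the series
converge geometrically, and the identities telescope to g. -/
theorem division (f : (Fin (m + 1) → 𝕂) → 𝕂) (hf : HasSeries f (1 / 2)) {k : ℕ}
    (g : (Fin (m + 1) → 𝕂) → 𝕂) (hg : HasSeries g C) :
    ∃ (q : (Fin (m + 1) → 𝕂) → 𝕂) (r : ℕ → (Fin m → 𝕂) → 𝕂), HasSeries q (2 * C) ∧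
      (∀ i, HasSeries (r i) (2 * C)) ∧ ∀ x, ‖x‖ ≤ 1 →
        g x = q x * (x 0 ^ k + f x) + ∑ i ∈ Finset.range k, r i (Fin.tail x) * x 0 ^ i := by
  choose q r hq hr hqr using fun (g : (Fin (m + 1) → 𝕂) → 𝕂) (C : ℝ) (h : HasSeries g C) =>
    split_pow g h k
  let G : ∀ n : ℕ, {g : (Fin (m + 1) → 𝕂) → 𝕂 // HasSeries g (C * (1 / 2) ^ n)} := fun n =>
    Nat.rec ⟨g, by simpa using hg⟩ (fun n G => ⟨fun x => -1 * (q G.1 _ G.2 x * f x), by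
      have := ((hq G.1 _ G.2).mul hf).const_mul (-1)
      refine this.mono (le_of_eq ?_)
      rw [norm_neg, norm_one, pow_succ]; ring⟩) n
  have hG : ∀ n x, (G (n + 1)).1 x = -1 * (q (G n).1 _ (G n).2 x * f x) := fun n x => rfl
  have hC : Summable fun n : ℕ => C * (1 / 2 : ℝ) ^ n := summable_geometric_two.mul_left C
  have hC' : ∑' n : ℕ, C * (1 / 2 : ℝ) ^ n = 2 * C := by
    rw [tsum_mul_left, tsum_geometric_two, mul_comm]
  refine ⟨_, fun i => _, hC' ▸ tsum (fun n => hq (G n).1 _ (G n).2) hC,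
    fun i => hC' ▸ tsum (fun n => hr (G n).1 _ (G n).2 i) hC, fun x hx => ?_⟩
  have hsum : ∀ {m' : ℕ} (a : ℕ → (Fin m' → 𝕂) → 𝕂), (∀ n, HasSeries (a n) (C * (1 / 2) ^ n)) →
      ∀ y, ‖y‖ ≤ 1 → Summable fun n => a n y := fun a ha y hy =>
    Summable.of_norm (hC.of_nonneg_of_le (fun _ => norm_nonneg _) fun n => (ha n).norm_le hy)
  have hx' : ‖Fin.tail x‖ ≤ 1 :=
    (pi_norm_le_iff_of_nonneg zero_le_one).2 fun i => (norm_le_pi_norm x i.succ).trans hx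
  have hGs := hsum _ (fun n => (G n).2) x hx
  have e₁ : g x = ∑' n, ((G n).1 x - (G (n + 1)).1 x) := by
    rw [hGs.tsum_sub ((summable_nat_add_iff 1).2 hGs), hGs.tsum_eq_zero_add]
    simp only [add_sub_cancel_right]
    rfl
  have e₂ : ∀ n, (G n).1 x - (G (n + 1)).1 x = q (G n).1 _ (G n).2 x * (x 0 ^ k + f x) +
      ∑ i ∈ Finset.range k, r (G n).1 _ (G n).2 i (Fin.tail x) * x 0 ^ i := fun n => by
    rw [hG, hqr (G n).1 _ (G n).2 x hx]
    ring
  have hqs := hsum _ (fun n => hq (G n).1 _ (G n).2) x hx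
  have hrs := fun i => hsum _ (fun n => hr (G n).1 _ (G n).2 i) (Fin.tail x) hx'
  rw [e₁, tsum_congr e₂, Summable.tsum_add (hqs.mul_right _)
    (summable_sum fun i _ => (hrs i).mul_right _), tsum_mul_right,
    Summable.tsum_finsetSum fun i _ => (hrs i).mul_right _]
  simp only [tsum_mul_right]

/-- Terms are grouped by total degree. A monomial of degree n is the diagonal of an n-linear form of
norm at most one, so the formal series has summable norms. -/
theorem analyticAt (h : HasSeries g C) : AnalyticAt 𝕂 g 0 := by
  obtain ⟨J, c, α, h₁, -, h₃⟩ := h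
  let deg : J → ℕ := fun j => ∑ i, α j i
  have hword : ∀ (n : ℕ) (j : {j // deg j = n}), ∃ w : Fin n → Fin m,
      ∀ x : Fin m → 𝕂, ∏ i, x (w i) = monomialFun (α j) x := by
    rintro n ⟨j, rfl⟩
    -- The word consisting of consecutive blocks, the letter i being repeated as often as its
    -- exponent.
    refine ⟨fun i => (finSigmaFinEquiv.symm i).1, fun x => ?_⟩
    rw [Equiv.prod_comp finSigmaFinEquiv.symm (fun s : (i : Fin m) × Fin (α j i) => x s.1),
      Fintype.prod_sigma]
    simp [monomialFun]
  choose w hw using hword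
  let A : ∀ n, {j // deg j = n} → ContinuousMultilinearMap 𝕂 (fun _ : Fin n => Fin m → 𝕂) 𝕂 :=
    fun n j => (ContinuousMultilinearMap.mkPiAlgebra 𝕂 (Fin n) 𝕂).compContinuousLinearMap
      fun i => ContinuousLinearMap.proj (w n j i)
  have hA : ∀ n j (v : Fin n → Fin m → 𝕂), A n j v = ∏ i, v i (w n j i) := fun n j v => by
    simp [A]
  have hAn : ∀ n j, ‖A n j‖ ≤ 1 := fun n j => by
    refine ContinuousMultilinearMap.opNorm_le_bound zero_le_one fun v => ?_
    rw [hA, norm_prod, one_mul]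
    exact Finset.prod_le_prod (fun _ _ => norm_nonneg _) fun i _ => norm_le_pi_norm _ _
  have hsig : Summable fun j : Σ n, {j // deg j = n} => ‖c j.2‖ :=
    (Equiv.sigmaFiberEquiv deg).summable_iff (f := fun j => ‖c j‖) |>.2 h₁
  have hfib : ∀ n, Summable fun j : {j // deg j = n} => ‖c j‖ := fun n => hsig.sigma_factor n
  have hle : ∀ n j, ‖c j.1 • A n j‖ ≤ ‖c j.1‖ := fun n j => by
    rw [norm_smul]
    exact mul_le_of_le_one_right (norm_nonneg _) (hAn n j)
  have hsA : ∀ n, Summable fun j : {j // deg j = n} => c j.1 • A n j := fun n =>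
    Summable.of_norm ((hfib n).of_nonneg_of_le (fun _ => norm_nonneg _) (hle n))
  let p : FormalMultilinearSeries 𝕂 (Fin m → 𝕂) 𝕂 := fun n => ∑' j, c j.1 • A n j
  have hp : Summable fun n => ‖p n‖ := by
    refine (hsig.sigma).of_nonneg_of_le (fun _ => norm_nonneg _) fun n => ?_
    refine (norm_tsum_le_tsum_norm ?_).trans (Summable.tsum_le_tsum (hle n) ?_ (hfib n))
    all_goals exact (hfib n).of_nonneg_of_le (fun _ => norm_nonneg _) (hle n)
  have hball : HasFPowerSeriesOnBall g p 0 1 := by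
    refine ⟨?_, one_pos, fun {y} hy => ?_⟩
    · have := p.le_radius_of_summable_norm (r := 1) (by simpa using hp)
      simpa using this
    · have hy' : ‖y‖ ≤ 1 := by
        rw [Metric.mem_eball, edist_zero_right] at hy
        have : ‖y‖ₑ ≤ 1 := hy.le
        rw [← ofReal_norm, ENNReal.ofReal_le_one] at this
        exact this
      have hs' := summable_of_norm h₁ α hy'
      have h4 : HasSum (fun j : Σ n, {j // deg j = n} => c j.2 * monomialFun (α j.2) y) (g y) :=
        (Equiv.sigmaFiberEquiv deg).hasSum_iff (f := fun j => c j * monomialFun (α j) y) |>.2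
          (h₃ y hy')
      rw [zero_add]
      refine h4.sigma fun n => ?_
      have h5 := (hsA n).hasSum
      have h6 : HasSum (fun j : {j // deg j = n} => (c j.1 • A n j) fun _ => y)
          (p n fun _ => y) :=
        h5.mapL (ContinuousMultilinearMap.apply 𝕂 (fun _ : Fin n => Fin m → 𝕂) 𝕂 fun _ => y)
      have e : (fun j : {j // deg j = n} => (c j.1 • A n j) fun _ => y) =
          fun j => c j.1 * monomialFun (α j.1) y := by
        funext j
        rw [smul_apply, hA, hw, smul_eq_mul]
      exact e ▸ h6
  exact hball.analyticAt

/-- Each n-linear term is expanded along the standard basis into m^n words, so the radius has to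
shrink by a factor m for absolute summability. -/
theorem exists_of_analyticAt {g : (Fin m → 𝕂) → 𝕂} (hg : AnalyticAt 𝕂 g 0) :
    ∃ ρ₀ > 0, ∀ ρ : ℝ, 0 < ρ → ρ ≤ ρ₀ →
      ∃ C, HasSeries (fun x => g ((ρ : 𝕂) • x)) C := by
  obtain ⟨p, r, hp⟩ := hg
  obtain ⟨r', hr'0, hr'⟩ := ENNReal.lt_iff_exists_nnreal_btwn.1 hp.r_pos
  have hr'pos : (0 : ℝ) < r' := by exact_mod_cast hr'0
  have hps := p.summable_norm_mul_pow (hr'.trans_le hp.r_le)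
  -- This radius gives ρ m ≤ r'; the denominator m + 1 also covers m = 0.
  refine ⟨r' / (m + 1), by positivity, fun ρ hρ hρr => ?_⟩
  have hρm : ρ * m ≤ r' := by
    rw [le_div_iff₀ (by positivity)] at hρr
    nlinarith
  have hρr' : ρ ≤ r' := hρr.trans (div_le_self hr'pos.le (by linarith [(Nat.cast_nonneg m : (0:ℝ) ≤ m)]))
  let c : (Σ n, (Fin n → Fin m)) → 𝕂 := fun w =>
    (ρ : 𝕂) ^ w.1 * p w.1 fun i => Pi.single (w.2 i) 1
  let α : (Σ n, (Fin n → Fin m)) → Fin m → ℕ := fun w i =>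
    (Finset.univ.filter fun a => w.2 a = i).card
  have hα : ∀ w (x : Fin m → 𝕂), monomialFun (α w) x = ∏ i, x (w.2 i) := fun w x => by
    simp only [monomialFun, α]
    rw [← Finset.prod_fiberwise_of_maps_to (g := w.2) (fun _ _ => Finset.mem_univ _)]
    refine Finset.prod_congr rfl fun i _ => ?_
    rw [Finset.prod_congr rfl fun a ha => by rw [(Finset.mem_filter.1 ha).2], Finset.prod_const]
  have hc : ∀ w, ‖c w‖ ≤ ρ ^ w.1 * ‖p w.1‖ := fun w => by
    simp only [c, norm_mul, norm_pow, RCLike.norm_ofReal, abs_of_pos hρ]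
    refine mul_le_mul_of_nonneg_left ?_ (by positivity)
    refine ((p w.1).le_opNorm _).trans ?_
    simp [Pi.norm_single]
  have hcs : Summable fun w => ‖c w‖ := by
    have : Summable fun w : Σ n, (Fin n → Fin m) => ρ ^ w.1 * ‖p w.1‖ := by
      rw [summable_sigma_of_nonneg fun _ => by positivity]
      refine ⟨fun n => Summable.of_finite, ?_⟩
      refine hps.of_nonneg_of_le (fun n => tsum_nonneg fun _ => by positivity) fun n => ?_
      have e : ∑' w : Fin n → Fin m, ρ ^ n * ‖p n‖ = (m : ℝ) ^ n * (ρ ^ n * ‖p n‖) := by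
        rw [tsum_fintype, Finset.sum_const, nsmul_eq_mul, Finset.card_univ, Fintype.card_fun,
          Fintype.card_fin, Fintype.card_fin, Nat.cast_pow]
      refine e.le.trans ?_
      calc (m : ℝ) ^ n * (ρ ^ n * ‖p n‖) = ‖p n‖ * (ρ * m) ^ n := by rw [mul_pow]; ring
        _ ≤ ‖p n‖ * r' ^ n := by gcongr
    exact this.of_nonneg_of_le (fun _ => norm_nonneg _) hc
  refine ⟨_, _, c, α, hcs, le_rfl, fun x hx => ?_⟩
  have hy : (ρ : 𝕂) • x ∈ Metric.eball (0 : Fin m → 𝕂) r := by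
    rw [Metric.mem_eball, edist_zero_right]
    refine lt_of_le_of_lt ?_ hr'
    rw [← ofReal_norm, norm_smul, RCLike.norm_ofReal, abs_of_pos hρ,
      ← ENNReal.ofReal_coe_nnreal]
    exact ENNReal.ofReal_le_ofReal ((mul_le_of_le_one_right hρ.le hx).trans hρr')
  have hsum := hp.hasSum hy
  rw [zero_add] at hsum
  have hs' := (summable_of_norm hcs α hx).of_norm
  have hinner : ∀ n, HasSum (fun w : Fin n → Fin m => c ⟨n, w⟩ * monomialFun (α ⟨n, w⟩) x)
      (p n fun _ => (ρ : 𝕂) • x) := fun n => by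
    have hx : (fun _ : Fin n => (ρ : 𝕂) • x) =
        fun _ => ∑ s, ((ρ : 𝕂) * x s) • (Pi.single s 1 : Fin m → 𝕂) := by
      funext _ i
      simp [Finset.sum_apply, Pi.single_apply]
    have e : (p n fun _ => (ρ : 𝕂) • x) =
        ∑ w : Fin n → Fin m, c ⟨n, w⟩ * monomialFun (α ⟨n, w⟩) x := by
      rw [hx, (p n).map_sum]
      refine Finset.sum_congr rfl fun w _ => ?_
      rw [(p n).map_smul_univ, hα]
      simp only [c, Finset.prod_mul_distrib, Finset.prod_const, Finset.card_univ,
        Fintype.card_fin, smul_eq_mul]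
      ring
    rw [e]
    exact hasSum_fintype _
  have := (hs'.hasSum.sigma hinner).unique hsum
  have h := hs'.hasSum
  rwa [this] at h

end HasSeries

/-- **Weierstrass division** for convergent power series, in the variables `x 0` and
`Fin.tail x`. -/
theorem exists_weierstrass_division {m k : ℕ} {f g : (Fin (m + 1) → 𝕂) → 𝕂} {u : 𝕂 → 𝕂}
    (hf : AnalyticAt 𝕂 f 0) (hg : AnalyticAt 𝕂 g 0) (hu : AnalyticAt 𝕂 u 0) (hu0 : u 0 ≠ 0)
    (hfu : ∀ᶠ t in 𝓝 0, f (Fin.cons t 0) = t ^ k * u t) :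
    ∃ (q : (Fin (m + 1) → 𝕂) → 𝕂) (r : ℕ → (Fin m → 𝕂) → 𝕂), AnalyticAt 𝕂 q 0 ∧
      (∀ i, AnalyticAt 𝕂 (r i) 0) ∧
      ∀ᶠ x in 𝓝 0, g x = q x * f x + ∑ i ∈ Finset.range k, r i (Fin.tail x) * x 0 ^ i := by
  have hU : AnalyticAt 𝕂 (fun x : Fin (m + 1) → 𝕂 => u (x 0)) 0 :=
    AnalyticAt.fun_comp (g := u) (f := fun x : Fin (m + 1) → 𝕂 => x 0) hu
      ((ContinuousLinearMap.proj (R := 𝕂) (φ := fun _ : Fin (m + 1) => 𝕂) 0).analyticAt 0)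
  obtain ⟨ρf, hρf, hρf'⟩ := HasSeries.exists_of_analyticAt hf
  obtain ⟨ρg, hρg, hρg'⟩ := HasSeries.exists_of_analyticAt hg
  obtain ⟨ρu, hρu, hρu'⟩ := HasSeries.exists_of_analyticAt hU
  obtain ⟨ρe, hρe, hρe'⟩ := Metric.eventually_nhds_iff.1 hfu
  obtain ⟨ρ₀, hρ₀, hle⟩ : ∃ ρ₀ > 0, ρ₀ ≤ ρf ∧ ρ₀ ≤ ρg ∧ ρ₀ ≤ ρu ∧ ρ₀ < ρe := by
    refine ⟨min (min ρf ρg) (min ρu (ρe / 2)), by positivity, ?_, ?_, ?_, ?_⟩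
    · simp
    · simp
    · simp
    · exact lt_of_le_of_lt (min_le_right _ _)
        (lt_of_le_of_lt (min_le_right _ _) (half_lt_self hρe))
  obtain ⟨Cf, hCf⟩ := hρf' ρ₀ hρ₀ hle.1
  obtain ⟨Cg, hCg⟩ := hρg' ρ₀ hρ₀ hle.2.1
  obtain ⟨Cu, hCu⟩ := hρu' ρ₀ hρ₀ hle.2.2.1
  have hCf0 := hCf.nonneg
  have hCu0 := hCu.nonneg
  have hu0' : 0 < ‖u 0‖ := norm_pos_iff.2 hu0
  -- Shrinking the first coordinate by τ makes u close to the constant u(0).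
  obtain ⟨τ, hτ, hτ1, hτu⟩ : ∃ τ : ℝ, 0 < τ ∧ τ ≤ 1 ∧ τ * Cu ≤ ‖u 0‖ / 4 := by
    refine ⟨min 1 (‖u 0‖ / (4 * (Cu + 1))), by positivity, min_le_left _ _, ?_⟩
    calc min 1 (‖u 0‖ / (4 * (Cu + 1))) * Cu ≤ ‖u 0‖ / (4 * (Cu + 1)) * (Cu + 1) := by
          gcongr
          · exact min_le_right _ _
          · linarith
      _ = ‖u 0‖ / 4 := by field_simp
  -- The leading coefficient after rescaling: on the first axis f becomes approximately κ x₀^k. The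
  -- scale ρ of the other coordinates is chosen only afterwards, since it must be small relative to
  -- κ.
  set κ : 𝕂 := ((ρ₀ * τ : ℝ) : 𝕂) ^ k * u 0 with hκ
  have hρτ : ((ρ₀ * τ : ℝ) : 𝕂) ≠ 0 := RCLike.ofReal_ne_zero.2 (by positivity)
  have hκ0 : κ ≠ 0 := mul_ne_zero (pow_ne_zero _ hρτ) hu0
  have hκ0' : 0 < ‖κ‖ := norm_pos_iff.2 hκ0
  obtain ⟨ρ, hρ, hρ1, hρκ⟩ : ∃ ρ : ℝ, 0 < ρ ∧ ρ ≤ 1 ∧ ρ * Cf ≤ ‖κ‖ / 4 := by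
    refine ⟨min 1 (‖κ‖ / (4 * (Cf + 1))), by positivity, min_le_left _ _, ?_⟩
    calc min 1 (‖κ‖ / (4 * (Cf + 1))) * Cf ≤ ‖κ‖ / (4 * (Cf + 1)) * (Cf + 1) := by
          gcongr
          · exact min_le_right _ _
          · linarith
      _ = ‖κ‖ / 4 := by field_simp
  let a : Fin (m + 1) → 𝕂 := Fin.cons (τ : 𝕂) fun _ => (ρ : 𝕂)
  let b : Fin (m + 1) → 𝕂 := Fin.cons (τ : 𝕂) 0
  let w : Fin (m + 1) → 𝕂 := fun _ => (τ : 𝕂)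
  have nτ : ‖(τ : 𝕂)‖ = τ := by rw [RCLike.norm_ofReal, abs_of_pos hτ]
  have nρ : ‖(ρ : 𝕂)‖ = ρ := by rw [RCLike.norm_ofReal, abs_of_pos hρ]
  have ha : ‖a‖ ≤ 1 := (pi_norm_le_iff_of_nonneg zero_le_one).2 fun i => by
    refine Fin.cases ?_ (fun i => ?_) i
    · simpa [a, nτ] using hτ1
    · simpa [a, nρ] using hρ1
  have hb : ‖b‖ ≤ 1 := (pi_norm_le_iff_of_nonneg zero_le_one).2 fun i => by
    refine Fin.cases ?_ (fun i => ?_) i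
    · simpa [b, nτ] using hτ1
    · simp [b]
  have hs₁ := hCf.scale_sub_scale hρ.le ha hb fun i => by
    refine Fin.cases (Or.inl ?_) (fun i => Or.inr ⟨?_, ?_⟩) i <;> simp [a, b, nρ]
  have hs₂ := hCu.scale_sub_scale (a := w) (b := 0) hτ.le
    ((pi_norm_le_iff_of_nonneg zero_le_one).2 fun i => by simpa [w, nτ] using hτ1)
    (by simp) fun i => Or.inr ⟨rfl, nτ.le⟩
  -- The relative error. The first term measures the variation of u along the axis, the second the
  -- variation of f off the axis; each contributes at most 1/4.
  set F : (Fin (m + 1) → 𝕂) → 𝕂 := fun x => (u 0)⁻¹ *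
      (x 0 ^ k * (u (((ρ₀ : 𝕂) • (w * x)) 0) - u (((ρ₀ : 𝕂) • (0 * x)) 0))) +
      κ⁻¹ * (f ((ρ₀ : 𝕂) • (a * x)) - f ((ρ₀ : 𝕂) • (b * x))) with hF
  have hFs : HasSeries F (1 / 2) := by
    refine ((((HasSeries.coord_pow 0 k).mul hs₂).const_mul (u 0)⁻¹).add
      (hs₁.const_mul κ⁻¹)).mono ?_
    rw [norm_inv, norm_inv, one_mul]
    have e₁ : ‖u 0‖⁻¹ * (τ * Cu) ≤ 1 / 4 := by
      rw [inv_mul_le_iff₀ hu0']; linarith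
    have e₂ : ‖κ‖⁻¹ * (ρ * Cf) ≤ 1 / 4 := by
      rw [inv_mul_le_iff₀ hκ0']; linarith
    linarith
  have hfF : ∀ x, ‖x‖ ≤ 1 → f ((ρ₀ : 𝕂) • (a * x)) = κ * (x 0 ^ k + F x) := by
    intro x hx
    have hb' : (ρ₀ : 𝕂) • (b * x) = Fin.cons ((ρ₀ * τ : ℝ) * x 0) 0 := by
      funext i
      refine Fin.cases ?_ (fun i => ?_) i <;> simp [b, mul_assoc]
    have hfb : f ((ρ₀ : 𝕂) • (b * x)) =
        (((ρ₀ * τ : ℝ) : 𝕂) * x 0) ^ k * u (((ρ₀ * τ : ℝ) : 𝕂) * x 0) := by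
      rw [hb']
      apply hρe'
      rw [dist_zero_right, norm_mul, RCLike.norm_ofReal, abs_of_pos (by positivity)]
      have h0 : ‖x 0‖ ≤ 1 := (norm_le_pi_norm x 0).trans hx
      have h1 : ρ₀ * τ * ‖x 0‖ ≤ ρ₀ * 1 * 1 := by gcongr
      linarith [hle.2.2.2]
    have e₁ : ((ρ₀ : 𝕂) • (w * x)) 0 = ((ρ₀ * τ : ℝ) : 𝕂) * x 0 := by
      simp [w, mul_assoc]
    have e₂ : ((ρ₀ : 𝕂) • (0 * x)) 0 = (0 : 𝕂) := by simp
    simp only [hF]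
    rw [e₁, e₂, hfb]
    have hk : κ * κ⁻¹ = 1 := mul_inv_cancel₀ hκ0
    have hk' : κ * (u 0)⁻¹ = ((ρ₀ * τ : ℝ) : 𝕂) ^ k := by
      rw [hκ, mul_assoc, mul_inv_cancel₀ hu0, mul_one]
    linear_combination -(f ((ρ₀ : 𝕂) • (a * x)) -
        (((ρ₀ * τ : ℝ) : 𝕂) * x 0) ^ k * u (((ρ₀ * τ : ℝ) : 𝕂) * x 0)) * hk -
      x 0 ^ k * (u (((ρ₀ * τ : ℝ) : 𝕂) * x 0) - u 0) * hk' - x 0 ^ k * hκ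
  obtain ⟨q, r, hq, hr, hqr⟩ := HasSeries.division (k := k) F hFs _ (hCg.scale ha)
  -- The inverse of the anisotropic rescaling, and `T'` the same on the remaining coordinates.
  let T : (Fin (m + 1) → 𝕂) →L[𝕂] (Fin (m + 1) → 𝕂) :=
    ContinuousLinearMap.pi fun i =>
      ((ρ₀ : 𝕂) * a i)⁻¹ • ContinuousLinearMap.proj (R := 𝕂) (φ := fun _ : Fin (m + 1) => 𝕂) i
  let T' : (Fin m → 𝕂) →L[𝕂] (Fin m → 𝕂) := ((ρ₀ : 𝕂) * (ρ : 𝕂))⁻¹ • ContinuousLinearMap.id 𝕂 _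
  have hρ₀' : (ρ₀ : 𝕂) ≠ 0 := RCLike.ofReal_ne_zero.2 hρ₀.ne'
  have hτ' : (τ : 𝕂) ≠ 0 := RCLike.ofReal_ne_zero.2 hτ.ne'
  have hρ' : (ρ : 𝕂) ≠ 0 := RCLike.ofReal_ne_zero.2 hρ.ne'
  have hT : ∀ x, (ρ₀ : 𝕂) • (a * T x) = x := fun x => by
    funext i
    have hai : a i ≠ 0 := by
      refine Fin.cases ?_ (fun i => ?_) i
      · simpa [a] using hτ'
      · simpa [a] using hρ'
    simp only [T, Pi.smul_apply, Pi.mul_apply, ContinuousLinearMap.coe_pi', smul_eq_mul,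
      smul_apply, ContinuousLinearMap.proj_apply]
    field_simp
  have hT' : ∀ x, Fin.tail (T x) = T' (Fin.tail x) := fun x => by
    funext i
    simp [T, T', a, Fin.tail]
  refine ⟨fun x => κ⁻¹ * q (T x), fun i y => ((ρ₀ : 𝕂) * τ)⁻¹ ^ i * r i (T' y), ?_, fun i => ?_, ?_⟩
  · have : AnalyticAt 𝕂 q (T 0) := by rw [map_zero]; exact hq.analyticAt
    exact analyticAt_const.mul (this.fun_comp (T.analyticAt 0))
  · have : AnalyticAt 𝕂 (r i) (T' 0) := by rw [map_zero]; exact (hr i).analyticAt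
    exact analyticAt_const.mul (this.fun_comp (T'.analyticAt 0))
  · have hev : ∀ᶠ x in 𝓝 0, ‖T x‖ ≤ 1 := by
      have : Tendsto (fun x => ‖T x‖) (𝓝 0) (𝓝 ‖T 0‖) := (T.continuous.norm).tendsto 0
      rw [map_zero, norm_zero] at this
      exact (this.eventually (eventually_lt_nhds one_pos)).mono fun x hx => hx.le
    filter_upwards [hev] with x hx
    have h := hqr (T x) hx
    have h2 := hfF (T x) hx
    rw [hT] at h h2
    rw [h, h2]
    have e : (T x) 0 = ((ρ₀ : 𝕂) * τ)⁻¹ * x 0 := by simp [T, a]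
    congr 1
    · field_simp
    · refine Finset.sum_congr rfl fun i _ => ?_
      rw [hT', e]
      ring

end Weierstrass

/-! ### Primes in extensions generated by one element -/

section OneElement

open Polynomial

variable {A B : Type*} [CommRing A] [CommRing B] (ι : B →+* A)

/-- Going up: a chain of primes above the contraction of Q lifts to a chain above Q. Integrality is
needed only modulo an ideal P₀ inside Q, which is how Weierstrass division supplies it. -/
theorem coheight_comap_le_coheight (P₀ : Ideal A)
    (hint : ((Ideal.Quotient.mk P₀).comp ι).IsIntegral) (Q : PrimeSpectrum A)
    (hQ : P₀ ≤ Q.asIdeal) : Order.coheight (PrimeSpectrum.comap ι Q) ≤ Order.coheight Q := by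
  have key : ∀ (n : ℕ) (Q : PrimeSpectrum A), P₀ ≤ Q.asIdeal →
      (n : ℕ∞) ≤ Order.coheight (PrimeSpectrum.comap ι Q) → (n : ℕ∞) ≤ Order.coheight Q := by
    intro n
    induction n with
    | zero => intros; simp
    | succ n ih =>
      intro Q hQ hn
      obtain ⟨q', hlt, hq'⟩ : ∃ q' > PrimeSpectrum.comap ι Q, (n : ℕ∞) ≤ Order.coheight q' := by
        by_contra hcon
        push Not at hcon
        have := Order.coheight_le_coe_iff.2 hcon
        have := hn.trans this
        exact absurd (Nat.cast_le.1 this) (by omega)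
      let _ : Algebra B (A ⧸ P₀) := ((Ideal.Quotient.mk P₀).comp ι).toAlgebra
      have : Algebra.IsIntegral B (A ⧸ P₀) := ⟨hint⟩
      have hmapcomap : (Q.asIdeal.map (Ideal.Quotient.mk P₀)).comap (Ideal.Quotient.mk P₀) =
          Q.asIdeal := by
        rw [Ideal.comap_map_of_surjective _ Ideal.Quotient.mk_surjective, ← RingHom.ker_eq_comap_bot,
          Ideal.mk_ker, sup_eq_left]
        exact hQ
      have hle : (Q.asIdeal.map (Ideal.Quotient.mk P₀)).comap (algebraMap B (A ⧸ P₀)) ≤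
          q'.asIdeal := by
        change (Q.asIdeal.map (Ideal.Quotient.mk P₀)).comap ((Ideal.Quotient.mk P₀).comp ι) ≤ _
        rw [← Ideal.comap_comap, hmapcomap]
        exact hlt.le
      obtain ⟨Q'', hge, hprime, hover⟩ :=
        Ideal.exists_ideal_over_prime_of_isIntegral q'.asIdeal _ hle
      let Q' : PrimeSpectrum A := ⟨Q''.comap (Ideal.Quotient.mk P₀), inferInstance⟩
      have hQQ' : Q.asIdeal ≤ Q'.asIdeal := by
        rw [← hmapcomap]; exact Ideal.comap_mono hge
      have hQ'q : PrimeSpectrum.comap ι Q' = q' := by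
        ext1
        rw [← hover]
        rfl
      have hlt' : Q < Q' := by
        refine lt_of_le_of_ne hQQ' fun h => ?_
        rw [h, hQ'q] at hlt
        exact lt_irrefl _ hlt
      have := ih Q' (hQ.trans hQQ') (hQ'q ▸ hq')
      calc ((n + 1 : ℕ) : ℕ∞) = n + 1 := by push_cast; rfl
        _ ≤ Order.coheight Q' + 1 := by gcongr
        _ ≤ Order.coheight Q := Order.coheight_add_one_le hlt'
  exact ENat.forall_natCast_le_iff_le.1 fun n hn => key n Q hQ hn

/-- Long division with a factor of the leading coefficient in place of each division by it. The
exponent depends only on the degree bound N, so one multiplier serves all such r. -/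
theorem exists_pseudo_division (G : B[X]) (hG : G.natDegree ≠ 0) (r : B[X]) (N : ℕ)
    (hr : r.natDegree ≤ N) : ∃ s r₂ : B[X], C G.leadingCoeff ^ (N + 1) * r = s * G + r₂ ∧
      r₂.natDegree < G.natDegree := by
  induction N generalizing r with
  | zero => exact ⟨0, C G.leadingCoeff ^ (0 + 1) * r, by ring, by
      rw [← C_pow]
      refine lt_of_le_of_lt (natDegree_C_mul_le _ _) ?_
      omega⟩
  | succ N ih =>
    by_cases hd : G.natDegree ≤ N + 1
    · set r' : B[X] := C G.leadingCoeff * r - C (r.coeff (N + 1)) * X ^ (N + 1 - G.natDegree) * G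
        with hr'
      have hdeg : r'.natDegree ≤ N := by
        rw [natDegree_le_iff_coeff_eq_zero]
        intro i hi
        rw [hr', coeff_sub, coeff_C_mul, mul_assoc, coeff_C_mul, coeff_X_pow_mul']
        rcases Nat.lt_or_ge (N + 1) i with h | h
        · rw [coeff_eq_zero_of_natDegree_lt (lt_of_le_of_lt hr h), if_pos (by omega),
            coeff_eq_zero_of_natDegree_lt (p := G) (by omega)]
          ring
        · obtain rfl : i = N + 1 := by omega
          rw [if_pos (by omega), Nat.sub_sub_self hd, ← leadingCoeff]
          ring
      obtain ⟨s, r₂, h₁, h₂⟩ := ih r' hdeg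
      refine ⟨s + C G.leadingCoeff ^ (N + 1) * (C (r.coeff (N + 1)) * X ^ (N + 1 - G.natDegree)),
        r₂, ?_, h₂⟩
      have : C G.leadingCoeff ^ (N + 1 + 1) * r = C G.leadingCoeff ^ (N + 1) * r' +
          C G.leadingCoeff ^ (N + 1) * (C (r.coeff (N + 1)) * X ^ (N + 1 - G.natDegree)) * G := by
        rw [hr']; ring
      rw [this, h₁]
      ring
    · refine ⟨0, C G.leadingCoeff ^ (N + 1 + 1) * r, by ring, ?_⟩
      rw [← C_pow]
      exact lt_of_le_of_lt (natDegree_C_mul_le _ _) (by omega)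

/-- G lifts a minimal polynomial of t over the fraction field of B/(P ∩ B), with denominators
cleared; the monic W only guarantees that some nonzero relation exists. The derivative of G has
lower degree and nonzero leading coefficient in characteristic zero, so by minimality it does not
vanish at t modulo P. A pseudo-remainder that vanishes at t modulo P has all its coefficients in P
for the same reason. -/
theorem exists_generator_of_monic (t : A) (P : Ideal A) [P.IsPrime]
    (hchar : ∀ k : ℕ, k ≠ 0 → (k : A) ∉ P) (W : B[X]) (hW : W.Monic) (hWP : W.eval₂ ι t ∈ P) :
    ∃ (G : B[X]) (l : B), ι l ∉ P ∧ G.eval₂ ι t ∈ P ∧ G.derivative.eval₂ ι t ∉ P ∧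
      ∀ (r : B[X]) (N : ℕ), r.natDegree ≤ N → r.eval₂ ι t ∈ P →
        ∃ s r₂ : B[X], C l ^ (N + 1) * r = s * G + r₂ ∧ ∀ i, ι (r₂.coeff i) ∈ P := by
  classical
  set P' : Ideal B := P.comap ι with hP'
  have hP'p : P'.IsPrime := inferInstance
  set π : B →+* B ⧸ P' := Ideal.Quotient.mk P' with hπ
  have hmap : ∀ r : B[X], r.map π = 0 ↔ ∀ i, ι (r.coeff i) ∈ P := fun r => by
    rw [Polynomial.ext_iff]
    refine forall_congr' fun i => ?_
    rw [coeff_map, coeff_zero, hπ, Ideal.Quotient.eq_zero_iff_mem]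
    rfl
  have heval : ∀ r r' : B[X], r.map π = r'.map π → r.eval₂ ι t ∈ P → r'.eval₂ ι t ∈ P := by
    intro r r' h hr
    have h0 : (r - r').map π = 0 := by rw [Polynomial.map_sub, h, sub_self]
    have h1 : (r - r').eval₂ ι t ∈ P := by
      rw [eval₂_eq_sum]
      exact sum_mem fun i _ => Ideal.mul_mem_right _ _ ((hmap _).1 h0 i)
    rw [eval₂_sub] at h1
    simpa using sub_mem hr h1
  let S : ℕ → Prop := fun d => ∃ r : B[X], r.map π ≠ 0 ∧ r.eval₂ ι t ∈ P ∧ (r.map π).natDegree = d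
  have hex : ∃ d, S d := ⟨_, W, (hW.map π).ne_zero, hWP, rfl⟩
  obtain ⟨G₀, hG₀, hG₀P, hG₀d⟩ := Nat.find_spec hex
  have hmin : ∀ r : B[X], r.eval₂ ι t ∈ P → (r.map π).natDegree < (G₀.map π).natDegree →
      r.map π = 0 := by
    intro r hr hd
    by_contra hne
    exact Nat.find_min hex (hG₀d ▸ hd) ⟨r, hne, hr, rfl⟩
  -- The lift is replaced by one of the same degree as its reduction, so that its leading
  -- coefficient survives modulo P.
  obtain ⟨G, hGmap, hGd⟩ := exists_natDegree_eq_of_mem_lifts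
    ((mem_lifts (f := π) (G₀.map π)).2 ⟨G₀, rfl⟩)
  have hG : G.map π ≠ 0 := hGmap ▸ hG₀
  have hGP : G.eval₂ ι t ∈ P := heval _ _ hGmap.symm hG₀P
  rw [← hGmap] at hmin hGd
  have hGd0 : G.natDegree ≠ 0 := by
    intro h0
    obtain ⟨b, hb⟩ := natDegree_eq_zero.1 h0
    rw [← hb, eval₂_C] at hGP
    apply hG
    rw [← hb, map_C, hπ, Ideal.Quotient.eq_zero_iff_mem.2 (show b ∈ P' from hGP), C_0]
  have hlead : π G.leadingCoeff ≠ 0 := by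
    rw [leadingCoeff, hGd, ← coeff_map]
    exact leadingCoeff_ne_zero.2 hG
  have hl : ι G.leadingCoeff ∉ P := fun h => hlead (Ideal.Quotient.eq_zero_iff_mem.2 h)
  refine ⟨G, G.leadingCoeff, hl, hGP, fun hder => ?_, fun r N hr hrP => ?_⟩
  · have h1 : (G.derivative.map π).natDegree < (G.map π).natDegree := by
      refine lt_of_le_of_lt natDegree_map_le ?_
      rw [← hGd]
      exact natDegree_derivative_lt hGd0
    have h2 := (hmap _).1 (hmin _ hder h1) (G.natDegree - 1)
    rw [coeff_derivative, Nat.sub_add_cancel (Nat.pos_of_ne_zero hGd0), map_mul] at h2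
    rcases (inferInstance : P.IsPrime).mem_or_mem h2 with h | h
    · exact hl h
    · refine hchar G.natDegree hGd0 ?_
      have e : ((G.natDegree - 1 : ℕ) : B) + 1 = (G.natDegree : B) := by
        rw [← Nat.cast_add_one, Nat.sub_add_cancel (Nat.pos_of_ne_zero hGd0)]
      rwa [e, map_natCast] at h
  · obtain ⟨s, r₂, h₁, h₂⟩ := exists_pseudo_division G hGd0 r N hr
    refine ⟨s, r₂, h₁, (hmap _).1 (hmin r₂ ?_ ?_)⟩
    · have e : r₂ = C G.leadingCoeff ^ (N + 1) * r - s * G := by rw [h₁]; ring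
      rw [e, eval₂_sub, eval₂_mul, eval₂_mul]
      exact sub_mem (Ideal.mul_mem_left _ _ hrP) (Ideal.mul_mem_left _ _ hGP)
    · refine lt_of_le_of_lt natDegree_map_le ?_
      rwa [← hGd]

theorem Derivation.eval₂_eq (D : Derivation ℤ A A) (t : A) (h₀ : ∀ b, D (ι b) = 0) (h₁ : D t = 1)
    (G : B[X]) : D (G.eval₂ ι t) = G.derivative.eval₂ ι t := by
  induction G using Polynomial.induction_on' with
  | add p q hp hq => rw [eval₂_add, map_add, hp, hq, derivative_add, eval₂_add]
  | monomial n b =>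
    rw [eval₂_monomial, Derivation.leibniz, h₀, Derivation.leibniz_pow, h₁, derivative_monomial,
      eval₂_monomial]
    simp [mul_assoc]

end OneElement

/-! ### The ring of germs of analytic functions on a normed space -/

noncomputable section PowerGerm

variable (𝕂 : Type) [RCLike 𝕂] (E : Type) [NormedAddCommGroup E] [NormedSpace 𝕂 E]

/-- Germs at the origin of analytic functions. -/
def PowerGerm : Subring (Germ (𝓝 (0 : E)) 𝕂) where
  carrier := {g | ∃ f : E → 𝕂, AnalyticAt 𝕂 f 0 ∧ (f : Germ (𝓝 (0 : E)) 𝕂) = g}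
  mul_mem' := by
    rintro _ _ ⟨f, hf, rfl⟩ ⟨g, hg, rfl⟩
    exact ⟨f * g, hf.mul hg, rfl⟩
  one_mem' := ⟨fun _ => 1, analyticAt_const, rfl⟩
  add_mem' := by
    rintro _ _ ⟨f, hf, rfl⟩ ⟨g, hg, rfl⟩
    exact ⟨f + g, hf.add hg, rfl⟩
  zero_mem' := ⟨fun _ => 0, analyticAt_const, rfl⟩
  neg_mem' := by
    rintro _ ⟨f, hf, rfl⟩
    exact ⟨-f, hf.neg, rfl⟩

namespace PowerGerm

variable {𝕂 E}

/-- The germ of an analytic function. -/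
def mk (f : E → 𝕂) (hf : AnalyticAt 𝕂 f 0) : PowerGerm 𝕂 E := ⟨(f : Germ (𝓝 (0 : E)) 𝕂), f, hf, rfl⟩

theorem exists_mk (a : PowerGerm 𝕂 E) : ∃ f hf, a = mk f hf := by
  obtain ⟨_, f, hf, rfl⟩ := a
  exact ⟨f, hf, rfl⟩

theorem mk_eq_mk {f g : E → 𝕂} {hf hg} : mk f hf = mk g hg ↔ f =ᶠ[𝓝 0] g := by
  rw [Subtype.ext_iff]
  exact Germ.coe_eq

theorem mk_add {f g : E → 𝕂} (hf hg) : mk f hf + mk g hg = mk (fun x => f x + g x) (hf.add hg) := rfl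

theorem mk_mul {f g : E → 𝕂} (hf hg) : mk f hf * mk g hg = mk (fun x => f x * g x) (hf.mul hg) := rfl

theorem mk_pow {f : E → 𝕂} (hf) (n : ℕ) : mk f hf ^ n = mk (fun x => f x ^ n) (hf.pow n) := rfl

theorem mk_sum {ι : Type*} (s : Finset ι) (f : ι → E → 𝕂) (hf : ∀ i, AnalyticAt 𝕂 (f i) 0) :
    ∑ i ∈ s, mk (f i) (hf i) =
      mk (fun x => ∑ i ∈ s, f i x) (Finset.analyticAt_fun_sum s fun i _ => hf i) := by
  classical
  induction s using Finset.induction_on with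
  | empty => rfl
  | insert a s ha ih =>
    rw [Finset.sum_insert ha, ih, mk_add]
    congr 1
    funext x
    rw [Finset.sum_insert ha]

theorem isUnit_mk {f : E → 𝕂} (hf : AnalyticAt 𝕂 f 0) (h0 : f 0 ≠ 0) : IsUnit (mk f hf) := by
  refine IsUnit.of_mul_eq_one (mk (fun x => (f x)⁻¹) (hf.inv h0)) ?_
  rw [mk_mul]
  change _ = mk (fun _ => (1 : 𝕂)) analyticAt_const
  rw [mk_eq_mk]
  filter_upwards [hf.continuousAt.eventually_ne h0] with x hx
  exact mul_inv_cancel₀ hx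

theorem natCast_notMem (P : Ideal (PowerGerm 𝕂 E)) (hP : P.IsPrime) (k : ℕ) (hk : k ≠ 0) :
    (k : PowerGerm 𝕂 E) ∉ P := by
  intro h
  refine hP.ne_top (P.eq_top_of_isUnit_mem h ?_)
  have e : (k : PowerGerm 𝕂 E) = mk (fun _ => (k : 𝕂)) analyticAt_const := by
    induction k with
    | zero => exact absurd rfl hk
    | succ k _ =>
      clear * -
      induction k with
      | zero => simp; rfl
      | succ k ih => rw [Nat.cast_succ, ih]; simp only [Nat.cast_succ]; rfl
  rw [e]
  exact isUnit_mk _ (Nat.cast_ne_zero.2 hk)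

variable {F : Type} [NormedAddCommGroup F] [NormedSpace 𝕂 F]

theorem tendsto_zero (T : E →L[𝕂] F) : Tendsto T (𝓝 0) (𝓝 0) := by
  have := T.continuous.tendsto 0
  rwa [map_zero] at this

theorem analyticAt_comp {f : F → 𝕂} (hf : AnalyticAt 𝕂 f 0) (T : E →L[𝕂] F) :
    AnalyticAt 𝕂 (fun x => f (T x)) 0 := by
  have hf' : AnalyticAt 𝕂 f (T 0) := by rwa [map_zero]
  exact hf'.fun_comp (T.analyticAt 0)

/-- Pull-back of germs along a linear map. -/
def pull (T : E →L[𝕂] F) : PowerGerm 𝕂 F →+* PowerGerm 𝕂 E where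
  toFun a := ⟨a.1.compTendsto T (tendsto_zero T), by
    obtain ⟨f, hf, rfl⟩ := exists_mk a
    exact ⟨fun x => f (T x), analyticAt_comp hf T, rfl⟩⟩
  map_one' := rfl
  map_mul' a b := by
    obtain ⟨f, hf, rfl⟩ := exists_mk a
    obtain ⟨g, hg, rfl⟩ := exists_mk b
    rfl
  map_zero' := rfl
  map_add' a b := by
    obtain ⟨f, hf, rfl⟩ := exists_mk a
    obtain ⟨g, hg, rfl⟩ := exists_mk b
    rfl

theorem pull_mk (T : E →L[𝕂] F) {f : F → 𝕂} (hf) :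
    pull T (mk f hf) = mk (fun x => f (T x)) (analyticAt_comp hf T) := rfl

/-- Pull-back along a linear isomorphism. -/
def pullEquiv (T : E ≃L[𝕂] F) : PowerGerm 𝕂 F ≃+* PowerGerm 𝕂 E :=
  RingEquiv.ofRingHom (pull (T : E →L[𝕂] F)) (pull (T.symm : F →L[𝕂] E))
    (by
      ext a : 1
      obtain ⟨f, hf, rfl⟩ := exists_mk a
      simp only [RingHom.comp_apply, pull_mk, RingHom.id_apply]
      congr 1; funext x; simp)
    (by
      ext a : 1
      obtain ⟨f, hf, rfl⟩ := exists_mk a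
      simp only [RingHom.comp_apply, pull_mk, RingHom.id_apply]
      congr 1; funext x; simp)

theorem analyticAt_fderiv_apply {f : E → 𝕂} {x : E} (hf : AnalyticAt 𝕂 f x) (v : E) :
    AnalyticAt 𝕂 (fun y => fderiv 𝕂 f y v) x :=
  ((ContinuousLinearMap.apply 𝕂 𝕂 v).analyticAt _).comp hf.fderiv

/-- The partial derivative in the direction `v`, as an additive map. -/
def derivAddHom (v : E) : PowerGerm 𝕂 E →+ PowerGerm 𝕂 E where
  toFun a := ⟨a.1.map' (fun f y => fderiv 𝕂 f y v) fun _ _ h =>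
      (eventually_eventually_nhds.2 h).mono fun _ hy => by
        simp only [EventuallyEq.fderiv_eq hy], by
    obtain ⟨f, hf, rfl⟩ := exists_mk a
    exact ⟨fun y => fderiv 𝕂 f y v,
      analyticAt_fderiv_apply hf v, rfl⟩⟩
  map_zero' := by
    refine Subtype.ext (Germ.coe_eq.2 (Eventually.of_forall fun y => ?_))
    simp only [fderiv_fun_const, Pi.zero_apply]
    rfl
  map_add' a b := by
    obtain ⟨f, hf, rfl⟩ := exists_mk a
    obtain ⟨g, hg, rfl⟩ := exists_mk b
    refine Subtype.ext (Germ.coe_eq.2 ?_)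
    filter_upwards [hf.eventually_analyticAt, hg.eventually_analyticAt] with y hfy hgy
    simp only [fderiv_fun_add hfy.differentiableAt hgy.differentiableAt]
    rfl

/-- The partial derivative in the direction `v`. -/
def deriv (v : E) : Derivation ℤ (PowerGerm 𝕂 E) (PowerGerm 𝕂 E) :=
  Derivation.mk' (derivAddHom v).toIntLinearMap fun a b => by
    obtain ⟨f, hf, rfl⟩ := exists_mk a
    obtain ⟨g, hg, rfl⟩ := exists_mk b
    refine Subtype.ext (Germ.coe_eq.2 ?_)
    filter_upwards [hf.eventually_analyticAt, hg.eventually_analyticAt] with y hfy hgy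
    simp only [fderiv_fun_mul hfy.differentiableAt hgy.differentiableAt]
    rfl

theorem deriv_mk (v : E) {f : E → 𝕂} (hf) : deriv v (mk f hf) = mk (fun y => fderiv 𝕂 f y v)
    (analyticAt_fderiv_apply hf v) := rfl

theorem deriv_pull (T : E →L[𝕂] F) (v : E) (a : PowerGerm 𝕂 F) :
    deriv v (pull T a) = pull T (deriv (T v) a) := by
  obtain ⟨f, hf, rfl⟩ := exists_mk a
  rw [pull_mk, deriv_mk, deriv_mk, pull_mk, mk_eq_mk]
  filter_upwards [(tendsto_zero T).eventually hf.eventually_analyticAt] with y hy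
  have : fderiv 𝕂 (fun x => f (T x)) y = (fderiv 𝕂 f (T y)).comp (fderiv 𝕂 T y) :=
    fderiv_comp y hy.differentiableAt T.differentiableAt
  rw [this, T.fderiv]
  rfl

section Coordinates

variable {m : ℕ}

/-- The projection forgetting the first coordinate. -/
def tailL (𝕂 : Type) [RCLike 𝕂] (m : ℕ) : (Fin (m + 1) → 𝕂) →L[𝕂] (Fin m → 𝕂) :=
  ContinuousLinearMap.pi fun i => ContinuousLinearMap.proj i.succ

theorem tailL_apply (x : Fin (m + 1) → 𝕂) : tailL 𝕂 m x = Fin.tail x := rfl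

/-- The inclusion of the hyperplane where the first coordinate vanishes. -/
def consL (𝕂 : Type) [RCLike 𝕂] (m : ℕ) : (Fin m → 𝕂) →L[𝕂] (Fin (m + 1) → 𝕂) :=
  ContinuousLinearMap.pi fun i => Fin.cases 0 (fun j => ContinuousLinearMap.proj j) i

theorem consL_apply (y : Fin m → 𝕂) : consL 𝕂 m y = Fin.cons 0 y := by
  funext i
  refine Fin.cases ?_ (fun j => ?_) i <;> simp [consL]

theorem tailL_consL (y : Fin m → 𝕂) : tailL 𝕂 m (consL 𝕂 m y) = y := by
  rw [consL_apply, tailL_apply, Fin.tail_cons]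

/-- Germs not depending on the first coordinate. -/
abbrev incl (𝕂 : Type) [RCLike 𝕂] (m : ℕ) :
    PowerGerm 𝕂 (Fin m → 𝕂) →+* PowerGerm 𝕂 (Fin (m + 1) → 𝕂) := pull (tailL 𝕂 m)

theorem analyticAt_coord (x : Fin (m + 1) → 𝕂) :
    AnalyticAt 𝕂 (fun x : Fin (m + 1) → 𝕂 => x 0) x :=
  (ContinuousLinearMap.proj (R := 𝕂) (φ := fun _ : Fin (m + 1) => 𝕂) 0).analyticAt x

/-- The germ of the first coordinate. -/
def coord (𝕂 : Type) [RCLike 𝕂] (m : ℕ) : PowerGerm 𝕂 (Fin (m + 1) → 𝕂) :=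
  mk (fun x => x 0) (analyticAt_coord 0)

theorem incl_injective : Function.Injective (incl 𝕂 m) := by
  have h : ∀ a, pull (consL 𝕂 m) (incl 𝕂 m a) = a := fun a => by
    obtain ⟨f, hf, rfl⟩ := exists_mk a
    rw [pull_mk, pull_mk]
    simp only [tailL_consL]
  exact Function.LeftInverse.injective h

theorem deriv_coord (v : Fin (m + 1) → 𝕂) :
    deriv v (coord 𝕂 m) = mk (fun _ => v 0) analyticAt_const := by
  rw [coord, deriv_mk, mk_eq_mk]
  refine Eventually.of_forall fun y => ?_
  have := (ContinuousLinearMap.proj (R := 𝕂) (φ := fun _ : Fin (m + 1) => 𝕂) 0).fderiv (x := y)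
  exact congrArg (· v) this

theorem coord_ne_zero : coord 𝕂 m ≠ 0 := by
  intro h
  have h1 := deriv_coord (𝕂 := 𝕂) (m := m) (Pi.single 0 1)
  rw [h, map_zero] at h1
  have h2 : (mk (fun _ => 0) analyticAt_const : PowerGerm 𝕂 (Fin (m + 1) → 𝕂)) =
      mk (fun _ => (Pi.single 0 1 : Fin (m + 1) → 𝕂) 0) analyticAt_const := h1
  rw [mk_eq_mk] at h2
  simpa using h2.self_of_nhds

/-- `f` is regular of order `k` in the first coordinate. -/
def IsRegularOfOrder (f : (Fin (m + 1) → 𝕂) → 𝕂) (k : ℕ) : Prop :=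
  ∃ u : 𝕂 → 𝕂, AnalyticAt 𝕂 u 0 ∧ u 0 ≠ 0 ∧ ∀ᶠ t in 𝓝 0, f (Fin.cons t 0) = t ^ k * u t

theorem exists_division {f : (Fin (m + 1) → 𝕂) → 𝕂} (hf : AnalyticAt 𝕂 f 0) {k : ℕ}
    (hk : IsRegularOfOrder f k) (g : PowerGerm 𝕂 (Fin (m + 1) → 𝕂)) :
    ∃ (q : PowerGerm 𝕂 (Fin (m + 1) → 𝕂)) (r : ℕ → PowerGerm 𝕂 (Fin m → 𝕂)),
      g = q * mk f hf + ∑ i ∈ Finset.range k, incl 𝕂 m (r i) * coord 𝕂 m ^ i := by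
  obtain ⟨u, hu, hu0, hfu⟩ := hk
  obtain ⟨g, hg, rfl⟩ := exists_mk g
  obtain ⟨q, r, hq, hr, hqr⟩ := exists_weierstrass_division hf hg hu hu0 hfu
  refine ⟨mk q hq, fun i => mk (r i) (hr i), ?_⟩
  simp only [pull_mk, coord, mk_pow, mk_mul]
  rw [mk_sum, mk_add, mk_eq_mk]
  exact hqr

/-- A polynomial of degree below k cannot vanish to order k. The factor t is cancelled away from the
origin and the identity restored at 0 by continuity. -/
theorem eq_zero_of_eq_pow_mul {k : ℕ} {c : ℕ → 𝕂} {a : 𝕂 → 𝕂} (ha : ContinuousAt a 0)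
    (h : ∀ᶠ t in 𝓝 0, ∑ i ∈ Finset.range k, c i * t ^ i = t ^ k * a t) :
    ∀ i < k, c i = 0 := by
  induction k generalizing c with
  | zero => intro i hi; omega
  | succ k ih =>
    have h0 : c 0 = 0 := by
      have := h.self_of_nhds
      rw [Finset.sum_range_succ'] at this
      simpa using this
    have h1 : ∀ᶠ t in 𝓝[≠] 0, ∑ i ∈ Finset.range k, c (i + 1) * t ^ i = t ^ k * a t := by
      filter_upwards [h.filter_mono nhdsWithin_le_nhds, self_mem_nhdsWithin] with t ht ht0
      have ht0' : t ≠ 0 := ht0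
      apply mul_left_cancel₀ ht0'
      rw [Finset.sum_range_succ', h0, zero_mul, add_zero] at ht
      rw [Finset.mul_sum, ← mul_assoc, ← pow_succ', ← ht]
      exact Finset.sum_congr rfl fun i _ => by ring
    have h2 : ∀ᶠ t in 𝓝 0, ∑ i ∈ Finset.range k, c (i + 1) * t ^ i = t ^ k * a t := by
      refine (ContinuousAt.eventuallyEq_nhds_iff_eventuallyEq_nhdsNE ?_ ?_).1 h1
      · fun_prop
      · fun_prop
    intro i hi
    cases i with
    | zero => exact h0
    | succ i => exact ih h2 i (by omega)

open Polynomial in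
/-- Weierstrass preparation, and division by a Weierstrass polynomial. -/
theorem exists_weierstrass_polynomial {f : (Fin (m + 1) → 𝕂) → 𝕂} (hf : AnalyticAt 𝕂 f 0) {k : ℕ}
    (hk : IsRegularOfOrder f k) : ∃ W : (PowerGerm 𝕂 (Fin m → 𝕂))[X], W.Monic ∧ W.natDegree ≤ k ∧
      (∃ q, W.eval₂ (incl 𝕂 m) (coord 𝕂 m) = q * mk f hf) ∧
      ∀ g, ∃ (q : PowerGerm 𝕂 (Fin (m + 1) → 𝕂)) (r : ℕ → PowerGerm 𝕂 (Fin m → 𝕂)),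
        g = q * W.eval₂ (incl 𝕂 m) (coord 𝕂 m) +
          ∑ i ∈ Finset.range k, incl 𝕂 m (r i) * coord 𝕂 m ^ i := by
  -- Dividing x₀^k by f, the Weierstrass polynomial is x₀^k minus the remainder.
  obtain ⟨q, r, hqr⟩ := exists_division hf hk (coord 𝕂 m ^ k)
  set ρ : (PowerGerm 𝕂 (Fin m → 𝕂))[X] := ∑ i ∈ Finset.range k, monomial i (r i) with hρ
  have hρd : ρ.degree < k := by
    rw [degree_lt_iff_coeff_zero]
    intro j hj
    rw [hρ, finsetSum_coeff]
    refine Finset.sum_eq_zero fun i hi => ?_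
    rw [coeff_monomial, if_neg]
    have := Finset.mem_range.1 hi
    omega
  have hρe : ρ.eval₂ (incl 𝕂 m) (coord 𝕂 m) =
      ∑ i ∈ Finset.range k, incl 𝕂 m (r i) * coord 𝕂 m ^ i := by
    rw [hρ, eval₂_finsetSum]
    simp only [eval₂_monomial]
  have hWe : (X ^ k - ρ).eval₂ (incl 𝕂 m) (coord 𝕂 m) = q * mk f hf := by
    rw [eval₂_sub, eval₂_X_pow, hρe]
    nth_rewrite 1 [hqr]
    ring
  refine ⟨X ^ k - ρ, ?_, ?_, ⟨q, hWe⟩, ?_⟩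
  · refine (monic_X_pow k).sub_of_left (lt_of_lt_of_le hρd ?_)
    rw [degree_X_pow]
  · refine (natDegree_sub_le _ _).trans (max_le (natDegree_X_pow_le k) ?_)
    exact natDegree_le_of_degree_le hρd.le
  · obtain ⟨u, hu, hu0, hfu⟩ := hk
    choose r' hr' hrr' using fun i => exists_mk (r i)
    obtain ⟨q', hq', rfl⟩ := exists_mk q
    set w : (Fin (m + 1) → 𝕂) → 𝕂 := fun x =>
      q' x * f x with hw
    have hwa : AnalyticAt 𝕂 w 0 := hq'.mul hf
    have hline : Tendsto (fun t : 𝕂 => (Fin.cons t 0 : Fin (m + 1) → 𝕂)) (𝓝 0) (𝓝 0) := by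
      have hc : Continuous (fun t : 𝕂 => (Fin.cons t 0 : Fin (m + 1) → 𝕂)) := by fun_prop
      have := hc.tendsto 0
      have e : (Fin.cons 0 0 : Fin (m + 1) → 𝕂) = 0 := by
        funext i; refine Fin.cases ?_ (fun j => ?_) i <;> simp
      rwa [e] at this
    have hqr' : ∀ᶠ x in 𝓝 (0 : Fin (m + 1) → 𝕂), x 0 ^ k =
        q' x * f x + ∑ i ∈ Finset.range k, r' i (Fin.tail x) * x 0 ^ i := by
      simp only [hrr', pull_mk, coord, mk_pow, mk_mul] at hqr
      rw [mk_sum, mk_add, mk_eq_mk] at hqr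
      exact hqr
    have hwt : ∀ᶠ t in 𝓝 (0 : 𝕂), w (Fin.cons t 0) =
        t ^ k - ∑ i ∈ Finset.range k, r' i 0 * t ^ i := by
      filter_upwards [hline.eventually hqr'] with t ht
      simp only [Fin.cons_zero, Fin.tail_cons] at ht
      rw [ht, hw]
      ring
    -- On the first axis W is also a multiple of t^k, so its lower coefficients vanish at the
    -- origin. Thus W restricts to t^k there and is itself regular of order k, so division by W is
    -- again Weierstrass division.
    have hz := eq_zero_of_eq_pow_mul (k := k) (c := fun i => r' i 0)
      (a := fun t => 1 - q' (Fin.cons t 0) * u t) (by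
        have h1 : ContinuousAt (fun t : 𝕂 => q' (Fin.cons t 0)) 0 := by
          have := hq'.continuousAt.tendsto.comp hline
          have e : (Fin.cons 0 0 : Fin (m + 1) → 𝕂) = 0 := by
            funext i; refine Fin.cases ?_ (fun j => ?_) i <;> simp
          rw [ContinuousAt, e]
          exact this
        exact continuousAt_const.sub (h1.mul hu.continuousAt)) (by
        filter_upwards [hwt, hfu] with t ht ht'
        rw [hw] at ht
        simp only [ht'] at ht
        linear_combination ht)
    intro g
    obtain ⟨q₂, r₂, h₂⟩ := exists_division hwa (k := k)
      ⟨fun _ => 1, analyticAt_const, one_ne_zero, by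
        filter_upwards [hwt] with t ht
        rw [ht, Finset.sum_eq_zero, sub_zero, mul_one]
        intro i hi
        rw [hz i (Finset.mem_range.1 hi), zero_mul]⟩ g
    refine ⟨q₂, r₂, ?_⟩
    rw [hWe]
    exact h₂

/-- Some line through the origin exists on which f does not vanish identically; a linear change of
coordinates moves it to the first axis, where f has a finite order of vanishing. -/
theorem exists_isRegularOfOrder {f : (Fin (m + 1) → 𝕂) → 𝕂} (hf : AnalyticAt 𝕂 f 0)
    (hne : mk f hf ≠ 0) : ∃ (T : (Fin (m + 1) → 𝕂) ≃L[𝕂] (Fin (m + 1) → 𝕂)) (k : ℕ),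
      IsRegularOfOrder (fun x => f (T x)) k := by
  obtain ⟨v, hv, hfv⟩ : ∃ v : Fin (m + 1) → 𝕂, v ≠ 0 ∧ ¬ ∀ᶠ t in 𝓝 (0 : 𝕂), f (t • v) = 0 := by
    by_cases h0 : f 0 = 0
    · obtain ⟨ε, hε, hball⟩ := Metric.eventually_nhds_iff_ball.1 hf.eventually_analyticAt
      have hfreq : ∃ᶠ x in 𝓝 0, f x ≠ 0 := by
        rw [Filter.Frequently]
        intro h
        refine hne (mk_eq_mk (hg := analyticAt_const).2 (h.mono fun x hx => not_not.1 hx))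
      obtain ⟨v, hfv, hv⟩ := (hfreq.and_eventually (Metric.ball_mem_nhds 0 hε)).exists
      refine ⟨v, fun h => hfv (h ▸ h0), fun hev => hfv ?_⟩
      -- The line through v meets the ball in a convex set of parameters containing 0 and 1, so
      -- vanishing near t = 0 would propagate to t = 1.
      let S : 𝕂 →L[𝕂] (Fin (m + 1) → 𝕂) := ContinuousLinearMap.toSpanSingleton 𝕂 v
      have hS : ∀ t, S t = t • v := fun t => rfl
      have han : AnalyticOnNhd 𝕂 (fun t => f (S t)) (S ⁻¹' Metric.ball 0 ε) := fun t ht =>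
        (hball _ ht).fun_comp (S.analyticAt t)
      have hconn : IsPreconnected (S ⁻¹' Metric.ball 0 ε) :=
        (((convex_ball (0 : Fin (m + 1) → 𝕂) ε).linear_preimage
          (S.restrictScalars ℝ).toLinearMap)).isPreconnected
      have := han.eqOn_zero_of_preconnected_of_eventuallyEq_zero hconn
        (show (0 : 𝕂) ∈ S ⁻¹' Metric.ball 0 ε by simpa using hε) hev
      have h1 := this (show (1 : 𝕂) ∈ S ⁻¹' Metric.ball 0 ε by simpa [hS] using hv)
      simpa [hS] using h1
    · refine ⟨Pi.single 0 1, by simp, fun hev => h0 ?_⟩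
      simpa using hev.self_of_nhds
  have he : (Pi.single 0 1 : Fin (m + 1) → 𝕂) ≠ 0 := by simp
  obtain ⟨T, hT⟩ := SeparatingDual.exists_continuousLinearEquiv_apply_eq (R := 𝕂) he hv
  have hφ : AnalyticAt 𝕂 (fun t : 𝕂 => f (t • v)) 0 :=
    analyticAt_comp hf (ContinuousLinearMap.toSpanSingleton 𝕂 v)
  obtain ⟨k, u, hu, hu0, hku⟩ := hφ.exists_eventuallyEq_pow_smul_nonzero_iff.2 hfv
  refine ⟨T, k, u, hu, hu0, ?_⟩
  filter_upwards [hku] with t ht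
  have e : (Fin.cons t 0 : Fin (m + 1) → 𝕂) = t • Pi.single 0 1 := by
    funext i; refine Fin.cases ?_ (fun j => ?_) i <;> simp
  rw [e, map_smul, hT, ht, sub_zero, smul_eq_mul]

end Coordinates

end PowerGerm

end PowerGerm

/-! ### Noetherianity and the Jacobian criterion for rings of analytic germs -/

section OneVariable

open Polynomial

variable {A B : Type*} [CommRing A] [CommRing B] (ι : B →+* A) (t : A) (P : Ideal A) (W : B[X])

/-- Division by W replaces an element of P by polynomials in t of degree at most k. Multiplication
by l^(k+1) permits pseudo-division of these by G, leaving coefficients in P ∩ B, and c moves those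
into the span of the F i. -/
theorem mul_mem_span_cons {k : ℕ} (hWd : W.natDegree ≤ k) (hWP : W.eval₂ ι t ∈ P)
    (hdiv : ∀ g, ∃ (q : A) (r : ℕ → B),
      g = q * W.eval₂ ι t + ∑ i ∈ Finset.range k, ι (r i) * t ^ i)
    (G : B[X]) (l : B) (hps : ∀ (r : B[X]) (N : ℕ), r.natDegree ≤ N → r.eval₂ ι t ∈ P →
        ∃ s r₂ : B[X], C l ^ (N + 1) * r = s * G + r₂ ∧ ∀ i, ι (r₂.coeff i) ∈ P)
    {e : ℕ} (F : Fin e → B) (c : B)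
    (hcF : ∀ a ∈ P.comap ι, c * a ∈ Ideal.span (Set.range F)) (a : A) (ha : a ∈ P) :
    ι (c * l ^ (k + 1)) * a ∈
      Ideal.span (Set.range (Fin.cons (G.eval₂ ι t) fun i => ι (F i) : Fin (e + 1) → A)) := by
  have hpoly : ∀ r : B[X], r.natDegree ≤ k → r.eval₂ ι t ∈ P →
      ι (c * l ^ (k + 1)) * r.eval₂ ι t ∈
        Ideal.span (Set.range (Fin.cons (G.eval₂ ι t) fun i => ι (F i) : Fin (e + 1) → A)) := by
    intro r hr hrP
    obtain ⟨s, r₂, h₁, h₂⟩ := hps r k hr hrP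
    have h3 := congrArg (Polynomial.eval₂ ι t) h₁
    rw [eval₂_mul, eval₂_pow, eval₂_C, eval₂_add, eval₂_mul] at h3
    rw [map_mul, map_pow, mul_assoc, h3, mul_add]
    refine add_mem (Ideal.mul_mem_left _ _ (Ideal.mul_mem_left _ _
      (Ideal.subset_span ⟨0, rfl⟩))) ?_
    rw [eval₂_eq_sum (p := r₂), Polynomial.sum, Finset.mul_sum]
    refine sum_mem fun i _ => ?_
    rw [← mul_assoc, ← map_mul]
    refine Ideal.mul_mem_right _ _ ?_
    have h4 := Ideal.mem_map_of_mem ι (hcF (r₂.coeff i) (h₂ i))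
    rw [Ideal.map_span, ← Set.range_comp] at h4
    refine Ideal.span_mono ?_ h4
    rintro _ ⟨j, rfl⟩
    exact ⟨j.succ, rfl⟩
  obtain ⟨q', r, hqr⟩ := hdiv a
  set ρ : B[X] := ∑ i ∈ Finset.range k, monomial i (r i) with hρ
  have hρd : ρ.natDegree ≤ k := by
    refine natDegree_sum_le_of_forall_le _ _ fun i hi => ?_
    exact (natDegree_monomial_le _).trans (Finset.mem_range.1 hi).le
  have hρe : ρ.eval₂ ι t = ∑ i ∈ Finset.range k, ι (r i) * t ^ i := by
    rw [hρ, eval₂_finsetSum]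
    simp only [eval₂_monomial]
  rw [← hρe] at hqr
  have hρP : ρ.eval₂ ι t ∈ P := by
    have e : ρ.eval₂ ι t = a - q' * W.eval₂ ι t := by
      rw [hqr]; ring
    rw [e]
    exact sub_mem ha (Ideal.mul_mem_left _ _ hWP)
  rw [hqr, mul_add, mul_left_comm]
  exact add_mem (Ideal.mul_mem_left _ _ (hpoly W hWd hWP)) (hpoly ρ hρd hρP)

/-- Modulo P every element is a B-combination of powers of t, and t is integral because W is monic.
-/
theorem isIntegral_of_division {k : ℕ} (hW : W.Monic) (hWP : W.eval₂ ι t ∈ P)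
    (hdiv : ∀ g, ∃ (q : A) (r : ℕ → B),
      g = q * W.eval₂ ι t + ∑ i ∈ Finset.range k, ι (r i) * t ^ i) :
    ((Ideal.Quotient.mk P).comp ι).IsIntegral := by
  have htint : ((Ideal.Quotient.mk P).comp ι).IsIntegralElem (Ideal.Quotient.mk P t) := by
    refine ⟨W, hW, ?_⟩
    rw [← hom_eval₂]
    exact Ideal.Quotient.eq_zero_iff_mem.2 hWP
  intro a
  obtain ⟨a, rfl⟩ := Ideal.Quotient.mk_surjective a
  obtain ⟨q', r, hqr⟩ := hdiv a
  rw [hqr, map_add, map_mul, Ideal.Quotient.eq_zero_iff_mem.2 hWP, mul_zero, zero_add, map_sum]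
  refine Finset.sum_induction _ (fun x => RingHom.IsIntegralElem _ x)
    (fun x y hx hy => hx.add _ hy) (RingHom.isIntegralElem_zero _) fun i hi => ?_
  clear hi
  rw [map_mul, map_pow]
  refine RingHom.IsIntegralElem.mul _ ?_ ?_
  · exact RingHom.isIntegralElem_map ((Ideal.Quotient.mk P).comp ι)
  · induction i with
    | zero => rw [pow_zero]; exact RingHom.isIntegralElem_one _
    | succ i ih => rw [pow_succ]; exact ih.mul _ htint

/-- The derivation D₀ kills the image of B, so the first row is zero beyond its first entry G'(t)
and the determinant factors. -/
theorem det_derivation_cons {E E' : Type*} (D : E → Derivation ℤ A A) (D₀ : Derivation ℤ A A)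
    (h₀ : ∀ b, D₀ (ι b) = 0) (h₁ : D₀ t = 1) (G : B[X]) {e : ℕ} (F : Fin e → B)
    (D' : E' → Derivation ℤ B B) (j : E' → E) (w : E) (hw : D w = D₀) (v : Fin e → E')
    (hj : ∀ w b, D (j w) (ι b) = ι (D' w b)) :
    Matrix.det (Matrix.of fun i k => D ((Fin.cons w fun i => j (v i) : Fin (e + 1) → E) i)
      ((Fin.cons (G.eval₂ ι t) fun i => ι (F i) : Fin (e + 1) → A) k)) =
      G.derivative.eval₂ ι t * ι (Matrix.det (Matrix.of fun i k => D' (v i) (F k))) := by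
  rw [Matrix.det_succ_row_zero, Finset.sum_eq_single 0]
  · rw [RingHom.map_det]
    simp only [Matrix.of_apply, Fin.cons_zero, Fin.val_zero, pow_zero, one_mul, hw]
    rw [Derivation.eval₂_eq ι _ _ h₀ h₁]
    congr 2
    ext i k : 2
    exact hj _ _
  · intro i _ hi
    obtain ⟨i, rfl⟩ := Fin.exists_succ_eq.2 hi
    simp only [Matrix.of_apply, Fin.cons_zero, Fin.cons_succ, hw, h₀, mul_zero, zero_mul]
  · intro h
    exact absurd (Finset.mem_univ _) h

end OneVariable

noncomputable section AnalyticLocalAlgebra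

namespace PowerGerm

variable {𝕂 : Type} [RCLike 𝕂]

/-- Pull-back of germs along a linear isomorphism, as a ring homomorphism. -/
abbrev pullHom {E E' : Type} [NormedAddCommGroup E] [NormedSpace 𝕂 E]
    [NormedAddCommGroup E'] [NormedSpace 𝕂 E'] (T : E ≃L[𝕂] E') :
    PowerGerm 𝕂 E' →+* PowerGerm 𝕂 E := pull (T : E →L[𝕂] E')

theorem pullHom_pullHom_symm {E E' : Type} [NormedAddCommGroup E] [NormedSpace 𝕂 E]
    [NormedAddCommGroup E'] [NormedSpace 𝕂 E'] (T : E ≃L[𝕂] E') (a : PowerGerm 𝕂 E) :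
    pullHom T (pullHom T.symm a) = a := (pullEquiv T).apply_symm_apply a

theorem eq_bot_of_isPrime_zero (P : Ideal (PowerGerm 𝕂 (Fin 0 → 𝕂))) (hP : P ≠ ⊤) : P = ⊥ := by
  rw [eq_bot_iff]
  intro a ha
  obtain ⟨f, hf, rfl⟩ := exists_mk a
  by_contra hne
  refine hP (P.eq_top_of_isUnit_mem ha (isUnit_mk hf fun h0 => hne ?_))
  refine (mk_eq_mk (hg := analyticAt_const)).2 (Eventually.of_forall fun x => ?_)
  rw [Subsingleton.elim x 0, h0]

/-- Division by f identifies elements of I, up to multiples of f, with vectors of k coefficients in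
fewer variables. Those vectors form a submodule of a finite free module over a noetherian ring. -/
theorem ideal_fg_of_regular {m k : ℕ} [IsNoetherianRing (PowerGerm 𝕂 (Fin m → 𝕂))]
    {f : (Fin (m + 1) → 𝕂) → 𝕂} (hf : AnalyticAt 𝕂 f 0) (hk : IsRegularOfOrder f k)
    (I : Ideal (PowerGerm 𝕂 (Fin (m + 1) → 𝕂))) (hI : mk f hf ∈ I) : I.FG := by
  classical
  let _ : Algebra (PowerGerm 𝕂 (Fin m → 𝕂)) (PowerGerm 𝕂 (Fin (m + 1) → 𝕂)) :=
    (incl 𝕂 m).toAlgebra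
  let ψ : (Fin k → PowerGerm 𝕂 (Fin m → 𝕂)) →ₗ[PowerGerm 𝕂 (Fin m → 𝕂)]
      PowerGerm 𝕂 (Fin (m + 1) → 𝕂) :=
    Fintype.linearCombination (PowerGerm 𝕂 (Fin m → 𝕂)) fun i : Fin k => coord 𝕂 m ^ (i : ℕ)
  obtain ⟨S, hS⟩ := IsNoetherian.noetherian
    ((I.restrictScalars (PowerGerm 𝕂 (Fin m → 𝕂))).comap ψ)
  refine ⟨insert (mk f hf) (S.image ψ), le_antisymm ?_ ?_⟩
  · rw [Ideal.span_le]
    intro a ha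
    rcases Finset.mem_insert.1 (Finset.mem_coe.1 ha) with rfl | ha
    · exact hI
    · obtain ⟨c, hc, rfl⟩ := Finset.mem_image.1 ha
      have : c ∈ (I.restrictScalars (PowerGerm 𝕂 (Fin m → 𝕂))).comap ψ :=
        hS ▸ Submodule.subset_span hc
      exact this
  · intro g hg
    obtain ⟨q, r, hqr⟩ := exists_division hf hk g
    have hψ : ψ (fun i => r i) = ∑ i ∈ Finset.range k, incl 𝕂 m (r i) * coord 𝕂 m ^ i := by
      rw [Finset.sum_range, Fintype.linearCombination_apply]
      rfl
    rw [← hψ] at hqr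
    rw [hqr]
    refine add_mem (Ideal.mul_mem_left _ _ (Ideal.subset_span (by simp))) ?_
    have hmem : (fun i : Fin k => r i) ∈
        Submodule.span (PowerGerm 𝕂 (Fin m → 𝕂)) (S : Set (Fin k → PowerGerm 𝕂 (Fin m → 𝕂))) := by
      rw [hS]
      have e : ψ (fun i => r i) = g - q * mk f hf := by rw [hqr]; ring
      change ψ (fun i => r i) ∈ I
      rw [e]
      exact sub_mem hg (Ideal.mul_mem_left _ _ hI)
    have key : ∀ d ∈ Submodule.span (PowerGerm 𝕂 (Fin m → 𝕂))
        (S : Set (Fin k → PowerGerm 𝕂 (Fin m → 𝕂))),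
        ψ d ∈ Ideal.span ((insert (mk f hf) (S.image ψ) : Finset _) : Set _) := by
      intro d hd
      induction hd using Submodule.span_induction with
      | mem c hc =>
        refine Ideal.subset_span ?_
        simp only [Finset.coe_insert, Finset.coe_image]
        exact Or.inr ⟨c, hc, rfl⟩
      | zero => rw [map_zero]; exact zero_mem _
      | add c d _ _ hc hd => rw [map_add]; exact add_mem hc hd
      | smul b c _ hc => rw [map_smul, Algebra.smul_def]; exact Ideal.mul_mem_left _ _ hc
    exact key _ hmem

/-- Rückert's basis theorem: after a linear change of coordinates a nonzero ideal contains a germ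
regular in the first variable, which permits induction on m. -/
theorem isNoetherianRing (m : ℕ) : IsNoetherianRing (PowerGerm 𝕂 (Fin m → 𝕂)) := by
  induction m with
  | zero =>
    rw [isNoetherianRing_iff_ideal_fg]
    intro I
    by_cases h : I = ⊤
    · exact h ▸ ⟨{1}, by simp⟩
    · rw [eq_bot_of_isPrime_zero I h]; exact Submodule.fg_bot
  | succ m ih =>
    rw [isNoetherianRing_iff_ideal_fg]
    intro I
    by_cases h : I = ⊥
    · rw [h]; exact Submodule.fg_bot
    · obtain ⟨a, ha, hne⟩ := (Submodule.ne_bot_iff I).1 h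
      obtain ⟨f, hf, rfl⟩ := exists_mk a
      obtain ⟨T, k, hk⟩ := exists_isRegularOfOrder hf hne
      have h1 : (I.map (pullHom T)).FG :=
        ideal_fg_of_regular (analyticAt_comp hf (T : (Fin (m + 1) → 𝕂) →L[𝕂] (Fin (m + 1) → 𝕂)))
          hk _ (Ideal.mem_map_of_mem (pullHom T) ha)
      have h2 := Ideal.FG.map h1 (pullHom T.symm)
      rw [Ideal.map_map] at h2
      have h3 : (pullHom T.symm).comp (pullHom T) = RingHom.id _ := by
        ext a : 1
        exact (pullEquiv T).symm_apply_apply a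
      rwa [h3, Ideal.map_id] at h2

/-- Local equations with independent differentials at a prime of the ring of analytic germs. -/
def HasLocalEquations {E : Type} [NormedAddCommGroup E] [NormedSpace 𝕂 E] (m : ℕ)
    (P : PrimeSpectrum (PowerGerm 𝕂 E)) : Prop :=
  ∃ (e : ℕ) (F : Fin e → PowerGerm 𝕂 E) (v : Fin e → E) (c : PowerGerm 𝕂 E),
    (∀ i, F i ∈ P.asIdeal) ∧ c ∉ P.asIdeal ∧
    (∀ a ∈ P.asIdeal, c * a ∈ Ideal.span (Set.range F)) ∧
    Matrix.det (Matrix.of fun i j => deriv (v i) (F j)) ∉ P.asIdeal ∧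
    (m : ℕ∞) ≤ Order.coheight P + e

theorem HasLocalEquations.pull {E E' : Type} [NormedAddCommGroup E] [NormedSpace 𝕂 E]
    [NormedAddCommGroup E'] [NormedSpace 𝕂 E'] (T : E ≃L[𝕂] E') {m : ℕ}
    {P : PrimeSpectrum (PowerGerm 𝕂 E)}
    (h : HasLocalEquations m (PrimeSpectrum.comap (pullHom T) P)) :
    HasLocalEquations m P := by
  obtain ⟨e, F, v, c, hF, hc, hcF, hdet, hm⟩ := h
  refine ⟨e, fun i => pullHom T (F i), fun i => T.symm (v i), pullHom T c, hF, hc,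
    fun a ha => ?_, ?_, hm.trans ?_⟩
  · have h1 := hcF (pullHom T.symm a) (by
      change pullHom T (pullHom T.symm a) ∈ P.asIdeal
      rwa [pullHom_pullHom_symm])
    have h2 := Ideal.mem_map_of_mem (pullHom T) h1
    rw [Ideal.map_span, ← Set.range_comp, map_mul, pullHom_pullHom_symm] at h2
    exact h2
  · have h1 : (Matrix.of fun i j => deriv (T.symm (v i)) (pullHom T (F j))) =
        (pullHom T).mapMatrix (Matrix.of fun i j => deriv (v i) (F j)) := by
      refine Matrix.ext fun i j => ?_
      rw [Matrix.of_apply, deriv_pull, RingHom.mapMatrix_apply, Matrix.map_apply, Matrix.of_apply]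
      exact congrArg (fun w => PowerGerm.pull (T : E →L[𝕂] E') (deriv w (F j)))
        (T.apply_symm_apply (v i))
    rw [h1, ← RingHom.map_det]
    exact hdet
  · gcongr
    refine (coheight_comap_le_coheight _ ⊥ ?_ P bot_le)
    refine RingHom.isIntegral_of_surjective _ ?_
    exact Ideal.Quotient.mk_surjective.comp (pullEquiv T).surjective

/-- Restriction to the hyperplane x₀ = 0 is surjective and embeds the smaller spectrum strictly
above the zero ideal, since the preimage of zero contains x₀. -/
theorem le_coheight_bot (m : ℕ) (h : (⊥ : Ideal (PowerGerm 𝕂 (Fin m → 𝕂))).IsPrime) :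
    (m : ℕ∞) ≤ Order.coheight (⟨⊥, h⟩ : PrimeSpectrum (PowerGerm 𝕂 (Fin m → 𝕂))) := by
  induction m with
  | zero => simp
  | succ m ih =>
    have h' : (⊥ : Ideal (PowerGerm 𝕂 (Fin m → 𝕂))).IsPrime := by
      rw [← Ideal.comap_bot_of_injective _ (incl_injective (𝕂 := 𝕂) (m := m))]
      exact Ideal.comap_isPrime _ _
    have hsurj : Function.Surjective (PowerGerm.pull (consL 𝕂 m)) := fun a => by
      refine ⟨incl 𝕂 m a, ?_⟩
      obtain ⟨f, hf, rfl⟩ := exists_mk a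
      rw [pull_mk, pull_mk]
      simp only [tailL_consL]
    have hmono : StrictMono (PrimeSpectrum.comap (PowerGerm.pull (consL 𝕂 m))) := by
      intro p q hpq
      refine lt_of_le_of_ne (Ideal.comap_mono hpq.le) fun he => hpq.ne ?_
      exact PrimeSpectrum.comap_injective_of_surjective _ hsurj he
    have h1 := Order.coheight_le_coheight_apply_of_strictMono _ hmono ⟨⊥, h'⟩
    have h2 : (⟨⊥, h⟩ : PrimeSpectrum (PowerGerm 𝕂 (Fin (m + 1) → 𝕂))) <
        PrimeSpectrum.comap (PowerGerm.pull (consL 𝕂 m)) ⟨⊥, h'⟩ := by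
      refine lt_of_le_of_ne (show (⊥ : Ideal _) ≤ _ from bot_le) fun he => ?_
      have hmem : coord 𝕂 m ∈
          (PrimeSpectrum.comap (PowerGerm.pull (consL 𝕂 m)) ⟨⊥, h'⟩).asIdeal := by
        change PowerGerm.pull (consL 𝕂 m) (coord 𝕂 m) = 0
        rw [coord, pull_mk]
        refine (mk_eq_mk (hg := analyticAt_const)).2 (Eventually.of_forall fun y => ?_)
        simp [consL_apply]
      rw [← he] at hmem
      exact coord_ne_zero hmem
    calc ((m + 1 : ℕ) : ℕ∞) = m + 1 := by push_cast; rfl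
      _ ≤ _ := add_le_add_left ((ih h').trans h1) 1
      _ ≤ _ := Order.coheight_add_one_le h2

theorem hasLocalEquations_of_eq_bot (m : ℕ) (P : PrimeSpectrum (PowerGerm 𝕂 (Fin m → 𝕂)))
    (hbot : P.asIdeal = ⊥) : HasLocalEquations m P := by
  refine ⟨0, Fin.elim0, Fin.elim0, 1, fun i => i.elim0, ?_, fun a ha => ?_, ?_, ?_⟩
  · exact fun h => P.2.ne_top ((Ideal.eq_top_iff_one _).2 h)
  · rw [hbot] at ha
    rw [(Submodule.mem_bot _).1 ha, mul_zero]
    exact zero_mem _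
  · rw [Matrix.det_fin_zero]
    exact fun h => P.2.ne_top ((Ideal.eq_top_iff_one _).2 h)
  · obtain ⟨I, hI⟩ := P
    obtain rfl : I = ⊥ := hbot
    simpa using le_coheight_bot m hI

theorem deriv_single_incl {m : ℕ} (b : PowerGerm 𝕂 (Fin m → 𝕂)) :
    deriv (Pi.single 0 1) (incl 𝕂 m b) = 0 := by
  rw [deriv_pull]
  have : tailL 𝕂 m (Pi.single 0 1) = 0 := by
    funext i; simp [tailL_apply, Fin.tail]
  rw [this]
  obtain ⟨g, hg, rfl⟩ := exists_mk b
  rw [deriv_mk]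
  simp only [map_zero]
  rfl

/-- The equations of the contraction of P to the remaining m variables are supplemented by the
minimal equation G of x₀. Its x₀-derivative is nonzero at P, so the Jacobian determinant stays
nonzero; the number of equations grows by one, and by integrality the coheight of P is at least that
of the contraction. -/
theorem hasLocalEquations_of_regular {m k : ℕ}
    (ih : ∀ P : PrimeSpectrum (PowerGerm 𝕂 (Fin m → 𝕂)), HasLocalEquations m P)
    {f : (Fin (m + 1) → 𝕂) → 𝕂} (hf : AnalyticAt 𝕂 f 0) (hk : IsRegularOfOrder f k)
    (P : PrimeSpectrum (PowerGerm 𝕂 (Fin (m + 1) → 𝕂))) (hP : mk f hf ∈ P.asIdeal) :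
    HasLocalEquations (m + 1) P := by
  obtain ⟨W, hW, hWd, ⟨q, hq⟩, hdiv⟩ := exists_weierstrass_polynomial hf hk
  have hWP : W.eval₂ (incl 𝕂 m) (coord 𝕂 m) ∈ P.asIdeal := hq ▸ Ideal.mul_mem_left _ _ hP
  obtain ⟨G, l, hl, hGP, hder, hps⟩ := exists_generator_of_monic (incl 𝕂 m) (coord 𝕂 m) P.asIdeal
    (natCast_notMem P.asIdeal P.2) W hW hWP
  obtain ⟨e, F, v, c, hF, hc, hcF, hdet, hm⟩ := ih (PrimeSpectrum.comap (incl 𝕂 m) P)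
  refine ⟨e + 1, Fin.cons (G.eval₂ (incl 𝕂 m) (coord 𝕂 m)) fun i => incl 𝕂 m (F i),
    Fin.cons (Pi.single 0 1) fun i => consL 𝕂 m (v i), incl 𝕂 m (c * l ^ (k + 1)),
    fun i => ?_, ?_, ?_, ?_, ?_⟩
  · refine Fin.cases ?_ (fun j => ?_) i
    · exact hGP
    · exact hF j
  · rw [map_mul, map_pow]
    intro h
    rcases P.2.mem_or_mem h with h | h
    · exact hc h
    · exact hl (P.2.mem_of_pow_mem _ h)
  · exact mul_mem_span_cons (incl 𝕂 m) (coord 𝕂 m) P.asIdeal W hWd hWP hdiv G l hps F c hcF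
  · rw [det_derivation_cons (incl 𝕂 m) (coord 𝕂 m) (fun w => deriv w) (deriv (Pi.single 0 1))
      deriv_single_incl (by rw [deriv_coord]; simp only [Pi.single_eq_same]; rfl) G F
      (fun w => deriv w) (consL 𝕂 m) (Pi.single 0 1) rfl v fun w b => by
        rw [deriv_pull, tailL_consL]]
    intro h
    rcases P.2.mem_or_mem h with h | h
    · exact hder h
    · exact hdet h
  · have := coheight_comap_le_coheight (incl 𝕂 m) P.asIdeal
      (isIntegral_of_division (incl 𝕂 m) (coord 𝕂 m) P.asIdeal W hW hWP hdiv) P le_rfl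
    calc ((m + 1 : ℕ) : ℕ∞) = m + 1 := by push_cast; rfl
      _ ≤ Order.coheight P + e + 1 := by
        gcongr
        exact hm.trans (by gcongr)
      _ = Order.coheight P + (e + 1 : ℕ) := by push_cast; ring

/-- Every prime of the ring of germs of analytic functions of `m` variables is, up to
localization, generated by equations with independent differentials; their number is at least
its codimension. -/
theorem hasLocalEquations (m : ℕ) (P : PrimeSpectrum (PowerGerm 𝕂 (Fin m → 𝕂))) :
    HasLocalEquations m P := by
  induction m with
  | zero => exact hasLocalEquations_of_eq_bot 0 P (eq_bot_of_isPrime_zero _ P.2.ne_top)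
  | succ m ih =>
    by_cases hbot : P.asIdeal = ⊥
    · exact hasLocalEquations_of_eq_bot _ P hbot
    obtain ⟨a, ha, hne⟩ := (Submodule.ne_bot_iff P.asIdeal).1 hbot
    obtain ⟨f, hf, rfl⟩ := exists_mk a
    obtain ⟨T, k, hk⟩ := exists_isRegularOfOrder hf hne
    refine HasLocalEquations.pull T.symm (hasLocalEquations_of_regular ih
      (analyticAt_comp hf (T : (Fin (m + 1) → 𝕂) →L[𝕂] (Fin (m + 1) → 𝕂))) hk _ ?_)
    change pullHom T.symm (pullHom T (mk f hf)) ∈ P.asIdeal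
    rwa [show pullHom T.symm (pullHom T (mk f hf)) = mk f hf from
      (pullEquiv T).symm_apply_apply _]

end PowerGerm

end AnalyticLocalAlgebra

/-! ### Isotropic matrices -/

section IsotropicMatrices

open Matrix

theorem exists_linearIndependent_comp {K V ι : Type*} [Field K] [AddCommGroup V] [Module K V]
    [Finite ι] (v : ι → V) {n : ℕ} (hn : n ≤ Module.finrank K (Submodule.span K (Set.range v))) :
    ∃ S : Fin n → ι, LinearIndependent K (v ∘ S) := by
  obtain ⟨κ, a, ha, hspan, hli⟩ := exists_linearIndependent' K v
  have : Finite κ := Finite.of_injective a ha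
  have := Fintype.ofFinite κ
  rw [← hspan, finrank_span_eq_card hli] at hn
  obtain ⟨f⟩ : Nonempty (Fin n ↪ κ) := Function.Embedding.nonempty_of_card_le (by simpa using hn)
  exact ⟨a ∘ f, hli.comp f f.injective⟩

theorem exists_det_submatrix_ne_zero {K ι : Type*} [Field K] [Fintype ι] {n : ℕ}
    (A : Matrix (Fin n) ι K) (hA : LinearIndependent K A.row) :
    ∃ T : Fin n → ι, (A.submatrix id T).det ≠ 0 := by
  classical
  have hrank : A.rank = n := by simpa using hA.rank_matrix
  rw [Matrix.rank_eq_finrank_span_cols] at hrank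
  obtain ⟨T, hT⟩ := exists_linearIndependent_comp A.col hrank.ge
  refine ⟨T, ?_⟩
  have h1 : LinearIndependent K (A.submatrix id T).col := hT
  rw [Matrix.linearIndependent_cols_iff_isUnit, Matrix.isUnit_iff_isUnit_det] at h1
  exact h1.ne_zero

variable {R : Type*} [CommRing R] {n : ℕ}

/-- The coefficients of the vectors dual to the chosen rows. -/
def dualRows {e N : ℕ} (D : Matrix (Fin e) (Fin e) R) (T : Fin e → Fin N) :
    Matrix (Fin e) (Fin N) R :=
  of fun j l => ∑ t, D.adjugate t j * if T t = l then 1 else 0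

/-- Cramer's rule for the minor in the columns T, with the other columns of the dual rows filled by
zeros. -/
theorem mul_dualRows_transpose {e N : ℕ} (C : Matrix (Fin e) (Fin N) R) (T : Fin e → Fin N) :
    C * (dualRows (C.submatrix id T) T)ᵀ = (C.submatrix id T).det • 1 := by
  rw [← Matrix.mul_adjugate]
  ext i j
  simp only [Matrix.mul_apply, dualRows, transpose_apply, of_apply, submatrix_apply, id,
    Finset.mul_sum]
  rw [Finset.sum_comm]
  refine Finset.sum_congr rfl fun t _ => ?_
  simp only [mul_ite, mul_one, mul_zero, Finset.sum_ite_eq, Finset.mem_univ, if_true]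

/-- An identification of two copies of `Fin n` with `Fin (2 * n)`. -/
def doubleEquiv (n : ℕ) : Fin n ⊕ Fin n ≃ Fin (2 * n) :=
  finSumFinEquiv.trans (finCongr (two_mul n).symm)

/-- The square matrix with rows those of `u` and of `A`. -/
def stacked (u A : Matrix (Fin n) (Fin (2 * n)) R) :
    Matrix (Fin n ⊕ Fin n) (Fin n ⊕ Fin n) R :=
  (fromRows u A).submatrix id (doubleEquiv n)

theorem dualRows_map {R' : Type*} [CommRing R'] (π : R →+* R') {e N : ℕ}
    (D : Matrix (Fin e) (Fin e) R) (T : Fin e → Fin N) :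
    (dualRows D T).map π = dualRows (D.map π) T := by
  ext j l
  have : (D.map π).adjugate = D.adjugate.map π := by
    have := RingHom.map_adjugate π D
    simpa using this.symm
  simp [dualRows, this, apply_ite π]

theorem stacked_map {R' : Type*} [CommRing R'] (π : R →+* R')
    (u A : Matrix (Fin n) (Fin (2 * n)) R) :
    (stacked u A).map π = stacked (u.map π) (A.map π) := by
  ext (i | i) j <;> rfl

theorem linearIndependent_row_mul {K : Type*} [Field K] {e N : ℕ} {A : Matrix (Fin e) (Fin N) K}
    {J J' : Matrix (Fin N) (Fin N) K} (hJ : J * J' = 1) (hA : LinearIndependent K A.row) :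
    LinearIndependent K (A * J).row := by
  rw [← Matrix.vecMul_injective_iff] at hA ⊢
  intro a b hab
  simp only [← Matrix.vecMul_vecMul] at hab
  have h := congrArg (fun v => v ᵥ* J') hab
  simp only [Matrix.vecMul_vecMul _ J J', hJ, Matrix.vecMul_one] at h
  exact hA h

/-- The n rows of A are isotropic in dimension 2n, and the dual rows complete them to a basis. In a
relation w₁ u + w₂ A = 0, multiplication by A J kills the second term and turns the first into the
nonzero minor times w₁; so w₁ = 0, and then w₂ = 0 by independence of the rows of A. -/
theorem exists_minor_ne_zero {K : Type*} [Field K] (A : Matrix (Fin n) (Fin (2 * n)) K)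
    (J J' : Matrix (Fin (2 * n)) (Fin (2 * n)) K) (hJ : J * J' = 1)
    (hA : LinearIndependent K A.row) (hiso : A * J * Aᵀ = 0) :
    ∃ T : Fin n → Fin (2 * n), ((A * J).submatrix id T).det ≠ 0 ∧
      (stacked (dualRows ((A * J).submatrix id T) T) A).det ≠ 0 := by
  obtain ⟨T, hT⟩ := exists_det_submatrix_ne_zero (A * J) (linearIndependent_row_mul hJ hA)
  refine ⟨T, hT, fun h0 => ?_⟩
  set u := dualRows ((A * J).submatrix id T) T with hu
  obtain ⟨w, hw, hw0⟩ := Matrix.exists_vecMul_eq_zero_iff.2 h0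
  have hw1 : (w ∘ Sum.inl) ᵥ* u + (w ∘ Sum.inr) ᵥ* A = 0 := by
    funext l
    have h1 := congrFun hw0 ((doubleEquiv n).symm l)
    simp only [stacked, Matrix.vecMul, dotProduct, submatrix_apply, id, Equiv.apply_symm_apply,
      Fintype.sum_sum_type, fromRows_apply_inl, fromRows_apply_inr, Pi.zero_apply] at h1
    simpa [Matrix.vecMul, dotProduct] using h1
  have h2 := congrArg (fun v => (A * J) *ᵥ v) hw1
  simp only [Matrix.mulVec_add, Matrix.mulVec_zero] at h2
  rw [← Matrix.mulVec_transpose, ← Matrix.mulVec_transpose, Matrix.mulVec_mulVec,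
    Matrix.mulVec_mulVec, hiso, Matrix.zero_mulVec, add_zero, hu, mul_dualRows_transpose,
    Matrix.smul_mulVec, Matrix.one_mulVec] at h2
  have h3 : w ∘ Sum.inl = 0 := (smul_eq_zero.1 h2).resolve_left hT
  rw [h3, Matrix.zero_vecMul, zero_add] at hw1
  have h4 : w ∘ Sum.inr = 0 := by
    rw [← Matrix.vecMul_injective_iff] at hA
    exact hA (hw1.trans (Matrix.zero_vecMul A).symm)
  refine hw ?_
  funext i
  rcases i with i | i
  · exact congrFun h3 i
  · exact congrFun h4 i

end IsotropicMatrices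

/-! ### The rank of the Jacobian matrix at a regular prime -/

section Jacobian

variable {O : Type*} [CommRing O] {N : ℕ}

/-- The prime `P` is, up to localization, generated by equations with independent differentials;
their number is at least the codimension of `P`. -/
def HasIndependentEquations (D : Fin N → Derivation ℤ O O) (P : PrimeSpectrum O) : Prop :=
  ∃ (e : ℕ) (F : Fin e → O) (V : Matrix (Fin N) (Fin e) O) (c : O),
    (∀ i, F i ∈ P.asIdeal) ∧ c ∉ P.asIdeal ∧
    (∀ a ∈ P.asIdeal, c * a ∈ Ideal.span (Set.range F)) ∧
    ((Matrix.of fun j l => D l (F j)) * V).det ∉ P.asIdeal ∧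
    (N : ℕ∞) ≤ Order.coheight P + e

theorem linearIndependent_of_det_notMem {K : Type*} [Field K] (π : O →+* K) {e : ℕ}
    (A : Matrix (Fin e) (Fin N) O) (V : Matrix (Fin N) (Fin e) O)
    (h : (A * V).det ∉ RingHom.ker π) : LinearIndependent K (A.map π).row := by
  rw [← Matrix.vecMul_injective_iff]
  have h1 : ((A.map π) * (V.map π)).det ≠ 0 := by
    rw [← Matrix.map_mul]
    intro h0
    refine h ?_
    rw [RingHom.mem_ker, RingHom.map_det]
    exact h0
  intro a b hab
  have h2 := congrArg (fun v => Matrix.vecMul v (V.map π)) hab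
  simp only [Matrix.vecMul_vecMul] at h2
  exact Matrix.vecMul_injective_of_isUnit
    ((Matrix.isUnit_iff_isUnit_det _).2 (isUnit_iff_ne_zero.2 h1)) h2

theorem height_add_coheight_le_of_ringKrullDim_le {R : Type*} [CommRing R] (Q : PrimeSpectrum R)
    {n : ℕ} (hn : ringKrullDim R ≤ n) : Q.asIdeal.height + Order.coheight Q ≤ n := by
  have : Nonempty (PrimeSpectrum R) := ⟨Q⟩
  have h4 : ringKrullDim R = ((⨆ a : PrimeSpectrum R, Order.height a + Order.coheight a : ℕ∞)) :=
    Order.krullDim_eq_iSup_height_add_coheight_of_nonempty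
  rw [h4] at hn
  have h6 := le_iSup (fun a : PrimeSpectrum R => Order.height a + Order.coheight a) Q
  rw [PrimeSpectrum.height_eq_orderHeight Q]
  exact h6.trans (by exact_mod_cast hn)

/-- A regular system of parameters of the localization with its denominators cleared, the dimension
of the localization being the height of Q. -/
theorem exists_generators_of_isRegularLocalRing {R : Type*} [CommRing R] (Q : Ideal R) [Q.IsPrime]
    (hQ : IsRegularLocalRing (Localization.AtPrime Q)) :
    ∃ (d : ℕ) (τ : Fin d → R), (d : ℕ∞) = Q.height ∧ (∀ i, τ i ∈ Q) ∧
      ∀ a ∈ Q, ∃ c ∉ Q, c * a ∈ Ideal.span (Set.range τ) := by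
  have hdim := hQ.spanFinrank_maximalIdeal
  rw [IsLocalization.AtPrime.ringKrullDim_eq_height Q (Localization.AtPrime Q)] at hdim
  set m := IsLocalRing.maximalIdeal (Localization.AtPrime Q) with hm
  have hfg : m.FG := IsNoetherian.noetherian m
  obtain ⟨s, hs, hspan⟩ := Submodule.FG.exists_span_set_encard_eq_spanFinrank hfg
  have hfin : s.Finite := Set.finite_of_encard_eq_coe hs
  have := hfin.fintype
  have hcard : Fintype.card s = Submodule.spanFinrank m := by
    have : s.encard = (Fintype.card s : ℕ∞) := by
      rw [Set.encard_eq_coe_toFinset_card, Set.toFinset_card]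
    rw [this] at hs
    exact_mod_cast hs
  let ε : Fin (Submodule.spanFinrank m) ≃ s := (Fintype.equivFinOfCardEq hcard).symm
  have hτ : ∀ i, ∃ t ∈ Q, ∃ b : Q.primeCompl,
      algebraMap R (Localization.AtPrime Q) t = algebraMap R _ b * (ε i : Localization.AtPrime Q) := by
    intro i
    obtain ⟨⟨t, b⟩, hb⟩ := IsLocalization.surj Q.primeCompl (ε i : Localization.AtPrime Q)
    refine ⟨t, ?_, b, by rw [mul_comm]; exact hb.symm⟩
    rw [← IsLocalization.AtPrime.to_map_mem_maximal_iff (Localization.AtPrime Q) Q]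
    rw [← hb]
    have hmem : (ε i : Localization.AtPrime Q) ∈ m := hspan.le (Submodule.subset_span (ε i).2)
    exact Ideal.mul_mem_right _ m hmem
  choose t ht b hb using hτ
  refine ⟨Submodule.spanFinrank m, t, by exact_mod_cast hdim, ht, fun a ha => ?_⟩
  have h1 : algebraMap R (Localization.AtPrime Q) a ∈
      (Ideal.span (Set.range t)).map (algebraMap R (Localization.AtPrime Q)) := by
    have h2 : algebraMap R (Localization.AtPrime Q) a ∈ m :=
      (IsLocalization.AtPrime.to_map_mem_maximal_iff (Localization.AtPrime Q) Q a).2 ha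
    rw [← hspan] at h2
    refine (Submodule.span_le.2 ?_ : Submodule.span _ s ≤ _) h2
    intro z hz
    obtain ⟨i, hi⟩ := ε.surjective ⟨z, hz⟩
    have h3 : z = ε i := by rw [hi]
    have h4 : algebraMap R (Localization.AtPrime Q) (t i) ∈
      (Ideal.span (Set.range t)).map (algebraMap R (Localization.AtPrime Q)) :=
      Ideal.mem_map_of_mem _ (Ideal.subset_span ⟨i, rfl⟩)
    rw [hb i, ← h3] at h4
    exact (Ideal.unit_mul_mem_iff_mem _
      (IsLocalization.map_units (Localization.AtPrime Q) (b i))).1 h4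
  rw [IsLocalization.algebraMap_mem_map_algebraMap_iff Q.primeCompl] at h1
  obtain ⟨c, hc, hca⟩ := h1
  exact ⟨c, hc, hca⟩

/-- At a regular point the differentials of generators of the ideal span a space of dimension
the codimension. -/
theorem exists_linearIndependent_differentials {n k : ℕ} (hN : N = 2 * n)
    (D : Fin N → Derivation ℤ O O) (I : Ideal O) (f : Fin k → O)
    (hI : I = Ideal.span (Set.range f)) (hdim : ringKrullDim (O ⧸ I) ≤ n)
    (Q : PrimeSpectrum (O ⧸ I)) (hreg : IsRegularLocalRing (Localization.AtPrime Q.asIdeal))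
    (hE : HasIndependentEquations D (PrimeSpectrum.comap (Ideal.Quotient.mk I) Q))
    {K : Type*} [Field K] (π : O ⧸ I →+* K) (hπ : RingHom.ker π = Q.asIdeal) :
    ∃ S : Fin n → Fin k, LinearIndependent K
      fun i l => π (Ideal.Quotient.mk I (D l (f (S i)))) := by
  obtain ⟨e, F, V, c, hF, hc, hcF, hdet, hm⟩ := hE
  obtain ⟨d, τ, hd, hτ, hgen⟩ := exists_generators_of_isRegularLocalRing Q.asIdeal hreg
  set ρ : O →+* K := π.comp (Ideal.Quotient.mk I) with hρ
  have hker : ∀ a, ρ a = 0 ↔ Ideal.Quotient.mk I a ∈ Q.asIdeal := fun a => by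
    rw [← hπ, RingHom.mem_ker]; rfl
  let row : O → Fin N → K := fun x l => ρ (D l x)
  have row_add : ∀ x y, row (x + y) = row x + row y := fun x y => by
    funext l; simp [row]
  -- On elements vanishing at Q the differential over the residue field is linear, by the Leibniz
  -- rule.
  have row_mul : ∀ x y, ρ y = 0 → row (x * y) = ρ x • row y := fun x y hy => by
    funext l; simp [row, Derivation.leibniz, hy]
  have row_zero : row 0 = 0 := by funext l; simp [row]
  set W := Submodule.span K (Set.range fun i => row (f i)) with hW
  have hIW : ∀ x ∈ I, row x ∈ W := by
    intro x hx
    have hf0 : ∀ x ∈ I, ρ x = 0 := fun x hx => by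
      rw [hρ, RingHom.comp_apply, Ideal.Quotient.eq_zero_iff_mem.2 hx, map_zero]
    rw [hI] at hx
    induction hx using Submodule.span_induction with
    | mem x hx =>
      obtain ⟨i, rfl⟩ := hx
      exact Submodule.subset_span ⟨i, rfl⟩
    | zero => rw [row_zero]; exact zero_mem _
    | add x y _ _ hx hy => rw [row_add]; exact add_mem hx hy
    | smul a x hx' hx => rw [smul_eq_mul, row_mul _ _ (hf0 _ (hI ▸ hx'))]
                         exact W.smul_mem _ hx
  choose τ' hτ' using fun i => Ideal.Quotient.mk_surjective (τ i)
  set W' := Submodule.span K (Set.range fun i => row (τ' i)) with hW'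
  -- Up to a factor outside Q, each equation of the lifted prime is an element of I plus a
  -- combination of the parameters, so its differential lies in the sum of the two spans.
  have hFW : ∀ j, row (F j) ∈ W ⊔ W' := by
    intro j
    obtain ⟨c, hc, hmem⟩ := hgen (Ideal.Quotient.mk I (F j)) (hF j)
    obtain ⟨c, rfl⟩ := Ideal.Quotient.mk_surjective c
    obtain ⟨b, hb⟩ := (Ideal.mem_span_range_iff_exists_fun).1 hmem
    choose b' hb' using fun i => Ideal.Quotient.mk_surjective (b i)
    have h1 : c * F j - ∑ i, b' i * τ' i ∈ I := by
      rw [← Ideal.Quotient.eq_zero_iff_mem]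
      simp only [map_sub, map_mul, map_sum, hb', hτ', hb, sub_self]
    have h2 : row (c * F j) = row (c * F j - ∑ i, b' i * τ' i) + row (∑ i, b' i * τ' i) := by
      rw [← row_add, sub_add_cancel]
    have h3 : row (∑ i, b' i * τ' i) ∈ W' := by
      have : row (∑ i, b' i * τ' i) = ∑ i, row (b' i * τ' i) := by
        funext l; simp [row, Finset.sum_apply]
      rw [this]
      refine sum_mem fun i _ => ?_
      rw [row_mul _ _ ((hker _).2 (by rw [hτ']; exact hτ i))]
      exact W'.smul_mem _ (Submodule.subset_span ⟨i, rfl⟩)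
    rw [row_mul _ _ ((hker _).2 (hF j))] at h2
    have h4 : ρ c • row (F j) ∈ W ⊔ W' :=
      h2 ▸ Submodule.add_mem_sup (hIW _ h1) h3
    exact (Submodule.smul_mem_iff _ fun h => hc ((hker _).1 h)).1 h4
  have hli : LinearIndependent K fun j => row (F j) :=
    linearIndependent_of_det_notMem ρ (Matrix.of fun j l => D l (F j)) V
      fun h => hdet ((hker _).1 h)
  -- The e independent differentials lie in W + W', and W' has dimension at most d, the height of Q.
  have he : e ≤ Module.finrank K W + d := by
    calc e = Module.finrank K (Submodule.span K (Set.range fun j => row (F j))) := by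
          rw [finrank_span_eq_card hli, Fintype.card_fin]
      _ ≤ Module.finrank K (W ⊔ W' : Submodule K (Fin N → K)) := by
          refine Submodule.finrank_mono (Submodule.span_le.2 ?_)
          rintro _ ⟨j, rfl⟩
          exact hFW j
      _ ≤ Module.finrank K W + Module.finrank K W' :=
          Submodule.finrank_add_le_finrank_add_finrank W W'
      _ ≤ Module.finrank K W + d := by
          gcongr
          simpa [hW', Set.finrank] using finrank_range_le_card (R := K) fun i => row (τ' i)
  refine exists_linearIndependent_comp (fun i => row (f i)) ?_
  -- The count: d + coheight Q ≤ n and 2n ≤ coheight Q + e give e - d ≥ n, so W has dimension at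
  -- least n.
  have h1 := height_add_coheight_le_of_ringKrullDim_le Q hdim
  have h2 := coheight_comap_le_coheight (Ideal.Quotient.mk I) ⊥
    (RingHom.isIntegral_of_surjective _
      (Ideal.Quotient.mk_surjective.comp Ideal.Quotient.mk_surjective)) Q bot_le
  have h3 := hm.trans (add_le_add_left h2 _)
  rw [← hd] at h1
  have hlt : Order.coheight Q ≠ ⊤ := fun h => by rw [h] at h1; simp at h1
  obtain ⟨q, hq⟩ := ENat.ne_top_iff_exists.1 hlt
  rw [← hq] at h1 h3
  have h1' : d + q ≤ n := by exact_mod_cast h1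
  have h3' : N ≤ q + e := by exact_mod_cast h3
  rw [hW] at he
  omega

end Jacobian

/-! ### Analytic germs in a chart -/

noncomputable section Charts

set_option linter.unusedSectionVars false

namespace SingularLagrangian

universe u

variable {𝕂 : Type} [RCLike 𝕂] {n : ℕ} {M : Type u} [TopologicalSpace M]
  [ChartedSpace (Model 𝕂 n) M] [IsManifold 𝓘(𝕂, Model 𝕂 n) ω M]

theorem contDiffAt_omega_iff {E F : Type*} [NormedAddCommGroup E] [NormedSpace 𝕂 E]
    [NormedAddCommGroup F] [NormedSpace 𝕂 F] [CompleteSpace F] {f : E → F} {x : E} :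
    ContDiffAt 𝕂 ω f x ↔ AnalyticAt 𝕂 f x := by
  rw [← contDiffWithinAt_univ, contDiffWithinAt_omega_iff_analyticWithinAt, analyticWithinAt_univ]

theorem contMDiffAt_chart {e : OpenPartialHomeomorph M (Model 𝕂 n)}
    (he : e ∈ atlas (Model 𝕂 n) M) {y : M} (hy : y ∈ e.source) :
    ContMDiffAt 𝓘(𝕂, Model 𝕂 n) 𝓘(𝕂, Model 𝕂 n) ω e y :=
  (contMDiffOn_of_mem_maximalAtlas (IsManifold.subset_maximalAtlas he)).contMDiffAt
    (e.open_source.mem_nhds hy)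

theorem contMDiffAt_chart_symm {e : OpenPartialHomeomorph M (Model 𝕂 n)}
    (he : e ∈ atlas (Model 𝕂 n) M) {z : Model 𝕂 n} (hz : z ∈ e.target) :
    ContMDiffAt 𝓘(𝕂, Model 𝕂 n) 𝓘(𝕂, Model 𝕂 n) ω e.symm z :=
  (contMDiffOn_symm_of_mem_maximalAtlas (IsManifold.subset_maximalAtlas he)).contMDiffAt
    (e.open_target.mem_nhds hz)

theorem contMDiffAt_comp_chart {e : OpenPartialHomeomorph M (Model 𝕂 n)}
    (he : e ∈ atlas (Model 𝕂 n) M) {y : M} (hy : y ∈ e.source) {f : Model 𝕂 n → 𝕂}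
    (hf : AnalyticAt 𝕂 f (e y)) : ContMDiffAt 𝓘(𝕂, Model 𝕂 n) 𝓘(𝕂, 𝕂) ω (fun z => f (e z)) y :=
  ContMDiffAt.comp y (contMDiffAt_iff_contDiffAt.2 (contDiffAt_omega_iff.2 hf))
    (contMDiffAt_chart he hy)

theorem analyticAt_comp_symm {e : OpenPartialHomeomorph M (Model 𝕂 n)}
    (he : e ∈ atlas (Model 𝕂 n) M) {y : M} (hy : y ∈ e.source) {f : M → 𝕂}
    (hf : ContMDiffAt 𝓘(𝕂, Model 𝕂 n) 𝓘(𝕂, 𝕂) ω f y) :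
    AnalyticAt 𝕂 (fun z => f (e.symm z)) (e y) := by
  rw [← contDiffAt_omega_iff, ← contMDiffAt_iff_contDiffAt]
  refine ContMDiffAt.comp (e y) (g := f) ?_ (contMDiffAt_chart_symm he (e.map_source hy))
  rwa [e.left_inv hy]

theorem eventually_symm_chart {e : OpenPartialHomeomorph M (Model 𝕂 n)} {y : M}
    (hy : y ∈ e.source) : ∀ᶠ z in 𝓝 y, e.symm (e z) = z :=
  Filter.mem_of_superset (e.open_source.mem_nhds hy) fun _ hz => e.left_inv hz

theorem tendsto_symm_add {e : OpenPartialHomeomorph M (Model 𝕂 n)} {y : M}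
    (hy : y ∈ e.source) : Tendsto (fun z => e.symm (z + e y)) (𝓝 0) (𝓝 y) := by
  have h1 : Tendsto e.symm (𝓝 (e y)) (𝓝 y) := by
    have := (e.continuousAt_symm (e.map_source hy)).tendsto
    rwa [e.left_inv hy] at this
  refine h1.comp ?_
  have : Tendsto (fun z : Model 𝕂 n => z + e y) (𝓝 0) (𝓝 (0 + e y)) :=
    (continuous_id.add continuous_const).tendsto 0
  rwa [zero_add] at this

theorem tendsto_sub_chart {e : OpenPartialHomeomorph M (Model 𝕂 n)} {y : M}
    (hy : y ∈ e.source) : Tendsto (fun z => e z - e y) (𝓝 y) (𝓝 0) := by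
  have := (e.continuousAt hy).tendsto.sub_const (e y)
  rwa [sub_self] at this

/-- Analytic germs on `M` as analytic germs at the origin of the model space. -/
def toPower {e : OpenPartialHomeomorph M (Model 𝕂 n)} (he : e ∈ atlas (Model 𝕂 n) M) {y : M}
    (hy : y ∈ e.source) : AnalyticGerm 𝕂 n y ≃+* PowerGerm 𝕂 (Model 𝕂 n) where
  toFun a := ⟨a.1.compTendsto _ (tendsto_symm_add hy), by
    obtain ⟨_, f, hf, rfl⟩ := a
    refine ⟨fun z => f (e.symm (z + e y)), ?_, rfl⟩
    have h := analyticAt_comp_symm he hy hf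
    rw [← zero_add (e y)] at h
    exact AnalyticAt.fun_comp (g := fun z => f (e.symm z)) (f := fun z => z + e y) h (by fun_prop)⟩
  invFun b := ⟨b.1.compTendsto _ (tendsto_sub_chart hy), by
    obtain ⟨_, f, hf, rfl⟩ := b
    refine ⟨fun z => f (e z - e y), ?_, rfl⟩
    refine contMDiffAt_comp_chart he hy (f := fun z => f (z - e y)) ?_
    rw [← sub_self (e y)] at hf
    exact AnalyticAt.fun_comp (g := f) (f := fun z => z - e y) hf (by fun_prop)⟩
  left_inv a := by
    obtain ⟨_, f, hf, rfl⟩ := a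
    refine Subtype.ext (Germ.coe_eq.2 ?_)
    filter_upwards [eventually_symm_chart hy] with z hz
    simp only [Function.comp_apply, sub_add_cancel, hz]
  right_inv b := by
    obtain ⟨_, f, hf, rfl⟩ := b
    refine Subtype.ext (Germ.coe_eq.2 ?_)
    have h1 : Tendsto (fun z : Model 𝕂 n => z + e y) (𝓝 0) (𝓝 (0 + e y)) :=
    (continuous_id.add continuous_const).tendsto 0
    rw [zero_add] at h1
    filter_upwards [h1 (e.open_target.mem_nhds (e.map_source hy))] with z hz
    simp only [Function.comp_apply]
    rw [e.right_inv hz, add_sub_cancel_right]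
  map_mul' a b := by
    obtain ⟨_, f, hf, rfl⟩ := a
    obtain ⟨_, g, hg, rfl⟩ := b
    rfl
  map_add' a b := by
    obtain ⟨_, f, hf, rfl⟩ := a
    obtain ⟨_, g, hg, rfl⟩ := b
    rfl

/-- The germ of a function analytic at a point. -/
def AnalyticGerm.mk {y : M} (f : M → 𝕂) (hf : ContMDiffAt 𝓘(𝕂, Model 𝕂 n) 𝓘(𝕂, 𝕂) ω f y) :
    AnalyticGerm 𝕂 n y := ⟨(f : Germ (𝓝 y) 𝕂), f, hf, rfl⟩

theorem AnalyticGerm.exists_mk {y : M} (a : AnalyticGerm 𝕂 n y) :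
    ∃ f hf, a = AnalyticGerm.mk f hf := by
  obtain ⟨_, f, hf, rfl⟩ := a
  exact ⟨f, hf, rfl⟩

/-- The partial derivative of a function in a chart. -/
def chartDeriv (e : OpenPartialHomeomorph M (Model 𝕂 n)) (v : Model 𝕂 n) (f : M → 𝕂) (y : M) :
    𝕂 := fderiv 𝕂 (fun z => f (e.symm z)) (e y) v

theorem contMDiffAt_chartDeriv {e : OpenPartialHomeomorph M (Model 𝕂 n)}
    (he : e ∈ atlas (Model 𝕂 n) M) {y : M} (hy : y ∈ e.source) {f : M → 𝕂}
    (hf : ContMDiffAt 𝓘(𝕂, Model 𝕂 n) 𝓘(𝕂, 𝕂) ω f y) (v : Model 𝕂 n) :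
    ContMDiffAt 𝓘(𝕂, Model 𝕂 n) 𝓘(𝕂, 𝕂) ω (chartDeriv e v f) y :=
  contMDiffAt_comp_chart he hy
    (PowerGerm.analyticAt_fderiv_apply (analyticAt_comp_symm he hy hf) v)

/-- The partial derivative as a derivation of the ring of germs. -/
def germDeriv {e : OpenPartialHomeomorph M (Model 𝕂 n)} (he : e ∈ atlas (Model 𝕂 n) M) {y : M}
    (hy : y ∈ e.source) (v : Model 𝕂 n) :
    Derivation ℤ (AnalyticGerm 𝕂 n y) (AnalyticGerm 𝕂 n y) :=
  Derivation.mk' (AddMonoidHom.toIntLinearMap (AddMonoidHom.mk'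
    (fun a => (toPower he hy).symm (PowerGerm.deriv v (toPower he hy a)))
      fun a b => by simp only [map_add])) fun a b => by
    change (toPower he hy).symm (PowerGerm.deriv v (toPower he hy (a * b))) =
      a * (toPower he hy).symm (PowerGerm.deriv v (toPower he hy b)) +
      b * (toPower he hy).symm (PowerGerm.deriv v (toPower he hy a))
    rw [map_mul, Derivation.leibniz, map_add, smul_eq_mul, smul_eq_mul, map_mul, map_mul,
      RingEquiv.symm_apply_apply, RingEquiv.symm_apply_apply]

theorem germDeriv_apply {e : OpenPartialHomeomorph M (Model 𝕂 n)} (he : e ∈ atlas (Model 𝕂 n) M)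
    {y : M} (hy : y ∈ e.source) (v : Model 𝕂 n) (a : AnalyticGerm 𝕂 n y) :
    germDeriv he hy v a = (toPower he hy).symm (PowerGerm.deriv v (toPower he hy a)) := rfl

theorem germDeriv_mk {e : OpenPartialHomeomorph M (Model 𝕂 n)} (he : e ∈ atlas (Model 𝕂 n) M)
    {y : M} (hy : y ∈ e.source) (v : Model 𝕂 n) {f : M → 𝕂}
    (hf : ContMDiffAt 𝓘(𝕂, Model 𝕂 n) 𝓘(𝕂, 𝕂) ω f y) :
    germDeriv he hy v (AnalyticGerm.mk f hf) =
      AnalyticGerm.mk (chartDeriv e v f) (contMDiffAt_chartDeriv he hy hf v) := by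
  refine Subtype.ext (Germ.coe_eq.2 (Eventually.of_forall fun z => ?_))
  change fderiv 𝕂 (fun z => f (e.symm (z + e y))) (e z - e y) v = chartDeriv e v f z
  rw [fderiv_comp_add_right (f := fun z => f (e.symm z)), sub_add_cancel]
  rfl

/-- The standard basis of the model space. -/
abbrev stdVec (𝕂 : Type) [RCLike 𝕂] (n : ℕ) (l : Fin (2 * n)) : Model 𝕂 n :=
  EuclideanSpace.single l 1

theorem linearMap_apply_eq_sum {F : Type*} [AddCommGroup F] [Module 𝕂 F]
    (φ : Model 𝕂 n →ₗ[𝕂] F) (v : Model 𝕂 n) : φ v = ∑ l, v l • φ (stdVec 𝕂 n l) := by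
  conv_lhs => rw [← (EuclideanSpace.basisFun (Fin (2 * n)) 𝕂).sum_repr v]
  rw [map_sum]
  simp only [map_smul, EuclideanSpace.basisFun_repr, EuclideanSpace.basisFun_apply]

theorem isNoetherianRing_analyticGerm (y : M) : IsNoetherianRing (AnalyticGerm 𝕂 n y) := by
  have h1 := PowerGerm.isNoetherianRing (𝕂 := 𝕂) (2 * n)
  have h2 : IsNoetherianRing (PowerGerm 𝕂 (Model 𝕂 n)) :=
    isNoetherianRing_of_ringEquiv _
      (PowerGerm.pullEquiv (EuclideanSpace.equiv (Fin (2 * n)) 𝕂))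
  exact isNoetherianRing_of_ringEquiv _
    (toPower (chart_mem_atlas (Model 𝕂 n) y) (mem_chart_source _ y)).symm

theorem isUnit_analyticGerm {y : M} {f : M → 𝕂}
    (hf : ContMDiffAt 𝓘(𝕂, Model 𝕂 n) 𝓘(𝕂, 𝕂) ω f y) (h0 : f y ≠ 0) :
    IsUnit (AnalyticGerm.mk f hf) := by
  have hm := mem_chart_source (Model 𝕂 n) y
  rw [← MulEquiv.isUnit_map (toPower (chart_mem_atlas (Model 𝕂 n) y) hm)]
  obtain ⟨g, hg, h⟩ := PowerGerm.exists_mk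
    (toPower (chart_mem_atlas (Model 𝕂 n) y) hm (AnalyticGerm.mk f hf))
  rw [h]
  refine PowerGerm.isUnit_mk hg ?_
  have h1 : (fun z => f ((chartAt (Model 𝕂 n) y).symm (z + chartAt (Model 𝕂 n) y y))) =ᶠ[𝓝 0] g :=
    Germ.coe_eq.1 (congrArg Subtype.val h)
  rw [← h1.self_of_nhds]
  beta_reduce
  rw [zero_add, (chartAt (Model 𝕂 n) y).left_inv hm]
  exact h0

theorem isLocalRing_analyticGerm (y : M) : IsLocalRing (AnalyticGerm 𝕂 n y) := by
  have : Nontrivial (AnalyticGerm 𝕂 n y) := ⟨0, 1, fun h => by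
    have h1 : (fun _ : M => (0 : 𝕂)) =ᶠ[𝓝 y] fun _ => 1 := Germ.coe_eq.1 (congrArg Subtype.val h)
    exact zero_ne_one h1.self_of_nhds⟩
  refine IsLocalRing.of_isUnit_or_isUnit_one_sub_self fun a => ?_
  obtain ⟨f, hf, rfl⟩ := AnalyticGerm.exists_mk a
  by_cases h : f y = 0
  · right
    exact isUnit_analyticGerm (f := fun z => 1 - f z) (contMDiffAt_const.sub hf)
      (by rw [h, sub_zero]; exact one_ne_zero)
  · exact Or.inl (isUnit_analyticGerm hf h)

theorem deriv_eq_sum (v : Model 𝕂 n) (a : PowerGerm 𝕂 (Model 𝕂 n)) :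
    PowerGerm.deriv v a = ∑ l, PowerGerm.deriv (stdVec 𝕂 n l) a *
      PowerGerm.mk (fun _ => v l) analyticAt_const := by
  obtain ⟨f, hf, rfl⟩ := PowerGerm.exists_mk a
  simp only [PowerGerm.deriv_mk, PowerGerm.mk_mul]
  rw [PowerGerm.mk_sum, PowerGerm.mk_eq_mk]
  refine Eventually.of_forall fun y => ?_
  have := linearMap_apply_eq_sum (fderiv 𝕂 f y).toLinearMap v
  simp only [smul_eq_mul, ContinuousLinearMap.coe_coe, mul_comm (v _)] at this
  exact this

/-- Transport from the origin of the model space. The directions of differentiation have constant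
components in the standard basis; these are the entries of the matrix multiplying the full Jacobian.
-/
theorem hasIndependentEquations_analyticGerm {e : OpenPartialHomeomorph M (Model 𝕂 n)}
    (he : e ∈ atlas (Model 𝕂 n) M) {y : M} (hy : y ∈ e.source)
    (P : PrimeSpectrum (AnalyticGerm 𝕂 n y)) :
    HasIndependentEquations (fun l => germDeriv he hy (stdVec 𝕂 n l)) P := by
  obtain ⟨k, F, v, c, hF, hc, hcF, hdet, hm⟩ := PowerGerm.HasLocalEquations.pull
    (EuclideanSpace.equiv (Fin (2 * n)) 𝕂)
    (P := PrimeSpectrum.comap ((toPower he hy).symm : _ →+* AnalyticGerm 𝕂 n y) P)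
    (PowerGerm.hasLocalEquations (2 * n) _)
  have hinv : ∀ a, (toPower he hy).symm (toPower he hy a) = a :=
    (toPower he hy).symm_apply_apply
  refine ⟨k, fun i => (toPower he hy).symm (F i), Matrix.of fun l i => (toPower he hy).symm
    (PowerGerm.mk (fun _ => v i l) analyticAt_const), (toPower he hy).symm c, hF, hc,
    fun a ha => ?_, ?_, hm.trans ?_⟩
  · have h1 := hcF (toPower he hy a) (by
      change (toPower he hy).symm (toPower he hy a) ∈ P.asIdeal
      rwa [hinv])
    have h2 := Ideal.mem_map_of_mem
      ((toPower he hy).symm : PowerGerm 𝕂 (Model 𝕂 n) →+* AnalyticGerm 𝕂 n y) h1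
    rw [Ideal.map_span, ← Set.range_comp, map_mul] at h2
    simp only [RingHom.coe_coe, hinv] at h2
    exact h2
  · have h1 : (Matrix.of fun j l => germDeriv he hy (stdVec 𝕂 n l) ((toPower he hy).symm (F j))) *
        (Matrix.of fun l i => (toPower he hy).symm
          (PowerGerm.mk (fun _ => v i l) analyticAt_const)) =
        (((toPower he hy).symm : PowerGerm 𝕂 (Model 𝕂 n) →+* AnalyticGerm 𝕂 n y).mapMatrix
          (Matrix.of fun i j => PowerGerm.deriv (v i) (F j))).transpose := by
      refine Matrix.ext fun j i => ?_
      simp only [Matrix.mul_apply, Matrix.of_apply, germDeriv_apply, RingEquiv.apply_symm_apply,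
        ← map_mul, ← map_sum, Matrix.transpose_apply, RingHom.mapMatrix_apply, Matrix.map_apply,
        RingHom.coe_coe]
      rw [deriv_eq_sum (v i) (F j)]
    rw [h1, Matrix.det_transpose, ← RingHom.map_det]
    exact hdet
  · gcongr
    refine (coheight_comap_le_coheight _ ⊥ ?_ P bot_le)
    refine RingHom.isIntegral_of_surjective _ ?_
    exact Ideal.Quotient.mk_surjective.comp (toPower he hy).symm.surjective

end SingularLagrangian

end Charts

/-! ### Differentials and Poisson brackets in a chart -/

noncomputable section Poisson

set_option linter.unusedSectionVars false

namespace SingularLagrangian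

universe u

variable {𝕂 : Type} [RCLike 𝕂] {n : ℕ} {M : Type u} [TopologicalSpace M]
  [ChartedSpace (Model 𝕂 n) M] [IsManifold 𝓘(𝕂, Model 𝕂 n) ω M]

/-- The coordinate functions of a chart. -/
def coordFun (e : OpenPartialHomeomorph M (Model 𝕂 n)) (l : Fin (2 * n)) (z : M) : 𝕂 := e z l

theorem contMDiffAt_coordFun {e : OpenPartialHomeomorph M (Model 𝕂 n)}
    (he : e ∈ atlas (Model 𝕂 n) M) (l : Fin (2 * n)) {y : M} (hy : y ∈ e.source) :
    ContMDiffAt 𝓘(𝕂, Model 𝕂 n) 𝓘(𝕂, 𝕂) ω (coordFun e l) y :=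
  contMDiffAt_comp_chart he hy (f := fun v => v l)
    ((EuclideanSpace.proj l : Model 𝕂 n →L[𝕂] 𝕂).analyticAt _)

/-- The differential of a function, as a covector of the model space. -/
def covDeriv (f : M → 𝕂) (y : M) : Model 𝕂 n →L[𝕂] 𝕂 :=
  mfderiv 𝓘(𝕂, Model 𝕂 n) 𝓘(𝕂, 𝕂) f y

/-- The differential of a chart, as a linear map of the model space. -/
def chartDiff (e : OpenPartialHomeomorph M (Model 𝕂 n)) (y : M) : Model 𝕂 n →L[𝕂] Model 𝕂 n :=
  mfderiv 𝓘(𝕂, Model 𝕂 n) 𝓘(𝕂, Model 𝕂 n) e y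

theorem covDeriv_eq_comp {e : OpenPartialHomeomorph M (Model 𝕂 n)}
    (he : e ∈ atlas (Model 𝕂 n) M) {y : M} (hy : y ∈ e.source) {f : M → 𝕂}
    (hf : ContMDiffAt 𝓘(𝕂, Model 𝕂 n) 𝓘(𝕂, 𝕂) ω f y) :
    covDeriv f y = (fderiv 𝕂 (fun z => f (e.symm z)) (e y)).comp (chartDiff e y) := by
  have h1 : f =ᶠ[𝓝 y] (fun z => f (e.symm z)) ∘ e := by
    filter_upwards [eventually_symm_chart hy] with z hz
    simp only [Function.comp_apply, hz]
  have h2 := mfderiv_comp y (I := 𝓘(𝕂, Model 𝕂 n)) (I' := 𝓘(𝕂, Model 𝕂 n)) (I'' := 𝓘(𝕂, 𝕂))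
    (g := fun z => f (e.symm z)) (f := e)
    (analyticAt_comp_symm he hy hf).differentiableAt.mdifferentiableAt
    ((contMDiffAt_chart he hy).mdifferentiableAt (by simp))
  rw [← h1.mfderiv_eq, mfderiv_eq_fderiv] at h2
  exact h2

theorem covDeriv_coordFun {e : OpenPartialHomeomorph M (Model 𝕂 n)}
    (he : e ∈ atlas (Model 𝕂 n) M) {y : M} (hy : y ∈ e.source) (l : Fin (2 * n)) (w : Model 𝕂 n) :
    covDeriv (coordFun e l) y w = chartDiff e y w l := by
  rw [covDeriv_eq_comp he hy (contMDiffAt_coordFun he l hy)]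
  have h1 : (fun z => coordFun e l (e.symm z)) =ᶠ[𝓝 (e y)]
      (EuclideanSpace.proj l : Model 𝕂 n →L[𝕂] 𝕂) := by
    filter_upwards [e.open_target.mem_nhds (e.map_source hy)] with z hz
    simp [coordFun, e.right_inv hz]
  rw [h1.fderiv_eq, ContinuousLinearMap.fderiv]
  rfl

theorem covDeriv_eq_sum {e : OpenPartialHomeomorph M (Model 𝕂 n)}
    (he : e ∈ atlas (Model 𝕂 n) M) {y : M} (hy : y ∈ e.source) {f : M → 𝕂}
    (hf : ContMDiffAt 𝓘(𝕂, Model 𝕂 n) 𝓘(𝕂, 𝕂) ω f y) :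
    covDeriv (n := n) f y =
      ∑ l, chartDeriv e (stdVec 𝕂 n l) f y • covDeriv (coordFun e l) y := by
  ext w
  rw [covDeriv_eq_comp he hy hf, ContinuousLinearMap.comp_apply]
  have := linearMap_apply_eq_sum (fderiv 𝕂 (fun z => f (e.symm z)) (e y)).toLinearMap
    (chartDiff e y w)
  rw [ContinuousLinearMap.coe_coe] at this
  rw [this, sum_apply]
  refine Finset.sum_congr rfl fun l _ => ?_
  rw [smul_apply, covDeriv_coordFun he hy, smul_eq_mul, smul_eq_mul, mul_comm]
  rfl

/-- The germ of a field of covectors. -/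
def covectorGermHom (x : M) : (M → Model 𝕂 n →L[𝕂] 𝕂) →+ CovectorGerm 𝕂 n x :=
  Germ.coeAddHom (𝓝 x)

theorem covectorGermHom_eq {x : M} {f g : M → Model 𝕂 n →L[𝕂] 𝕂} (h : f =ᶠ[𝓝 x] g) :
    covectorGermHom x f = covectorGermHom x g := Germ.coe_eq.2 h

/-- The germ of a coordinate function. -/
def coordGerm {e : OpenPartialHomeomorph M (Model 𝕂 n)} (he : e ∈ atlas (Model 𝕂 n) M) {y : M}
    (hy : y ∈ e.source) (l : Fin (2 * n)) : AnalyticGerm 𝕂 n y :=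
  AnalyticGerm.mk (coordFun e l) (contMDiffAt_coordFun he l hy)

theorem d_eq_sum {e : OpenPartialHomeomorph M (Model 𝕂 n)} (he : e ∈ atlas (Model 𝕂 n) M)
    {y : M} (hy : y ∈ e.source) (a : AnalyticGerm 𝕂 n y) :
    d a = ∑ l, germDeriv he hy (stdVec 𝕂 n l) a • d (coordGerm he hy l) := by
  obtain ⟨f, hf, rfl⟩ := AnalyticGerm.exists_mk a
  refine Subtype.ext ?_
  rw [Submodule.coe_sum]
  have h1 : ∀ l, ((germDeriv he hy (stdVec 𝕂 n l) (AnalyticGerm.mk f hf) •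
      d (coordGerm he hy l) : FormGerm 𝕂 n y) : CovectorGerm 𝕂 n y) =
      covectorGermHom y fun z => chartDeriv e (stdVec 𝕂 n l) f z •
        covDeriv (coordFun e l) z := fun l => by
    rw [germDeriv_mk]
    rfl
  simp only [h1]
  rw [← map_sum]
  change covectorGermHom y (covDeriv f) = _
  refine covectorGermHom_eq ?_
  filter_upwards [(contMDiffAt_iff_contMDiffAt_nhds (by simp)).1 hf, e.open_source.mem_nhds hy]
    with z hz hz'
  rw [Finset.sum_apply]
  exact covDeriv_eq_sum he hz' hz

theorem formGerm_eq_span {e : OpenPartialHomeomorph M (Model 𝕂 n)}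
    (he : e ∈ atlas (Model 𝕂 n) M) {y : M} (hy : y ∈ e.source) :
    FormGerm 𝕂 n y = Submodule.span (AnalyticGerm 𝕂 n y)
      (Set.range fun l => (d (coordGerm he hy l) : CovectorGerm 𝕂 n y)) := by
  refine le_antisymm (Submodule.span_le.2 ?_) (Submodule.span_le.2 ?_)
  · rintro _ ⟨a, rfl⟩
    have h := congrArg Subtype.val (d_eq_sum he hy a)
    rw [Submodule.coe_sum] at h
    refine (congrArg (· ∈ Submodule.span _ _) h).mpr ?_
    exact sum_mem fun l _ => Submodule.smul_mem _ _ (Submodule.subset_span ⟨l, rfl⟩)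
  · rintro _ ⟨l, rfl⟩
    exact (d (coordGerm he hy l)).2

/-! ### The Poisson pairing of one-forms -/

variable (σ : SymplecticForm 𝕂 n M)

/-- The field of vectors corresponding to a field of covectors. -/
def sharpGerm (x : M) : CovectorGerm 𝕂 n x → Germ (𝓝 x) (Model 𝕂 n) :=
  Germ.map' (fun (α : M → Model 𝕂 n →L[𝕂] 𝕂) z => (σ.flat z).symm (α z).toLinearMap)
    fun _ _ h => h.mono fun z hz => by simp only [hz]

/-- The Poisson pairing of fields of covectors. -/
def poissonGerm (x : M) (α β : CovectorGerm 𝕂 n x) : Germ (𝓝 x) 𝕂 :=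
  Germ.map₂ (fun (b : Model 𝕂 n →L[𝕂] 𝕂) v => b v) β (sharpGerm σ x α)

theorem poissonGerm_add_left (x : M) (α α' β : CovectorGerm 𝕂 n x) :
    poissonGerm σ x (α + α') β = poissonGerm σ x α β + poissonGerm σ x α' β := by
  refine Germ.inductionOn₃ α α' β fun α α' β => Germ.coe_eq.2 (Eventually.of_forall fun z => ?_)
  change β z ((σ.flat z).symm (α z + α' z).toLinearMap) = _
  rw [ContinuousLinearMap.toLinearMap_add, map_add, map_add]

theorem poissonGerm_add_right (x : M) (α β β' : CovectorGerm 𝕂 n x) :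
    poissonGerm σ x α (β + β') = poissonGerm σ x α β + poissonGerm σ x α β' := by
  refine Germ.inductionOn₃ α β β' fun α β β' => ?_
  rfl

theorem poissonGerm_smul_left (x : M) (a : Germ (𝓝 x) 𝕂) (α β : CovectorGerm 𝕂 n x) :
    poissonGerm σ x (a • α) β = a * poissonGerm σ x α β := by
  refine Germ.inductionOn₃ a α β fun a α β => Germ.coe_eq.2 (Eventually.of_forall fun z => ?_)
  change β z ((σ.flat z).symm (a z • α z).toLinearMap) = _
  rw [ContinuousLinearMap.toLinearMap_smul, map_smul, map_smul]
  rfl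

theorem poissonGerm_smul_right (x : M) (a : Germ (𝓝 x) 𝕂) (α β : CovectorGerm 𝕂 n x) :
    poissonGerm σ x α (a • β) = a * poissonGerm σ x α β := by
  refine Germ.inductionOn₃ a α β fun a α β => ?_
  rfl

/-- The matrix of the symplectic form in a chart. -/
def formMatrix (e : OpenPartialHomeomorph M (Model 𝕂 n)) (z : Model 𝕂 n) :
    Matrix (Fin (2 * n)) (Fin (2 * n)) 𝕂 :=
  Matrix.of fun j l => pullbackToChart σ.form e z ![stdVec 𝕂 n j, stdVec 𝕂 n l]

/-- The Poisson brackets of the coordinates of a chart. -/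
def bracketMatrix (e : OpenPartialHomeomorph M (Model 𝕂 n)) (y : M) :
    Matrix (Fin (2 * n)) (Fin (2 * n)) 𝕂 :=
  Matrix.of fun j l => σ.poisson (coordFun e j) (coordFun e l) y

theorem flat_hamiltonian (f : M → 𝕂) (x : M) (w : Model 𝕂 n) :
    toBilin (σ.form x) (σ.hamiltonian f x) w =
      covDeriv f x w :=
  LinearMap.congr_fun ((σ.flat x).apply_symm_apply
    (mfderiv 𝓘(𝕂, Model 𝕂 n) 𝓘(𝕂, 𝕂) f x).toLinearMap) w

/-- The l-th component of the hamiltonian field of x_j is {x_j, x_l}, so the (j, m) entry of the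
product is σ(H_{x_j}, ∂_m) = dx_j(∂_m). -/
theorem bracketMatrix_mul_formMatrix {e : OpenPartialHomeomorph M (Model 𝕂 n)}
    (he : e ∈ atlas (Model 𝕂 n) M) {y : M} (hy : y ∈ e.source) :
    bracketMatrix σ e y * formMatrix σ e (e y) = 1 := by
  have : IsManifold 𝓘(𝕂, Model 𝕂 n) 1 M := IsManifold.of_le (n := ω) (by simp)
  have hd := mdifferentiable_of_mem_atlas (I := 𝓘(𝕂, Model 𝕂 n)) he
  set E : Model 𝕂 n →L[𝕂] Model 𝕂 n := chartDiff e y with hE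
  set E' : Model 𝕂 n →L[𝕂] Model 𝕂 n := mfderiv 𝓘(𝕂, Model 𝕂 n) 𝓘(𝕂, Model 𝕂 n) e.symm (e y)
    with hE'
  have h1 : ∀ w, E' (E w) = w := fun w => DFunLike.congr_fun (hd.symm_comp_deriv hy) w
  have h2 : ∀ w, E (E' w) = w := fun w => by
    have := DFunLike.congr_fun (hd.comp_symm_deriv (e.map_source hy)) w
    rw [e.left_inv hy] at this
    exact this
  refine Matrix.ext fun j m => ?_
  set v : Model 𝕂 n := σ.hamiltonian (coordFun e j) y with hv
  have h3 : ∀ l, bracketMatrix σ e y j l = E v l := fun l => covDeriv_coordFun he hy l v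
  have h4 : ∀ l, formMatrix σ e (e y) l m =
      toBilin (σ.form y) (E' (stdVec 𝕂 n l)) (E' (stdVec 𝕂 n m)) := fun l => by
    change σ.form (e.symm (e y)) (fun i => E' (![stdVec 𝕂 n l, stdVec 𝕂 n m] i)) = _
    rw [e.left_inv hy]
    change _ = σ.form y ![E' (stdVec 𝕂 n l), E' (stdVec 𝕂 n m)]
    congr 1
    funext i
    fin_cases i <;> rfl
  rw [Matrix.mul_apply]
  simp only [h3, h4]
  have h5 := linearMap_apply_eq_sum
    (((toBilin (σ.form y)).flip (E' (stdVec 𝕂 n m))).comp E'.toLinearMap) (E v)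
  simp only [LinearMap.comp_apply, LinearMap.flip_apply, ContinuousLinearMap.coe_coe, h1,
    smul_eq_mul] at h5
  rw [← h5, hv, flat_hamiltonian, covDeriv_coordFun he hy]
  rw [h2, Matrix.one_apply]
  simp [stdVec]

theorem analyticAt_formMatrix {e : OpenPartialHomeomorph M (Model 𝕂 n)}
    (he : e ∈ atlas (Model 𝕂 n) M) {z : Model 𝕂 n} (hz : z ∈ e.target) (j l : Fin (2 * n)) :
    AnalyticAt 𝕂 (fun z => formMatrix σ e z j l) z := by
  have h1 := contDiffAt_omega_iff.1
    ((σ.analytic e he).contDiffAt (e.open_target.mem_nhds hz))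
  exact ((ContinuousAlternatingMap.apply 𝕂 (Model 𝕂 n) 𝕂
    ![stdVec 𝕂 n j, stdVec 𝕂 n l]).analyticAt _).comp h1

theorem analyticAt_det {E : Type*} [NormedAddCommGroup E] [NormedSpace 𝕂 E] {ι : Type*}
    [Fintype ι] [DecidableEq ι] {A : E → Matrix ι ι 𝕂} {z : E}
    (hA : ∀ i j, AnalyticAt 𝕂 (fun z => A z i j) z) : AnalyticAt 𝕂 (fun z => (A z).det) z := by
  simp only [Matrix.det_apply']
  refine Finset.analyticAt_fun_sum _ fun s _ => analyticAt_const.mul ?_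
  exact Finset.analyticAt_fun_prod _ fun i _ => hA _ _

theorem analyticAt_inv_apply {E : Type*} [NormedAddCommGroup E] [NormedSpace 𝕂 E] {ι : Type*}
    [Fintype ι] [DecidableEq ι] {A : E → Matrix ι ι 𝕂} {z : E}
    (hA : ∀ i j, AnalyticAt 𝕂 (fun z => A z i j) z) (h0 : (A z).det ≠ 0) (i j : ι) :
    AnalyticAt 𝕂 (fun z => (A z)⁻¹ i j) z := by
  simp only [Matrix.inv_def, Matrix.smul_apply, Ring.inverse_eq_inv', smul_eq_mul,
    Matrix.adjugate_apply]
  refine ((analyticAt_det hA).inv h0).mul (analyticAt_det fun k l => ?_)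
  by_cases h : k = j
  · subst h; simpa using analyticAt_const
  · simpa [Matrix.updateRow_ne h] using hA k l

theorem bracketMatrix_eq_inv {e : OpenPartialHomeomorph M (Model 𝕂 n)}
    (he : e ∈ atlas (Model 𝕂 n) M) {y : M} (hy : y ∈ e.source) :
    bracketMatrix σ e y = (formMatrix σ e (e y))⁻¹ :=
  (Matrix.inv_eq_left_inv (bracketMatrix_mul_formMatrix σ he hy)).symm

/-- Analyticity of the brackets comes from that of the form: the bracket matrix is its inverse,
given by Cramer's rule. -/
theorem contMDiffAt_bracketMatrix {e : OpenPartialHomeomorph M (Model 𝕂 n)}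
    (he : e ∈ atlas (Model 𝕂 n) M) {y : M} (hy : y ∈ e.source) (j l : Fin (2 * n)) :
    ContMDiffAt 𝓘(𝕂, Model 𝕂 n) 𝓘(𝕂, 𝕂) ω (fun y => bracketMatrix σ e y j l) y := by
  have h0 : (formMatrix σ e (e y)).det ≠ 0 := fun h => by
    have := congrArg Matrix.det (bracketMatrix_mul_formMatrix σ he hy)
    rw [Matrix.det_mul, h, mul_zero, Matrix.det_one] at this
    exact zero_ne_one this
  refine (contMDiffAt_comp_chart he hy (analyticAt_inv_apply
    (fun j l => analyticAt_formMatrix σ he (e.map_source hy) j l) h0 j l)).congr_of_eventuallyEq ?_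
  filter_upwards [e.open_source.mem_nhds hy] with z hz
  rw [bracketMatrix_eq_inv σ he hz]

/-- The germs of the Poisson brackets of the coordinates. -/
def bracketGerm {e : OpenPartialHomeomorph M (Model 𝕂 n)} (he : e ∈ atlas (Model 𝕂 n) M) {y : M}
    (hy : y ∈ e.source) : Matrix (Fin (2 * n)) (Fin (2 * n)) (AnalyticGerm 𝕂 n y) :=
  Matrix.of fun j l =>
    AnalyticGerm.mk (fun y => bracketMatrix σ e y j l) (contMDiffAt_bracketMatrix σ he hy j l)

theorem AnalyticGerm.mk_sum_mul {y : M} {ι : Type*} (s : Finset ι) (f g : ι → M → 𝕂)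
    (hf : ∀ i, ContMDiffAt 𝓘(𝕂, Model 𝕂 n) 𝓘(𝕂, 𝕂) ω (f i) y)
    (hg : ∀ i, ContMDiffAt 𝓘(𝕂, Model 𝕂 n) 𝓘(𝕂, 𝕂) ω (g i) y) (k : M → 𝕂)
    (hk : ContMDiffAt 𝓘(𝕂, Model 𝕂 n) 𝓘(𝕂, 𝕂) ω k y)
    (h : ∀ᶠ z in 𝓝 y, ∑ i ∈ s, f i z * g i z = k z) :
    ∑ i ∈ s, (AnalyticGerm.mk (f i) (hf i) * AnalyticGerm.mk (g i) (hg i) : AnalyticGerm 𝕂 n y) =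
      AnalyticGerm.mk k hk := by
  refine Subtype.ext ?_
  rw [AddSubmonoidClass.coe_finsetSum]
  have : ∑ i ∈ s, ((AnalyticGerm.mk (f i) (hf i) * AnalyticGerm.mk (g i) (hg i) :
      AnalyticGerm 𝕂 n y) : Germ (𝓝 y) 𝕂) = Germ.coeAddHom (𝓝 y) (∑ i ∈ s, f i * g i) := by
    rw [map_sum]; rfl
  rw [this]
  refine Germ.coe_eq.2 (h.mono fun z hz => ?_)
  rw [Finset.sum_apply]
  exact hz

theorem exists_bracketGerm_mul_eq_one {e : OpenPartialHomeomorph M (Model 𝕂 n)}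
    (he : e ∈ atlas (Model 𝕂 n) M) {y : M} (hy : y ∈ e.source) :
    ∃ B, bracketGerm σ he hy * B = 1 := by
  refine ⟨Matrix.of fun j l => AnalyticGerm.mk (fun y => formMatrix σ e (e y) j l)
    (contMDiffAt_comp_chart he hy (analyticAt_formMatrix σ he (e.map_source hy) j l)), ?_⟩
  refine Matrix.ext fun j l => ?_
  rw [Matrix.mul_apply]
  have h1 : (1 : Matrix (Fin (2 * n)) (Fin (2 * n)) (AnalyticGerm 𝕂 n y)) j l =
      AnalyticGerm.mk (fun _ => (1 : Matrix (Fin (2 * n)) (Fin (2 * n)) 𝕂) j l)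
        contMDiffAt_const := by
    simp only [Matrix.one_apply]
    split_ifs <;> rfl
  rw [h1]
  refine AnalyticGerm.mk_sum_mul _ _ _ (fun i => contMDiffAt_bracketMatrix σ he hy j i)
    (fun i => contMDiffAt_comp_chart he hy
      (analyticAt_formMatrix σ he (e.map_source hy) i l)) _ _ ?_
  filter_upwards [e.open_source.mem_nhds hy] with z hz
  rw [← bracketMatrix_mul_formMatrix σ he hz, Matrix.mul_apply]

/-- By bilinearity it is enough to pair coordinate differentials, where the values are the analytic
bracket functions. -/
theorem poissonGerm_mem {y : M} {α β : CovectorGerm 𝕂 n y} (hα : α ∈ FormGerm 𝕂 n y)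
    (hβ : β ∈ FormGerm 𝕂 n y) : poissonGerm σ y α β ∈ AnalyticGerm 𝕂 n y := by
  have he := chart_mem_atlas (Model 𝕂 n) y
  have hy := mem_chart_source (Model 𝕂 n) y
  rw [formGerm_eq_span he hy] at hα hβ
  have hz : ∀ α, poissonGerm σ y α 0 = 0 := fun α => by
    have := poissonGerm_add_right σ y α 0 0
    simpa using this
  have hz' : ∀ α, poissonGerm σ y 0 α = 0 := fun α => by
    have := poissonGerm_add_left σ y 0 0 α
    simpa using this
  induction hα, hβ using Submodule.span_induction₂ with
  | mem_mem α β hα hβ =>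
    obtain ⟨j, rfl⟩ := hα
    obtain ⟨l, rfl⟩ := hβ
    exact (bracketGerm σ he hy j l).2
  | zero_left => rw [hz']; exact zero_mem _
  | zero_right => rw [hz]; exact zero_mem _
  | add_left _ _ _ _ _ _ h h' => rw [poissonGerm_add_left]; exact add_mem h h'
  | add_right _ _ _ _ _ _ h h' => rw [poissonGerm_add_right]; exact add_mem h h'
  | smul_left a _ _ _ _ h =>
    rw [show a • _ = (a : Germ (𝓝 y) 𝕂) • _ from rfl, poissonGerm_smul_left]
    exact mul_mem a.2 h
  | smul_right a _ _ _ _ h =>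
    rw [show a • _ = (a : Germ (𝓝 y) 𝕂) • _ from rfl, poissonGerm_smul_right]
    exact mul_mem a.2 h

/-- The Poisson pairing of germs of analytic one-forms. -/
def poissonForm (y : M) : FormGerm 𝕂 n y →ₗ[AnalyticGerm 𝕂 n y]
    FormGerm 𝕂 n y →ₗ[AnalyticGerm 𝕂 n y] AnalyticGerm 𝕂 n y :=
  LinearMap.mk₂ _ (fun α β => ⟨poissonGerm σ y α β, poissonGerm_mem σ α.2 β.2⟩)
    (fun _ _ _ => Subtype.ext (poissonGerm_add_left σ y _ _ _))
    (fun _ _ _ => Subtype.ext (poissonGerm_smul_left σ y _ _ _))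
    (fun _ _ _ => Subtype.ext (poissonGerm_add_right σ y _ _ _))
    (fun _ _ _ => Subtype.ext (poissonGerm_smul_right σ y _ _ _))

end SingularLagrangian

end Poisson

/-! ### The pairing of the conormal module with the module of differentials -/

noncomputable section CotangentPairing

variable {S : Type*} [CommRing S] (I : Ideal S) {F : Type*} [AddCommGroup F] [Module S F]
  (δ : S → F) (hadd : ∀ a b, δ (a + b) = δ a + δ b) (hmul : ∀ a b, δ (a * b) = a • δ b + b • δ a)
  (B : F →ₗ[S] F →ₗ[S] S) (hI : ∀ f ∈ I, ∀ g ∈ I, B (δ f) (δ g) ∈ I)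

theorem smul_mk_eq_zero (i : S) (hi : i ∈ I) (q : S ⧸ I) : i • q = 0 := by
  obtain ⟨q, rfl⟩ := Ideal.Quotient.mk_surjective q
  exact Ideal.Quotient.eq_zero_iff_mem.2 (I.mul_mem_right q hi)

/-- A form with values in `S ⧸ I` on the reduction of `F` modulo `I`. -/
def reduceForm (φ : F →ₗ[S] S) : (F ⧸ (I • (⊤ : Submodule S F))) →ₗ[S ⧸ I] S ⧸ I :=
  LinearMap.extendScalarsOfSurjective (R := S) Ideal.Quotient.mk_surjective
    (Submodule.liftQ _ ((Ideal.Quotient.mkₐ S I).toLinearMap ∘ₗ φ) (by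
      refine Submodule.smul_le.2 fun i hi x _ => ?_
      rw [LinearMap.mem_ker, map_smul]
      exact smul_mk_eq_zero I i hi _))

/-- The module of differentials of `S ⧸ I`. -/
abbrev QuotientForms : Type _ := (F ⧸ (I • (⊤ : Submodule S F))) ⧸
  Submodule.span (S ⧸ I) {θ : F ⧸ (I • (⊤ : Submodule S F)) | ∃ f ∈ I, θ = Submodule.Quotient.mk (δ f)}

include hI in
-- The place where involutivity is used: pairing with an element of I annihilates the differentials
-- of I modulo I, so it descends to the quotient defining the differentials of S ⧸ I.
theorem span_le_ker_reduceForm (f : S) (hf : f ∈ I) :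
    Submodule.span (S ⧸ I) {θ : F ⧸ (I • (⊤ : Submodule S F)) | ∃ f ∈ I, θ = Submodule.Quotient.mk (δ f)} ≤
      LinearMap.ker (reduceForm I (B (δ f))) := by
  refine Submodule.span_le.2 ?_
  rintro _ ⟨g, hg, rfl⟩
  exact Ideal.Quotient.eq_zero_iff_mem.2 (hI f hf g hg)

/-- The form on the differentials of `S ⧸ I` defined by an element of `I`. -/
def cotangentForm (f : I) : QuotientForms I δ →ₗ[S ⧸ I] S ⧸ I :=
  Submodule.liftQ _ (reduceForm I (B (δ f))) (span_le_ker_reduceForm I δ B hI f f.2)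

theorem cotangentForm_mk (f : I) (x : F) :
    cotangentForm I δ B hI f (Submodule.Quotient.mk (Submodule.Quotient.mk x)) =
      Ideal.Quotient.mk I (B (δ f) x) := rfl

theorem quotientForms_ext {φ ψ : QuotientForms I δ →ₗ[S ⧸ I] S ⧸ I}
    (h : ∀ x : F, φ (Submodule.Quotient.mk (Submodule.Quotient.mk x)) =
      ψ (Submodule.Quotient.mk (Submodule.Quotient.mk x))) : φ = ψ := by
  refine LinearMap.ext fun z => ?_
  obtain ⟨z, rfl⟩ := Submodule.Quotient.mk_surjective _ z
  obtain ⟨z, rfl⟩ := Submodule.Quotient.mk_surjective _ z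
  exact h z

/-- The map `f ↦ cotangentForm f`. -/
def cotangentFormHom : I →ₗ[S] QuotientForms I δ →ₗ[S ⧸ I] S ⧸ I where
  toFun := cotangentForm I δ B hI
  map_add' f g := quotientForms_ext I δ fun x => by
    rw [LinearMap.add_apply, cotangentForm_mk, cotangentForm_mk, cotangentForm_mk,
      Submodule.coe_add, hadd, map_add, LinearMap.add_apply, map_add]
  -- Of the two Leibniz terms of δ(a f), the one containing f as a factor dies modulo I.
  map_smul' a f := quotientForms_ext I δ fun x => by
    rw [RingHom.id_apply, LinearMap.smul_apply, cotangentForm_mk, cotangentForm_mk,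
      Submodule.coe_smul, smul_eq_mul, hmul, map_add, map_smul, map_smul,
      LinearMap.add_apply, map_add, LinearMap.smul_apply, LinearMap.smul_apply,
      smul_eq_mul, smul_eq_mul, map_mul, map_mul, Ideal.Quotient.eq_zero_iff_mem.2 f.2,
      zero_mul, add_zero]
    rfl

theorem smul_le_ker_cotangentFormHom : (I • (⊤ : Submodule S I)) ≤
    LinearMap.ker (cotangentFormHom I δ hadd hmul B hI) := by
  refine Submodule.smul_le.2 fun i hi f _ => ?_
  rw [LinearMap.mem_ker, map_smul]
  refine quotientForms_ext I δ fun x => ?_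
  rw [LinearMap.smul_apply, LinearMap.zero_apply]
  exact smul_mk_eq_zero I i hi _

/-- The pairing of `I / I²` with the differentials of `S ⧸ I`. -/
def cotangentPairing : I.Cotangent →ₗ[S ⧸ I] QuotientForms I δ →ₗ[S ⧸ I] S ⧸ I where
  toFun z := Submodule.liftQ (I • (⊤ : Submodule S I)) (cotangentFormHom I δ hadd hmul B hI)
    (smul_le_ker_cotangentFormHom I δ hadd hmul B hI) z
  map_add' z w := map_add (Submodule.liftQ (I • (⊤ : Submodule S I)) _ _) z w
  map_smul' r z := by
    obtain ⟨r, rfl⟩ := Ideal.Quotient.mk_surjective r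
    obtain ⟨f, rfl⟩ := I.toCotangent_surjective z
    exact map_smul (cotangentFormHom I δ hadd hmul B hI) r f

end CotangentPairing

/-! ### Germs and local functions -/

noncomputable section Stalks

set_option linter.unusedSectionVars false

namespace SingularLagrangian

universe u

variable {𝕂 : Type} [RCLike 𝕂] {n : ℕ} {M : Type u} [TopologicalSpace M]
  [ChartedSpace (Model 𝕂 n) M] [IsManifold 𝓘(𝕂, Model 𝕂 n) ω M]

theorem exists_opens_le {ι : Type*} [Fintype ι] {x : M} {V : Opens M} (hx : x ∈ V)
    (U : ι → Opens M) (hU : ∀ i, x ∈ U i) :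
    ∃ (V' : Opens M) (_ : V' ≤ V), x ∈ V' ∧ ∀ i, V' ≤ U i := by
  refine ⟨V ⊓ Finset.univ.inf U, inf_le_left, ⟨hx, ?_⟩,
    fun i => inf_le_right.trans (Finset.inf_le (Finset.mem_univ i))⟩
  classical
  have : ∀ s : Finset ι, x ∈ s.inf U := fun s => by
    induction s using Finset.induction_on with
    | empty => trivial
    | insert i s _ ih => rw [Finset.inf_insert]; exact ⟨hU i, ih⟩
  exact this _

theorem exists_localFunction {x : M} (a : AnalyticGerm 𝕂 n x) (V : Opens M) (hx : x ∈ V) :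
    ∃ (W : Opens M) (_ : W ≤ V) (hxW : x ∈ W) (f : LocalFunction 𝕂 n W), f.germ ⟨x, hxW⟩ = a := by
  obtain ⟨f, hf, rfl⟩ := AnalyticGerm.exists_mk a
  obtain ⟨W, hW, hWo, hxW⟩ := eventually_nhds_iff.1
    ((contMDiffAt_iff_contMDiffAt_nhds (by simp)).1 hf)
  exact ⟨⟨W, hWo⟩ ⊓ V, inf_le_right, ⟨hxW, hx⟩,
    ⟨f, fun y hy => (hW y hy.1).contMDiffWithinAt⟩, rfl⟩

/-- Finitely many germs are simultaneously represented by local functions. -/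
theorem exists_localFunctions {x : M} {k : ℕ} (a : Fin k → AnalyticGerm 𝕂 n x) (V : Opens M)
    (hx : x ∈ V) : ∃ (W : Opens M) (_ : W ≤ V) (hxW : x ∈ W) (f : Fin k → LocalFunction 𝕂 n W),
      ∀ i, (f i).germ ⟨x, hxW⟩ = a i := by
  choose W hWV hxW f hf using fun i => exists_localFunction (a i) V hx
  obtain ⟨W', hW', hxW', hle⟩ := exists_opens_le hx W hxW
  exact ⟨W', hW', hxW', fun i => (f i).res (hle i), hf⟩

theorem exists_eq_germ {V : Opens M} (f g : LocalFunction 𝕂 n V) (x : V)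
    (h : f.germ x = g.germ x) :
    ∃ (W : Opens M) (hW : W ≤ V), (x : M) ∈ W ∧
      ∀ y : W, f.germ ⟨y, hW y.2⟩ = g.germ ⟨y, hW y.2⟩ := by
  have h1 : f.toFun =ᶠ[𝓝 (x : M)] g.toFun := Germ.coe_eq.1 (congrArg Subtype.val h)
  obtain ⟨W, hW, hWo, hxW⟩ := eventually_nhds_iff.1 (eventually_eventually_nhds.2 h1)
  exact ⟨⟨W, hWo⟩ ⊓ V, inf_le_right, ⟨hxW, x.2⟩,
    fun y => Subtype.ext (Germ.coe_eq.2 (hW y y.2.1))⟩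

/-- The coefficients of the relation at x are represented by functions near x, and equality of two
germs persists in a neighbourhood. -/
theorem exists_eq_sum_germ {V : Opens M} {k : ℕ} (f : Fin k → LocalFunction 𝕂 n V)
    (g : LocalFunction 𝕂 n V) (x : V)
    (h : g.germ x ∈ Ideal.span (Set.range fun i => (f i).germ x)) :
    ∃ (W : Opens M) (hW : W ≤ V) (_ : (x : M) ∈ W) (c : Fin k → LocalFunction 𝕂 n W),
      ∀ y : W, g.germ ⟨y, hW y.2⟩ = ∑ i, (c i).germ y * (f i).germ ⟨y, hW y.2⟩ := by
  obtain ⟨a, ha⟩ := Ideal.mem_span_range_iff_exists_fun.1 h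
  obtain ⟨W, hW, hxW, c, hc⟩ := exists_localFunctions a V x.2
  have hs : ContMDiffOn 𝓘(𝕂, Model 𝕂 n) 𝓘(𝕂, 𝕂) ω
      (fun z => ∑ i, (c i).toFun z * (f i).toFun z) W :=
    contMDiffOn_finsetSum fun i _ => (c i).contMDiffOn.mul ((f i).contMDiffOn.mono hW)
  have hg : ∀ y : W, LocalFunction.germ (⟨_, hs⟩ : LocalFunction 𝕂 n W) y =
      ∑ i, (c i).germ y * (f i).germ ⟨y, hW y.2⟩ := fun y =>
    (AnalyticGerm.mk_sum_mul Finset.univ (fun i => (c i).toFun) (fun i => (f i).toFun)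
      (fun i => (c i).contMDiffOn.contMDiffAt (W.isOpen.mem_nhds y.2))
      (fun i => (f i).contMDiffOn.contMDiffAt (V.isOpen.mem_nhds (hW y.2))) _
      (hs.contMDiffAt (W.isOpen.mem_nhds y.2)) (Eventually.of_forall fun z => rfl)).symm
  obtain ⟨W', hW', hxW', h'⟩ := exists_eq_germ (g.res hW) ⟨_, hs⟩ ⟨x, hxW⟩ (by
    rw [hg, show (g.res hW).germ ⟨x, hxW⟩ = g.germ x from rfl, ← ha]
    exact Finset.sum_congr rfl fun i _ => by rw [hc i])
  refine ⟨W', hW'.trans hW, hxW', fun i => (c i).res hW', fun y => ?_⟩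
  exact (h' y).trans (hg ⟨y, hW' y.2⟩)

namespace AnalyticSubspace

variable (L : AnalyticSubspace 𝕂 n M)

/-- Local finite generation makes membership in the ideal an open condition: a linear relation with
the generators at x continues to hold nearby. -/
theorem exists_germ_mem_ideal {V : Opens M} (f : LocalFunction 𝕂 n V) (x : V)
    (h : f.germ x ∈ L.ideal x) :
    ∃ (W : Opens M) (hW : W ≤ V), (x : M) ∈ W ∧ ∀ y : W, f.germ ⟨y, hW y.2⟩ ∈ L.ideal y := by
  obtain ⟨V', hx', k, g, hg⟩ := L.locally_fg x
  have hx : (x : M) ∈ V ⊓ V' := ⟨x.2, hx'⟩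
  obtain ⟨W, hW, hxW, c, hc⟩ := exists_eq_sum_germ (V := V ⊓ V')
    (fun i => (g i).res inf_le_right) (f.res inf_le_left) ⟨x, hx⟩ (by
      have := hg ⟨x, hx'⟩
      rw [this] at h
      exact h)
  refine ⟨W, hW.trans inf_le_left, hxW, fun y => ?_⟩
  refine (congrArg (· ∈ L.ideal (y : M)) (hc y)).mpr ?_
  refine sum_mem fun i _ => Ideal.mul_mem_left _ _ ?_
  rw [hg ⟨y, (hW y.2).2⟩]
  exact Ideal.subset_span ⟨i, rfl⟩

theorem exists_localFunction_mem {x : M} {k : ℕ} (a : Fin k → AnalyticGerm 𝕂 n x)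
    (ha : ∀ i, a i ∈ L.ideal x) (V : Opens M) (hx : x ∈ V) :
    ∃ (W : Opens M) (_ : W ≤ V) (hxW : x ∈ W) (f : Fin k → LocalFunction 𝕂 n W),
      (∀ i, (f i).germ ⟨x, hxW⟩ = a i) ∧ ∀ i (y : W), (f i).germ y ∈ L.ideal y := by
  obtain ⟨W₀, hW₀, hxW₀, f, hf⟩ := exists_localFunctions a V hx
  choose W hWV hxW hfW using fun i => L.exists_germ_mem_ideal (f i) ⟨x, hxW₀⟩
    (by rw [hf i]; exact ha i)
  obtain ⟨W', hW', hxW', hle⟩ := exists_opens_le hxW₀ W hxW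
  exact ⟨W', hW'.trans hW₀, hxW', fun i => (f i).res hW', hf,
    fun i y => hfW i ⟨y, hle i y.2⟩⟩

theorem exists_section {x : M} (r : L.Stalk x) (V : Opens M) (hx : x ∈ V) :
    ∃ (W : Opens M) (_ : W ≤ V) (hxW : x ∈ W) (s : L.sections W), s.1 ⟨x, hxW⟩ = r := by
  obtain ⟨a, rfl⟩ := Ideal.Quotient.mk_surjective r
  obtain ⟨W, hW, hxW, f, rfl⟩ := exists_localFunction a V hx
  exact ⟨W, hW, hxW, ⟨L.ofFunction f, fun x => ⟨W, le_rfl, f, x.2, fun y => rfl⟩⟩, rfl⟩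

theorem exists_eq_section {V : Opens M} (s t : L.sections V) (x : V) (h : s.1 x = t.1 x) :
    ∃ (W : Opens M) (hW : W ≤ V), (x : M) ∈ W ∧
      ∀ y : W, s.1 ⟨y, hW y.2⟩ = t.1 ⟨y, hW y.2⟩ := by
  obtain ⟨V₁, h₁, f, hx₁, hf⟩ := s.2 x
  obtain ⟨V₂, h₂, g, hx₂, hg⟩ := t.2 x
  let k : LocalFunction 𝕂 n (V₁ ⊓ V₂) := ⟨f.toFun - g.toFun,
    (f.res inf_le_left).contMDiffOn.sub (g.res inf_le_right).contMDiffOn⟩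
  have hk : ∀ y : (V₁ ⊓ V₂ : Opens M), k.germ y ∈ L.ideal y ↔
      s.1 ⟨y, h₁ y.2.1⟩ = t.1 ⟨y, h₂ y.2.2⟩ := fun y => by
    have e : s.1 ⟨y, h₁ y.2.1⟩ = _ := hf ⟨y, y.2.1⟩
    have e' : t.1 ⟨y, h₂ y.2.2⟩ = _ := hg ⟨y, y.2.2⟩
    rw [e, e']
    exact (Ideal.Quotient.eq (I := L.ideal (y : M)) (x := f.germ ⟨y, y.2.1⟩)
      (y := g.germ ⟨y, y.2.2⟩)).symm
  obtain ⟨W, hW, hxW, hy⟩ := L.exists_germ_mem_ideal k ⟨x, hx₁, hx₂⟩ ((hk _).2 h)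
  exact ⟨W, hW.trans (inf_le_left.trans h₁), hxW, fun y => (hk ⟨y, hW y.2⟩).1 (hy y)⟩

/-! ### The Poisson pairing on stalks -/

variable {L} (σ : SymplecticForm 𝕂 n M)

theorem d_add {x : M} (a b : AnalyticGerm 𝕂 n x) : d (a + b) = d a + d b := by
  rw [d_eq_sum (chart_mem_atlas (Model 𝕂 n) x) (mem_chart_source _ x) a,
    d_eq_sum (chart_mem_atlas (Model 𝕂 n) x) (mem_chart_source _ x) b,
    d_eq_sum (chart_mem_atlas (Model 𝕂 n) x) (mem_chart_source _ x) (a + b),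
    ← Finset.sum_add_distrib]
  simp only [map_add, add_smul]

theorem d_mul {x : M} (a b : AnalyticGerm 𝕂 n x) : d (a * b) = a • d b + b • d a := by
  rw [d_eq_sum (chart_mem_atlas (Model 𝕂 n) x) (mem_chart_source _ x) a,
    d_eq_sum (chart_mem_atlas (Model 𝕂 n) x) (mem_chart_source _ x) b,
    d_eq_sum (chart_mem_atlas (Model 𝕂 n) x) (mem_chart_source _ x) (a * b),
    Finset.smul_sum, Finset.smul_sum, ← Finset.sum_add_distrib]
  simp only [Derivation.leibniz, add_smul, smul_eq_mul, mul_smul]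

/-- Involutivity speaks about functions on open sets, so both germs are first represented by
functions lying in the ideal on a common neighbourhood. -/
theorem poissonForm_mem_ideal (hinv : L.IsInvolutive σ) (x : M) (f : AnalyticGerm 𝕂 n x)
    (hf : f ∈ L.ideal x) (g : AnalyticGerm 𝕂 n x) (hg : g ∈ L.ideal x) :
    poissonForm σ x (d f) (d g) ∈ L.ideal x := by
  obtain ⟨W, -, hxW, k, hk, hkI⟩ := L.exists_localFunction_mem ![f, g]
    (fun i => by fin_cases i; exacts [hf, hg]) ⊤ trivial
  obtain ⟨h, hh, he⟩ := hinv W (k 0) (k 1) (hkI 0) (hkI 1) ⟨x, hxW⟩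
  have : poissonForm σ x (d f) (d g) = h := by
    rw [← show (k 0).germ ⟨x, hxW⟩ = f from hk 0, ← show (k 1).germ ⟨x, hxW⟩ = g from hk 1]
    exact Subtype.ext he.symm
  rw [this]
  exact hh

/-- The pairing `I/I² × Ω¹_L → 𝒪_L` defined by the Poisson bracket. -/
def stalkPairing (hinv : L.IsInvolutive σ) (x : M) : L.conormal.stalk x →ₗ[L.Stalk x]
    L.oneForms.stalk x →ₗ[L.Stalk x] L.Stalk x :=
  cotangentPairing (L.ideal x) d d_add d_mul (poissonForm σ x) (poissonForm_mem_ideal σ hinv x)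

variable (L) in
/-- The class of a differential in `Ω¹_L`. -/
def dForm {x : M} (g : AnalyticGerm 𝕂 n x) : L.oneForms.stalk x :=
  (L.conormalForms x).mkQ (L.dAmbient g)

theorem dForm_eq_zero {x : M} {g : AnalyticGerm 𝕂 n x} (hg : g ∈ L.ideal x) : L.dForm g = 0 :=
  (Submodule.Quotient.mk_eq_zero _).2 (Submodule.subset_span ⟨g, hg, rfl⟩)

theorem dForm_eq_sum {e : OpenPartialHomeomorph M (Model 𝕂 n)} (he : e ∈ atlas (Model 𝕂 n) M)
    {y : M} (hy : y ∈ e.source) (a : AnalyticGerm 𝕂 n y) :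
    L.dForm a = ∑ l, L.toStalk y (germDeriv he hy (stdVec 𝕂 n l) a) •
      L.dForm (coordGerm he hy l) := by
  let q : FormGerm 𝕂 n y →+ L.oneForms.stalk y :=
    (L.conormalForms y).mkQ.toAddMonoidHom.comp
      (Submodule.mkQ (L.ideal y • (⊤ : Submodule (AnalyticGerm 𝕂 n y)
        (FormGerm 𝕂 n y)))).toAddMonoidHom
  change q (d a) = _
  rw [d_eq_sum he hy a, map_sum]
  rfl

end AnalyticSubspace

end SingularLagrangian

end Stalks

/-! ### The rank of the Poisson pairing -/

noncomputable section Rank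

set_option linter.unusedSectionVars false

namespace SingularLagrangian

universe u

namespace AnalyticSubspace

variable {𝕂 : Type} [RCLike 𝕂] {n : ℕ} {M : Type u} [TopologicalSpace M]
  [ChartedSpace (Model 𝕂 n) M] [IsManifold 𝓘(𝕂, Model 𝕂 n) ω M]
  (L : AnalyticSubspace 𝕂 n M) (σ : SymplecticForm 𝕂 n M)

theorem isNoetherianRing_stalk (x : M) : IsNoetherianRing (L.Stalk x) := by
  have := isNoetherianRing_analyticGerm (𝕂 := 𝕂) (n := n) x
  exact inferInstanceAs (IsNoetherianRing (AnalyticGerm 𝕂 n x ⧸ L.ideal x))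

theorem isLocalRing_stalk {x : M} (hx : x ∈ L.carrier) : IsLocalRing (L.Stalk x) := by
  have := isLocalRing_analyticGerm (𝕂 := 𝕂) (n := n) x
  have : Nontrivial (L.Stalk x) := Ideal.Quotient.nontrivial_iff.2 hx
  exact IsLocalRing.of_surjective' (Ideal.Quotient.mk (L.ideal x)) Ideal.Quotient.mk_surjective

theorem subsingleton_stalk {x : M} (hx : x ∉ L.carrier) : Subsingleton (L.Stalk x) :=
  Ideal.Quotient.subsingleton_iff.2 (not_not.1 hx)

theorem mem_carrier_of_isPrime {x : M} (Q : Ideal (L.Stalk x)) (hQ : Q.IsPrime) :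
    x ∈ L.carrier := by
  by_contra hx
  have := L.subsingleton_stalk hx
  exact hQ.ne_top (Subsingleton.elim _ _)

section Chart

variable {e : OpenPartialHomeomorph M (Model 𝕂 n)} (he : e ∈ atlas (Model 𝕂 n) M) {y : M}
  (hy : y ∈ e.source)

/-- The Jacobian matrix of germs in a chart, modulo the ideal of `L`. -/
def jacobian {k : ℕ} (f : Fin k → AnalyticGerm 𝕂 n y) : Matrix (Fin k) (Fin (2 * n)) (L.Stalk y) :=
  Matrix.of fun i l => L.toStalk y (germDeriv he hy (stdVec 𝕂 n l) (f i))

/-- The brackets of germs with the coordinates of a chart, modulo the ideal of `L`. -/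
def brackets {k : ℕ} (f : Fin k → AnalyticGerm 𝕂 n y) : Matrix (Fin k) (Fin (2 * n)) (L.Stalk y) :=
  Matrix.of fun i l => L.toStalk y (poissonForm σ y (d (f i)) (d (coordGerm he hy l)))

theorem brackets_eq_mul {k : ℕ} (f : Fin k → AnalyticGerm 𝕂 n y) :
    L.brackets σ he hy f =
      L.jacobian he hy f * (bracketGerm σ he hy).map (L.toStalk y) := by
  refine Matrix.ext fun i l => ?_
  rw [Matrix.mul_apply]
  simp only [brackets, jacobian, Matrix.of_apply, Matrix.map_apply]
  rw [d_eq_sum he hy (f i), map_sum, LinearMap.sum_apply, map_sum]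
  refine Finset.sum_congr rfl fun j _ => ?_
  rw [map_smul, LinearMap.smul_apply, smul_eq_mul, map_mul]
  rfl

theorem brackets_mul_transpose {k k' : ℕ} (f : Fin k → AnalyticGerm 𝕂 n y)
    (g : Fin k' → AnalyticGerm 𝕂 n y) :
    L.brackets σ he hy f * (L.jacobian he hy g).transpose =
      Matrix.of fun i j => L.toStalk y (poissonForm σ y (d (f i)) (d (g j))) := by
  refine Matrix.ext fun i j => ?_
  rw [Matrix.mul_apply]
  simp only [brackets, jacobian, Matrix.of_apply, Matrix.transpose_apply]
  rw [d_eq_sum he hy (g j), map_sum, map_sum]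
  refine Finset.sum_congr rfl fun l _ => ?_
  rw [map_smul, smul_eq_mul, map_mul, mul_comm]

theorem brackets_mul_transpose_eq_zero (hinv : L.IsInvolutive σ) {k : ℕ}
    (f : Fin k → AnalyticGerm 𝕂 n y) (hf : ∀ i, f i ∈ L.ideal y) :
    L.brackets σ he hy f * (L.jacobian he hy f).transpose = 0 := by
  rw [brackets_mul_transpose]
  refine Matrix.ext fun i j => ?_
  exact Ideal.Quotient.eq_zero_iff_mem.2
    (poissonForm_mem_ideal σ hinv y _ (hf i) _ (hf j))

theorem exists_bracket_inverse {K : Type*} [Field K] (π : L.Stalk y →+* K) :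
    ∃ B, ((bracketGerm σ he hy).map (L.toStalk y)).map π * B = 1 := by
  obtain ⟨B, hB⟩ := exists_bracketGerm_mul_eq_one σ he hy
  refine ⟨(B.map (L.toStalk y)).map π, ?_⟩
  rw [← Matrix.map_mul, ← Matrix.map_mul, hB, Matrix.map_one _ (map_zero _) (map_one _),
    Matrix.map_one _ (map_zero _) (map_one _)]

/-- The homomorphism to the residue field at a prime. -/
def toResidue {R : Type*} [CommRing R] (Q : Ideal R) [Q.IsPrime] : R →+* FractionRing (R ⧸ Q) :=
  (algebraMap (R ⧸ Q) (FractionRing (R ⧸ Q))).comp (Ideal.Quotient.mk Q)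

theorem ker_toResidue {R : Type*} [CommRing R] (Q : Ideal R) [Q.IsPrime] :
    RingHom.ker (toResidue Q) = Q := by
  ext a
  rw [RingHom.mem_ker, toResidue, RingHom.comp_apply, ← Ideal.Quotient.eq_zero_iff_mem]
  exact map_eq_zero_iff _ (IsFractionRing.injective _ _)

theorem toResidue_ne_zero {R : Type*} [CommRing R] (Q : Ideal R) [Q.IsPrime] {a : R} :
    toResidue Q a ≠ 0 ↔ a ∉ Q := by
  rw [Ne, ← RingHom.mem_ker, ker_toResidue]

theorem exists_jacobian_linearIndependent (hdim : L.dim = n) (hR1 : L.IsRegularInCodimOne) {k : ℕ}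
    (f : Fin k → AnalyticGerm 𝕂 n y) (hf : L.ideal y = Ideal.span (Set.range f))
    (Q : Ideal (L.Stalk y)) [hQ : Q.IsPrime] (hht : Q.height ≤ 1) :
    ∃ S : Fin n → Fin k, LinearIndependent (FractionRing (L.Stalk y ⧸ Q))
      ((L.jacobian he hy (f ∘ S)).map (toResidue Q)).row := by
  have hyL := L.mem_carrier_of_isPrime Q hQ
  have hd : ringKrullDim (L.Stalk y) ≤ n := by
    rw [← hdim]
    exact le_iSup (fun x : L.carrier => ringKrullDim (L.Stalk x)) ⟨y, hyL⟩
  exact exists_linearIndependent_differentials (O := AnalyticGerm 𝕂 n y) rfl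
    (fun l => germDeriv he hy (stdVec 𝕂 n l)) (L.ideal y) f hf hd ⟨Q, hQ⟩ (hR1 y hyL Q hht)
    (hasIndependentEquations_analyticGerm he hy _) (toResidue Q) (ker_toResidue Q)

/-- The minor of the matrix of brackets. -/
def minor {k : ℕ} (f : Fin k → AnalyticGerm 𝕂 n y) (S : Fin n → Fin k)
    (T : Fin n → Fin (2 * n)) : L.Stalk y :=
  ((L.brackets σ he hy (f ∘ S)).submatrix id T).det

/-- The determinant of dual rows and differentials. -/
def frameDet {k : ℕ} (f : Fin k → AnalyticGerm 𝕂 n y) (S : Fin n → Fin k)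
    (T : Fin n → Fin (2 * n)) : L.Stalk y :=
  (stacked (dualRows ((L.brackets σ he hy (f ∘ S)).submatrix id T) T)
    (L.jacobian he hy (f ∘ S))).det

/-- Over the residue field of Q the Jacobian has n independent rows, and involutivity makes them
isotropic for the invertible bracket matrix. The linear algebra of Lagrangian subspaces in
`exists_minor_ne_zero` then applies; the two determinants are the h and g of the multipliers. -/
theorem exists_minor_notMem (hinv : L.IsInvolutive σ) (hdim : L.dim = n)
    (hR1 : L.IsRegularInCodimOne) {k : ℕ}
    (f : Fin k → AnalyticGerm 𝕂 n y) (hf : L.ideal y = Ideal.span (Set.range f))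
    (Q : Ideal (L.Stalk y)) [hQ : Q.IsPrime] (hht : Q.height ≤ 1) :
    ∃ (S : Fin n → Fin k) (T : Fin n → Fin (2 * n)),
      L.minor σ he hy f S T ∉ Q ∧ L.frameDet σ he hy f S T ∉ Q := by
  obtain ⟨S, hS⟩ := L.exists_jacobian_linearIndependent he hy hdim hR1 f hf Q hht
  obtain ⟨B, hB⟩ := L.exists_bracket_inverse σ he hy (toResidue Q)
  have hfI : ∀ i, (f ∘ S) i ∈ L.ideal y := fun i => by
    rw [hf]; exact Ideal.subset_span ⟨S i, rfl⟩
  have hC : (L.brackets σ he hy (f ∘ S)).map (toResidue Q) =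
      (L.jacobian he hy (f ∘ S)).map (toResidue Q) *
        ((bracketGerm σ he hy).map (L.toStalk y)).map (toResidue Q) := by
    rw [brackets_eq_mul, Matrix.map_mul]
  have hiso : (L.jacobian he hy (f ∘ S)).map (toResidue Q) *
      ((bracketGerm σ he hy).map (L.toStalk y)).map (toResidue Q) *
        ((L.jacobian he hy (f ∘ S)).map (toResidue Q)).transpose = 0 := by
    rw [← hC, ← Matrix.transpose_map, ← Matrix.map_mul,
      L.brackets_mul_transpose_eq_zero σ he hy hinv _ hfI]
    exact Matrix.map_zero _ (map_zero _)
  obtain ⟨T, hT, hT'⟩ := exists_minor_ne_zero _ _ B hB hS hiso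
  rw [← hC] at hT hT'
  refine ⟨S, T, ?_, ?_⟩
  · rw [← toResidue_ne_zero, minor, RingHom.map_det]
    exact hT
  · rw [← toResidue_ne_zero, frameDet, RingHom.map_det, RingHom.mapMatrix_apply, stacked_map,
      dualRows_map]
    exact hT'

/-- At a minimal prime L is generically reduced, so equations of the prime become equations of L
after multiplication by an element c' outside it. This gives functions in the ideal that generate it
up to a factor and have independent hamiltonian fields at Q; only regularity at Q and invertibility
of the bracket matrix are needed, not isotropy. -/
theorem exists_adapted_equations (hR1 : L.IsRegularInCodimOne)
    (Q : Ideal (L.Stalk y)) (hQ : Q ∈ minimalPrimes (L.Stalk y)) :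
    ∃ (r : ℕ) (F : Fin r → AnalyticGerm 𝕂 n y) (c : AnalyticGerm 𝕂 n y)
      (T : Fin r → Fin (2 * n)), (∀ j, F j ∈ L.ideal y) ∧ L.toStalk y c ∉ Q ∧
      (∀ a ∈ L.ideal y, c * a ∈ Ideal.span (Set.range F)) ∧
      ((L.brackets σ he hy F).submatrix id T).det ∉ Q := by
  have hQp : Q.IsPrime := hQ.1.1
  have hyL := L.mem_carrier_of_isPrime Q hQp
  have hht : Q.height = 0 := Ideal.height_eq_zero_iff.2 hQ
  obtain ⟨r, F, V, c, hF, hc, hcF, hdet, -⟩ := hasIndependentEquations_analyticGerm he hy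
    (PrimeSpectrum.comap (L.toStalk y) ⟨Q, hQp⟩)
  -- Height zero means that there are no parameters, so every element of Q is killed by some element
  -- outside Q.
  obtain ⟨d, τ, hd, -, hgen⟩ := exists_generators_of_isRegularLocalRing Q
    (hR1 y hyL Q (by rw [hht]; exact zero_le_one))
  obtain rfl : d = 0 := by rw [hht] at hd; exact_mod_cast hd
  have hkill : ∀ j, ∃ b : AnalyticGerm 𝕂 n y, L.toStalk y b ∉ Q ∧ b * F j ∈ L.ideal y := by
    intro j
    obtain ⟨b, hb, hbF⟩ := hgen (L.toStalk y (F j)) (hF j)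
    obtain ⟨b, rfl⟩ := Ideal.Quotient.mk_surjective b
    refine ⟨b, hb, ?_⟩
    rw [Set.range_eq_empty, Ideal.span_empty, Ideal.mem_bot] at hbF
    exact Ideal.Quotient.eq_zero_iff_mem.1 hbF
  choose b hb hbF using hkill
  set c' : AnalyticGerm 𝕂 n y := ∏ j, b j with hc'
  have hc'Q : L.toStalk y c' ∉ Q := by
    rw [hc', map_prod]
    intro h
    obtain ⟨j, -, hj⟩ := (Ideal.IsPrime.prod_mem_iff).1 h
    exact hb j hj
  have hFI : ∀ j, c' * F j ∈ L.ideal y := fun j => by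
    rw [hc', ← Finset.mul_prod_erase _ _ (Finset.mem_univ j), mul_right_comm]
    exact Ideal.mul_mem_right _ _ (hbF j)
  have hli : LinearIndependent (FractionRing (L.Stalk y ⧸ Q))
      ((L.jacobian he hy F).map (toResidue Q)).row :=
    linearIndependent_of_det_notMem ((toResidue Q).comp (L.toStalk y))
      (Matrix.of fun j l => germDeriv he hy (stdVec 𝕂 n l) (F j)) V fun h => hdet (by
        have h1 : L.toStalk y _ ∈ RingHom.ker (toResidue Q) := h
        rw [ker_toResidue] at h1
        exact h1)
  -- As F j vanishes modulo Q, the differential of c' F j is there c' times that of F j, and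
  -- independence is preserved.
  have hli' : LinearIndependent (FractionRing (L.Stalk y ⧸ Q))
      ((L.jacobian he hy fun j => c' * F j).map (toResidue Q)).row := by
    have h1 : ((L.jacobian he hy fun j => c' * F j).map (toResidue Q)).row =
        fun j => toResidue Q (L.toStalk y c') • ((L.jacobian he hy F).map (toResidue Q)).row j := by
      funext j l
      have h0 : toResidue Q (L.toStalk y (F j)) = 0 := by
        rw [← RingHom.mem_ker, ker_toResidue]; exact hF j
      simp only [Matrix.row, jacobian, Matrix.map_apply, Matrix.of_apply, Derivation.leibniz,
        smul_eq_mul, map_add, map_mul, h0, zero_mul, add_zero, Pi.smul_apply]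
    rw [h1]
    exact hli.units_smul fun _ => Units.mk0 _ ((toResidue_ne_zero Q).2 hc'Q)
  obtain ⟨B, hB⟩ := L.exists_bracket_inverse σ he hy (toResidue Q)
  obtain ⟨T, hT⟩ := exists_det_submatrix_ne_zero _ (linearIndependent_row_mul hB hli')
  refine ⟨r, fun j => c' * F j, c * c', T, hFI, ?_, fun a ha => ?_, ?_⟩
  · rw [map_mul]
    exact fun h => (hQp.mem_or_mem h).elim hc hc'Q
  · have h1 := hcF a (by
      change L.toStalk y a ∈ Q
      rw [show L.toStalk y a = 0 from Ideal.Quotient.eq_zero_iff_mem.2 ha]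
      exact zero_mem _)
    obtain ⟨w, hw⟩ := Ideal.mem_span_range_iff_exists_fun.1 h1
    refine Ideal.mem_span_range_iff_exists_fun.2 ⟨w, ?_⟩
    rw [mul_right_comm, ← hw, Finset.sum_mul]
    exact Finset.sum_congr rfl fun j _ => by ring
  · rw [← toResidue_ne_zero, RingHom.map_det]
    rw [← Matrix.map_mul, ← brackets_eq_mul] at hT
    exact hT

end Chart

end AnalyticSubspace

end SingularLagrangian

end Rank

/-! ### Sections, wedge products and pairings of sheaves given by their stalks -/

noncomputable section Sheaves

set_option linter.unusedSectionVars false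

namespace SingularLagrangian

universe u

namespace AnalyticSubspace

variable {𝕂 : Type} [RCLike 𝕂] {n : ℕ} {M : Type u} [TopologicalSpace M]
  [ChartedSpace (Model 𝕂 n) M] {L : AnalyticSubspace 𝕂 n M}

theorem mem_sections_of_local {V : Opens M} {s : ∀ x : V, L.Stalk (x : M)}
    (h : ∀ x : V, ∃ (W : Opens M) (hW : W ≤ V), (x : M) ∈ W ∧
      (fun y : W => s ⟨y, hW y.2⟩) ∈ L.sections W) : s ∈ L.sections V := by
  intro x
  obtain ⟨W, hW, hx, hs⟩ := h x
  obtain ⟨W', hW', f, hx', hf⟩ := hs ⟨x, hx⟩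
  exact ⟨W', hW'.trans hW, f, hx', hf⟩

theorem ofFunction_mem_sections {V : Opens M} (f : LocalFunction 𝕂 n V) :
    L.ofFunction f ∈ L.sections V := fun x => ⟨V, le_rfl, f, x.2, fun _ => rfl⟩

/-- The value of a section at a point. -/
def evalAt {V : Opens M} (x : V) : L.sections V →+* L.Stalk (x : M) :=
  (Pi.evalRingHom (fun x : V => L.Stalk (x : M)) x).comp (L.sections V).subtype

namespace StalkSheaf

variable (F G : StalkSheaf L)

instance moduleSections (V : Opens M) : Module (L.sections V) (F.sections V) :=
  (F.sections V).module

instance smulSections (V : Opens M) : SMul (L.sections V) (F.sections V) :=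
  (F.moduleSections V).toSMul

theorem span_gens_le_sections (V : Opens M) :
    Submodule.span (L.sections V) (F.gens V) ≤ F.sections V :=
  fun _ hs x => ⟨V, le_rfl, x.2, hs⟩

theorem res_smul {V W : Opens M} (h : W ≤ V) (a : L.sections V) (s : F.sections V) :
    F.res h (a • s) = L.resSections h a • F.res h s := rfl

/-! #### Pairings -/

variable {F G}

/-- A family of pairings of stalks which pairs generators to sections of `𝒪_L`. -/
structure Pairing (F G : StalkSheaf L) where
  stalk : ∀ x : M, F.stalk x →ₗ[L.Stalk x] G.stalk x →ₗ[L.Stalk x] L.Stalk x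
  mem : ∀ (V : Opens M), ∀ s ∈ F.gens V, ∀ t ∈ G.gens V,
    (fun x : V => stalk x (s x) (t x)) ∈ L.sections V

theorem Pairing.mem_sections (B : Pairing F G) {V : Opens M} (s : F.sections V)
    (t : G.sections V) : (fun x : V => B.stalk x (s.1 x) (t.1 x)) ∈ L.sections V := by
  refine mem_sections_of_local fun x => ?_
  obtain ⟨W₁, h₁, hx₁, hs⟩ := s.2 x
  obtain ⟨W₂, h₂, hx₂, ht⟩ := t.2 x
  refine ⟨W₁ ⊓ W₂, inf_le_left.trans h₁, ⟨hx₁, hx₂⟩, ?_⟩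
  have hs' := F.res_mem_span (inf_le_left : W₁ ⊓ W₂ ≤ W₁) hs
  have ht' := G.res_mem_span (inf_le_right : W₁ ⊓ W₂ ≤ W₂) ht
  have key : ∀ s ∈ Submodule.span (L.sections (W₁ ⊓ W₂)) (F.gens (W₁ ⊓ W₂)),
      ∀ t ∈ Submodule.span (L.sections (W₁ ⊓ W₂)) (G.gens (W₁ ⊓ W₂)),
      (fun x : (W₁ ⊓ W₂ : Opens M) => B.stalk x (s x) (t x)) ∈ L.sections (W₁ ⊓ W₂) := by
    intro s hs t ht
    induction hs, ht using Submodule.span_induction₂ with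
    | mem_mem s t hs ht => exact B.mem _ s hs t ht
    | zero_left t ht =>
      have : (fun x : (W₁ ⊓ W₂ : Opens M) => B.stalk x 0 (t x)) = 0 := by
        funext x; rw [map_zero]; rfl
      exact this ▸ zero_mem _
    | zero_right t ht =>
      have : (fun x : (W₁ ⊓ W₂ : Opens M) => B.stalk x (t x) 0) = 0 := by
        funext x; rw [map_zero]; rfl
      exact this ▸ zero_mem _
    | add_left s s' t _ _ _ h h' =>
      have := add_mem h h'
      convert this using 1
      funext x
      exact congrArg (fun φ => φ (t x)) (map_add (B.stalk x) (s x) (s' x))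
    | add_right s t t' _ _ _ h h' =>
      have := add_mem h h'
      convert this using 1
      funext x
      exact map_add (B.stalk x (s x)) (t x) (t' x)
    | smul_left a s t _ _ h =>
      have := mul_mem a.2 h
      convert this using 1
      funext x
      exact congrArg (fun φ => φ (t x)) (map_smul (B.stalk x) (a.1 x) (s x))
    | smul_right a s t _ _ h =>
      have := mul_mem a.2 h
      convert this using 1
      funext x
      exact map_smul (B.stalk x (s x)) (a.1 x) (t x)
  exact key _ hs' _ ht'

/-- The pairing of sections. -/
def Pairing.onSections (B : Pairing F G) (V : Opens M) :
    F.sections V →ₗ[L.sections V] G.sections V →ₗ[L.sections V] L.sections V :=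
  LinearMap.mk₂ _ (fun s t => ⟨fun x => B.stalk x (s.1 x) (t.1 x), B.mem_sections s t⟩)
    (fun s s' t => Subtype.ext <| funext fun x =>
      congrArg (fun φ => φ (t.1 x)) (map_add (B.stalk x) (s.1 x) (s'.1 x)))
    (fun a s t => Subtype.ext <| funext fun x =>
      congrArg (fun φ => φ (t.1 x)) (map_smul (B.stalk x) (a.1 x) (s.1 x)))
    (fun s t t' => Subtype.ext <| funext fun x => map_add (B.stalk x (s.1 x)) (t.1 x) (t'.1 x))
    (fun a s t => Subtype.ext <| funext fun x => map_smul (B.stalk x (s.1 x)) (a.1 x) (t.1 x))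

/-! #### Wedge products -/

variable (F)

/-- The wedge product of families of elements of the stalks. -/
def wedgeFamily (p : ℕ) (V : Opens M) : AlternatingMap (L.sections V) (∀ x : V, F.stalk x)
    (∀ x : V, (F.exteriorPower p).stalk x) (Fin p) where
  toFun t x := _root_.exteriorPower.ιMulti (L.Stalk (x : M)) p fun i => t i x
  map_update_add' := by
    intro dec t i a b
    obtain rfl : dec = instDecidableEqFin p := Subsingleton.elim _ _
    funext x
    have h : ∀ c : ∀ x : V, F.stalk x, (fun j => Function.update t i c j x) =
        Function.update (fun j => t j x) i (c x) := fun c => by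
      funext j
      by_cases hj : j = i
      · subst hj; simp
      · simp [Function.update_of_ne hj]
    change _root_.exteriorPower.ιMulti (L.Stalk (x : M)) p
      (fun j => Function.update t i (a + b) j x) = _root_.exteriorPower.ιMulti (L.Stalk (x : M)) p
      (fun j => Function.update t i a j x) + _root_.exteriorPower.ιMulti (L.Stalk (x : M)) p
      (fun j => Function.update t i b j x)
    rw [h, h, h]
    exact AlternatingMap.map_update_add _ _ _ _ _
  map_update_smul' := by
    intro dec t i r a
    obtain rfl : dec = instDecidableEqFin p := Subsingleton.elim _ _
    funext x
    have h : ∀ c : ∀ x : V, F.stalk x, (fun j => Function.update t i c j x) =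
        Function.update (fun j => t j x) i (c x) := fun c => by
      funext j
      by_cases hj : j = i
      · subst hj; simp
      · simp [Function.update_of_ne hj]
    change _root_.exteriorPower.ιMulti (L.Stalk (x : M)) p
      (fun j => Function.update t i (r • a) j x) =
      r.1 x • _root_.exteriorPower.ιMulti (L.Stalk (x : M)) p
      (fun j => Function.update t i a j x)
    rw [h, h]
    exact AlternatingMap.map_update_smul _ _ _ _ _
  map_eq_zero_of_eq' t i j hij hne := by
    funext x
    exact AlternatingMap.map_eq_zero_of_eq _ _ (congrFun hij x) hne

theorem wedgeFamily_mem {p : ℕ} {V : Opens M} (t : Fin p → ∀ x : V, F.stalk x)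
    (ht : ∀ i, t i ∈ F.sections V) : F.wedgeFamily p V t ∈ (F.exteriorPower p).sections V := by
  intro x
  choose W hW hx hs using fun i => ht i x
  obtain ⟨W', hW', hxW', hle⟩ := exists_opens_le x.2 W hx
  refine ⟨W', hW', hxW', ?_⟩
  exact MultilinearMap.map_mem_of_mem_span (F.wedgeFamily p W').toMultilinearMap (F.gens W')
    (Submodule.span _ ((F.exteriorPower p).gens W'))
    (fun s hs => Submodule.subset_span ⟨s, hs, rfl⟩)
    (fun i y => t i ⟨y, hW' y.2⟩) fun i => F.res_mem_span (hle i) (hs i)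

/-- The wedge product of sections. -/
def wedge (p : ℕ) (V : Opens M) :
    AlternatingMap (L.sections V) (F.sections V) ((F.exteriorPower p).sections V) (Fin p) :=
  ((F.wedgeFamily p V).compLinearMap (F.sections V).subtype).codRestrict
    ((F.exteriorPower p).sections V) fun t => F.wedgeFamily_mem _ fun i => (t i).2

/-! #### Functionals -/

variable {F}

/-- The values of a section of the dual sheaf. -/
def ev {U : Opens M} (φ : dualSections F.toModules U) (V : Opens M) (h : V ≤ U) :
    F.sections V →ₗ[L.sections V] L.sections V := φ.1 ⟨V, h⟩

theorem ev_res {U : Opens M} (φ : dualSections F.toModules U) {V W : Opens M} (h : V ≤ U)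
    (hW : W ≤ V) (s : F.sections V) :
    L.resSections hW (ev φ V h s) = ev φ W (hW.trans h) (F.res hW s) :=
  φ.2 ⟨V, h⟩ ⟨W, hW.trans h⟩ hW s

/-- A section of the dual sheaf from its values. -/
def mkDual {U : Opens M} (f : ∀ V ≤ U, F.sections V →ₗ[L.sections V] L.sections V)
    (hf : ∀ V (h : V ≤ U) W (hW : W ≤ V) (s : F.sections V),
      L.resSections hW (f V h s) = f W (hW.trans h) (F.res hW s)) :
    dualSections F.toModules U :=
  ⟨fun V => f V.1 V.2, fun V W h s => hf V.1 V.2 W.1 h s⟩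

theorem dual_ext {U : Opens M} {φ ψ : dualSections F.toModules U}
    (h : ∀ V (hV : V ≤ U) (s : F.sections V), ev φ V hV s = ev ψ V hV s) : φ = ψ :=
  Subtype.ext <| funext fun V => LinearMap.ext fun s => h V.1 V.2 s

theorem ev_apply_eq {U : Opens M} (φ : dualSections F.toModules U) {V W : Opens M} (h : V ≤ U)
    (hW : W ≤ V) (s : F.sections V) (x : W) :
    (ev φ V h s).1 ⟨x, hW x.2⟩ = (ev φ W (hW.trans h) (F.res hW s)).1 x :=
  congrFun (congrArg Subtype.val (ev_res φ h hW s)) x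

/-- A section of the dual of an exterior power is determined by its values on wedge products of
generators. -/
theorem dual_ext_wedge {p : ℕ} {U : Opens M} {φ ψ : dualSections (F.exteriorPower p).toModules U}
    (h : ∀ V (hV : V ≤ U) (t : Fin p → F.sections V), (∀ i, (t i).1 ∈ F.gens V) →
      ev φ V hV (F.wedge p V t) = ev ψ V hV (F.wedge p V t)) : φ = ψ := by
  refine dual_ext fun V hV s => Subtype.ext <| funext fun x => ?_
  obtain ⟨W, hW, hx, hs⟩ := s.2 x
  have key : ∀ t (ht : t ∈ Submodule.span (L.sections W) ((F.exteriorPower p).gens W)),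
      ∀ ht' : t ∈ (F.exteriorPower p).sections W,
      ev φ W (hW.trans hV) ⟨t, ht'⟩ = ev ψ W (hW.trans hV) ⟨t, ht'⟩ := by
    intro t ht
    induction ht using Submodule.span_induction with
    | mem t ht =>
      intro ht'
      obtain ⟨v, hv, rfl⟩ := ht
      exact h W (hW.trans hV)
        (fun i => ⟨v i, F.span_gens_le_sections W (Submodule.subset_span (hv i))⟩) hv
    | zero =>
      intro ht'
      exact (map_zero (ev φ W (hW.trans hV))).trans (map_zero (ev ψ W (hW.trans hV))).symm
    | add s t hs ht h₁ h₂ =>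
      intro ht'
      have hs' := (F.exteriorPower p).span_gens_le_sections W hs
      have ht'' := (F.exteriorPower p).span_gens_le_sections W ht
      exact (map_add (ev φ W (hW.trans hV)) ⟨s, hs'⟩ ⟨t, ht''⟩).trans
        ((congrArg₂ (· + ·) (h₁ hs') (h₂ ht'')).trans
          (map_add (ev ψ W (hW.trans hV)) ⟨s, hs'⟩ ⟨t, ht''⟩).symm)
    | smul a t ht h₁ =>
      intro ht'
      have ht'' := (F.exteriorPower p).span_gens_le_sections W ht
      exact (map_smul (ev φ W (hW.trans hV)) a ⟨t, ht''⟩).trans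
        ((congrArg (a • ·) (h₁ ht'')).trans
          (map_smul (ev ψ W (hW.trans hV)) a ⟨t, ht''⟩).symm)
  have h1 := ev_apply_eq φ hV hW s ⟨x, hx⟩
  have h2 := ev_apply_eq ψ hV hW s ⟨x, hx⟩
  exact h1.trans ((congrFun (congrArg Subtype.val (key _ hs ((F.exteriorPower p).res hW s).2))
    ⟨x, hx⟩).trans h2.symm)

end StalkSheaf

end AnalyticSubspace

end SingularLagrangian

end Sheaves

/-! ### The Poisson pairing of sections -/

section Expansion

/-- The expansion of an alternating form along vectors dual to given functionals. -/
theorem AlternatingMap.factorial_mul_eq_sum {A Ω : Type*} [CommRing A] [AddCommGroup Ω] [Module A Ω]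
    {p r : ℕ} (θ : Ω [⋀^Fin p]→ₗ[A] A) (u : Fin r → Ω) (ev : Fin r → Module.Dual A Ω) (h g : A)
    (hev : ∀ i j, ev i (u j) = if i = j then h else 0) (t : Fin p → Ω)
    (ht : ∀ i, g • t i ∈ Submodule.span A (Set.range u)) :
    (p.factorial : A) * h ^ p * g ^ p * θ t = ∑ K : Fin p → Fin r,
      g ^ p * θ (fun i => u (K i)) * Matrix.det (Matrix.of fun i j => ev (K j) (t i)) := by
  classical
  -- The difference of the two sides is multilinear and vanishes on tuples of the u j by
  -- `AlternatingMap.sum_mul_det`, hence on tuples in their span. Evaluation at the g • t i then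
  -- produces the factor g^p.
  let δ : MultilinearMap A (fun _ : Fin p => Ω) A :=
    ((p.factorial : A) * h ^ p) • θ.toMultilinearMap -
      ∑ K : Fin p → Fin r, θ (fun i => u (K i)) •
        ((exteriorPower.pairingDual A Ω p (exteriorPower.ιMulti A p fun i => ev (K i))).compAlternatingMap
          (exteriorPower.ιMulti A p)).toMultilinearMap
  have hδ : ∀ v, δ v = (p.factorial : A) * h ^ p * θ v - ∑ K : Fin p → Fin r,
      θ (fun i => u (K i)) * Matrix.det (Matrix.of fun i j => ev (K j) (v i)) := fun v => by
    simp only [δ, _root_.sub_apply, _root_.smul_apply, _root_.sum_apply,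
      AlternatingMap.coe_multilinearMap, LinearMap.compAlternatingMap_apply,
      exteriorPower.pairingDual_ιMulti_ιMulti, smul_eq_mul]
  have h0 : δ (fun i => g • t i) ∈ (⊥ : Submodule A A) := by
    refine MultilinearMap.map_mem_of_mem_span δ (Set.range u) ⊥ (fun s hs => ?_) _ ht
    choose K' hK' using hs
    obtain rfl : (fun i => u (K' i)) = s := funext hK'
    rw [Submodule.mem_bot, hδ, ← AlternatingMap.sum_mul_det θ u h K', sub_eq_zero]
    simp only [hev]
  rw [Submodule.mem_bot, MultilinearMap.map_smul_univ, hδ] at h0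
  simp only [Finset.prod_const, Finset.card_univ, Fintype.card_fin, smul_eq_mul, mul_sub,
    Finset.mul_sum, sub_eq_zero] at h0
  rw [mul_comm _ (g ^ p), mul_assoc, h0]
  exact Finset.sum_congr rfl fun K _ => by ring

end Expansion

noncomputable section SectionPairing

set_option linter.unusedSectionVars false

namespace SingularLagrangian

universe u

namespace AnalyticSubspace

variable {𝕂 : Type} [RCLike 𝕂] {n : ℕ} {M : Type u} [TopologicalSpace M]
  [ChartedSpace (Model 𝕂 n) M] [IsManifold 𝓘(𝕂, Model 𝕂 n) ω M]
  {L : AnalyticSubspace 𝕂 n M} (σ : SymplecticForm 𝕂 n M) (hinv : L.IsInvolutive σ)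

theorem contMDiffOn_poisson {V : Opens M} (f g : LocalFunction 𝕂 n V) :
    ContMDiffOn 𝓘(𝕂, Model 𝕂 n) 𝓘(𝕂, 𝕂) ω (σ.poisson f.toFun g.toFun) V := by
  intro y hy
  obtain ⟨k, hk, he⟩ := (poissonForm σ y (d (f.germ ⟨y, hy⟩)) (d (g.germ ⟨y, hy⟩))).2
  have h1 : k =ᶠ[𝓝 y] σ.poisson f.toFun g.toFun := Germ.coe_eq.1 he
  exact (hk.congr_of_eventuallyEq h1.symm).contMDiffWithinAt

/-- The Poisson pairing of the conormal sheaf with the differentials. -/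
def poissonPairing : StalkSheaf.Pairing L.conormal L.oneForms where
  stalk := stalkPairing σ hinv
  mem := by
    rintro V _ ⟨f, hf, rfl⟩ _ ⟨g, rfl⟩
    exact ofFunction_mem_sections (L := L)
      (⟨σ.poisson f.toFun g.toFun, contMDiffOn_poisson σ f g⟩ : LocalFunction 𝕂 n V)

theorem det_mem_sections {V : Opens M} {p : ℕ} (A : Matrix (Fin p) (Fin p) (L.sections V)) :
    (fun x : V => Matrix.det (Matrix.of fun i j => (A i j).1 x)) ∈ L.sections V := by
  have : (fun x : V => Matrix.det (Matrix.of fun i j => (A i j).1 x)) = A.det.1 := by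
    funext x
    exact (RingHom.map_det (evalAt x) A).symm
  rw [this]
  exact A.det.2

/-- The pairing of exterior powers of stalks. -/
def stalkPowerPairing (p : ℕ) (x : M) : (L.conormal.exteriorPower p).stalk x →ₗ[L.Stalk x]
    (L.oneForms.exteriorPower p).stalk x →ₗ[L.Stalk x] L.Stalk x :=
  (exteriorPower.pairingDual (L.Stalk x) (L.oneForms.stalk x) p).comp
    (exteriorPower.map p (stalkPairing σ hinv x))

theorem stalkPowerPairing_ιMulti (p : ℕ) (x : M) (s : Fin p → L.conormal.stalk x)
    (t : Fin p → L.oneForms.stalk x) :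
    stalkPowerPairing σ hinv p x (exteriorPower.ιMulti (L.Stalk x) p s)
      (exteriorPower.ιMulti (L.Stalk x) p t) =
      Matrix.det (Matrix.of fun i j => stalkPairing σ hinv x (s j) (t i)) := by
  have h : exteriorPower.map p (stalkPairing σ hinv x) (exteriorPower.ιMulti (L.Stalk x) p s) =
      exteriorPower.ιMulti (L.Stalk x) p (stalkPairing σ hinv x ∘ s) :=
    exteriorPower.map_apply_ιMulti _ _
  refine (congrArg (fun z => exteriorPower.pairingDual (L.Stalk x) (L.oneForms.stalk x) p z
    (exteriorPower.ιMulti (L.Stalk x) p t)) h).trans ?_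
  exact exteriorPower.pairingDual_ιMulti_ιMulti _ _

/-- The Poisson pairing of exterior powers. -/
def powerPairing (p : ℕ) : StalkSheaf.Pairing (L.conormal.exteriorPower p)
    (L.oneForms.exteriorPower p) where
  stalk := stalkPowerPairing σ hinv p
  mem := by
    rintro V _ ⟨s, hs, rfl⟩ _ ⟨t, ht, rfl⟩
    have := det_mem_sections (L := L) (V := V) (Matrix.of fun i j =>
      (⟨_, (poissonPairing σ hinv).mem V (s j) (hs j) (t i) (ht i)⟩ : L.sections V))
    convert this using 1
    funext x
    exact stalkPowerPairing_ιMulti σ hinv p x _ _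

theorem powerPairing_wedge {p : ℕ} {V : Opens M} (s : Fin p → L.conormal.sections V)
    (t : Fin p → L.oneForms.sections V) :
    (powerPairing σ hinv p).onSections V (L.conormal.wedge p V s) (L.oneForms.wedge p V t) =
      Matrix.det (Matrix.of fun i j => (poissonPairing σ hinv).onSections V (s j) (t i)) := by
  refine Subtype.ext <| funext fun x => ?_
  refine (stalkPowerPairing_ιMulti σ hinv p x _ _).trans ?_
  exact (RingHom.map_det (evalAt (L := L) x) (Matrix.of fun i j =>
    (poissonPairing σ hinv).onSections V (s j) (t i))).symm

/-- The functional on `p`-forms defined by a section of the exterior power of the conormal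
sheaf. -/
def toFunctional {p : ℕ} {V : Opens M} (ν : (L.conormal.exteriorPower p).sections V) :
    dualSections (L.oneForms.exteriorPower p).toModules V :=
  StalkSheaf.mkDual
    (fun W h => (powerPairing σ hinv p).onSections W ((L.conormal.exteriorPower p).res h ν))
    fun _ _ _ _ _ => rfl

theorem ev_toFunctional {p : ℕ} {V W : Opens M} (h : W ≤ V)
    (ν : (L.conormal.exteriorPower p).sections V) :
    StalkSheaf.ev (toFunctional σ hinv ν) W h =
      (powerPairing σ hinv p).onSections W ((L.conormal.exteriorPower p).res h ν) := rfl

/-! ### Frames in a chart -/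

variable {W : Opens M}

/-- The section of the conormal sheaf defined by a function. -/
def conormalSection (f : LocalFunction 𝕂 n W) (hf : ∀ y : W, f.germ y ∈ L.ideal y) :
    L.conormal.sections W :=
  ⟨fun y => (L.ideal (y : M)).toCotangent ⟨f.germ y, hf y⟩,
    L.conormal.span_gens_le_sections W (Submodule.subset_span ⟨f, hf, rfl⟩)⟩

variable (L) in
/-- The differential of a function as a section of `Ω¹_L`. -/
def formSection (g : LocalFunction 𝕂 n W) : L.oneForms.sections W :=
  ⟨fun y => L.dForm (g.germ y),
    L.oneForms.span_gens_le_sections W (Submodule.subset_span ⟨g, rfl⟩)⟩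

variable {e : OpenPartialHomeomorph M (Model 𝕂 n)} (he : e ∈ atlas (Model 𝕂 n) M)
  (hW : ∀ y ∈ W, y ∈ e.source)

/-- A coordinate function on an open subset of the domain of a chart. -/
def coordFunction (l : Fin (2 * n)) : LocalFunction 𝕂 n W :=
  ⟨coordFun e l, fun y hy => (contMDiffAt_coordFun he l (hW y hy)).contMDiffWithinAt⟩

/-- The partial derivative of a local function. -/
def derivFunction (f : LocalFunction 𝕂 n W) (l : Fin (2 * n)) : LocalFunction 𝕂 n W :=
  ⟨chartDeriv e (stdVec 𝕂 n l) f.toFun, fun y hy => (contMDiffAt_chartDeriv he (hW y hy)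
    (f.contMDiffOn.contMDiffAt (W.isOpen.mem_nhds hy)) _).contMDiffWithinAt⟩

theorem germ_derivFunction (f : LocalFunction 𝕂 n W) (l : Fin (2 * n)) (y : W) :
    (derivFunction he hW f l).germ y = germDeriv he (hW y y.2) (stdVec 𝕂 n l) (f.germ y) :=
  (germDeriv_mk he (hW y y.2) (stdVec 𝕂 n l)
    (f.contMDiffOn.contMDiffAt (W.isOpen.mem_nhds y.2))).symm

variable (L) in
/-- The matrix of partial derivatives, as sections of `𝒪_L`. -/
def jacobianSection {k : ℕ} (f : Fin k → LocalFunction 𝕂 n W) :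
    Matrix (Fin k) (Fin (2 * n)) (L.sections W) :=
  Matrix.of fun i l => ⟨L.ofFunction (derivFunction he hW (f i) l), ofFunction_mem_sections _⟩

variable (L) in
/-- The coordinate differentials. -/
def coordForm (l : Fin (2 * n)) : L.oneForms.sections W :=
  L.formSection (coordFunction he hW l)

theorem formSection_eq_sum {k : ℕ} (f : Fin k → LocalFunction 𝕂 n W) (i : Fin k) :
    L.formSection (f i) = ∑ l, L.jacobianSection he hW f i l • L.coordForm he hW l := by
  refine Subtype.ext <| funext fun y => ?_
  rw [Submodule.coe_sum, Finset.sum_apply]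
  refine (dForm_eq_sum he (hW y y.2) ((f i).germ y)).trans ?_
  refine Finset.sum_congr rfl fun l _ => ?_
  rw [← germ_derivFunction he hW (f i) l y]
  rfl

theorem formSection_eq_zero (f : LocalFunction 𝕂 n W) (hf : ∀ y : W, f.germ y ∈ L.ideal y) :
    L.formSection f = 0 := Subtype.ext <| funext fun y => dForm_eq_zero (hf y)

variable {k : ℕ} (f : Fin k → LocalFunction 𝕂 n W) (hf : ∀ i (y : W), (f i).germ y ∈ L.ideal y)

/-- The brackets of functions with the coordinates, as sections of `𝒪_L`. -/
def bracketSection : Matrix (Fin k) (Fin (2 * n)) (L.sections W) :=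
  Matrix.of fun i l => (poissonPairing σ hinv).onSections W (conormalSection (f i) (hf i))
    (L.coordForm he hW l)

theorem jacobianSection_map_evalAt (y : W) :
    (L.jacobianSection he hW f).map (evalAt y) =
      L.jacobian he (hW y y.2) fun i => (f i).germ y := by
  refine Matrix.ext fun i l => ?_
  exact congrArg (L.toStalk (y : M)) (germ_derivFunction he hW (f i) l y)

variable (T : Fin k → Fin (2 * n))

/-- One-forms dual to the given functions. -/
def dualForm (j : Fin k) : L.oneForms.sections W :=
  ∑ l, dualRows ((bracketSection σ hinv he hW f hf).submatrix id T) T j l • L.coordForm he hW l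

theorem poissonPairing_dualForm (i j : Fin k) :
    (poissonPairing σ hinv).onSections W (conormalSection (f i) (hf i))
      (dualForm σ hinv he hW f hf T j) =
      if i = j then ((bracketSection σ hinv he hW f hf).submatrix id T).det else 0 := by
  rw [dualForm, map_sum]
  have h := congrFun (congrFun (mul_dualRows_transpose (bracketSection σ hinv he hW f hf) T) i) j
  rw [Matrix.mul_apply, Matrix.smul_apply, Matrix.one_apply, smul_eq_mul, mul_ite, mul_one,
    mul_zero] at h
  rw [← h]
  refine Finset.sum_congr rfl fun l _ => ?_
  rw [map_smul, smul_eq_mul, mul_comm]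
  rfl

end AnalyticSubspace

end SingularLagrangian

end SectionPairing

/-! ### Multiples of functionals on forms, and the kernel of the pairing -/

noncomputable section Multipliers

set_option linter.unusedSectionVars false

namespace SingularLagrangian

universe u

namespace AnalyticSubspace

variable {𝕂 : Type} [RCLike 𝕂] {n : ℕ} {M : Type u} [TopologicalSpace M]
  [ChartedSpace (Model 𝕂 n) M] [IsManifold 𝓘(𝕂, Model 𝕂 n) ω M]
  {L : AnalyticSubspace 𝕂 n M} (σ : SymplecticForm 𝕂 n M) (hinv : L.IsInvolutive σ)

theorem natCast_notMem_stalk {x : M} (Q : Ideal (L.Stalk x)) (hQ : Q.IsPrime) {m : ℕ}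
    (hm : m ≠ 0) : (m : L.Stalk x) ∉ Q := by
  intro h
  refine hQ.ne_top (Q.eq_top_of_isUnit_mem h ?_)
  have h1 : IsUnit (AnalyticGerm.mk (n := n) (y := x) (fun _ => (m : 𝕂)) contMDiffAt_const) :=
    isUnit_analyticGerm _ (Nat.cast_ne_zero.2 hm)
  have h2 : (AnalyticGerm.mk (n := n) (y := x) (fun _ => (m : 𝕂)) contMDiffAt_const) =
      (m : AnalyticGerm 𝕂 n x) := Subtype.ext rfl
  rw [h2] at h1
  have h3 := h1.map (L.toStalk x)
  rwa [map_natCast] at h3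

/-- The multiple of a functional by a section of `𝒪_L`. -/
def StalkSheaf.smulDual {F : StalkSheaf L} {W : Opens M} (a : L.sections W)
    (φ : dualSections F.toModules W) : dualSections F.toModules W :=
  StalkSheaf.mkDual (fun V h => L.resSections h a • StalkSheaf.ev φ V h) fun _ h _ hV' s =>
    congrArg (L.resSections (hV'.trans h) a * ·) (StalkSheaf.ev_res φ h hV' s)

/-- The multiple `a • θ` of a functional on forms is given by the section `ν`. -/
def IsMultiple {p : ℕ} {W : Opens M} (a : L.sections W)
    (θ : dualSections (L.oneForms.exteriorPower p).toModules W)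
    (ν : (L.conormal.exteriorPower p).sections W) : Prop :=
  ∀ W' (hW' : W' ≤ W) (τ : (L.oneForms.exteriorPower p).sections W'),
    L.resSections hW' a * StalkSheaf.ev θ W' hW' τ =
      (powerPairing σ hinv p).onSections W' ((L.conormal.exteriorPower p).res hW' ν) τ

theorem powerPairing_sum_wedge {p r : ℕ} {V : Opens M} (a : (Fin p → Fin r) → L.sections V)
    (s : Fin r → L.conormal.sections V) (t : Fin p → L.oneForms.sections V) :
    (powerPairing σ hinv p).onSections V
      (∑ K : Fin p → Fin r, a K • L.conormal.wedge p V fun i => s (K i))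
        (L.oneForms.wedge p V t) = ∑ K : Fin p → Fin r, a K *
      Matrix.det (Matrix.of fun i j => (poissonPairing σ hinv).onSections V (s (K j)) (t i)) := by
  rw [map_sum, LinearMap.sum_apply]
  refine Finset.sum_congr rfl fun K _ => ?_
  rw [map_smul, LinearMap.smul_apply, powerPairing_wedge, smul_eq_mul]

section Frame

variable {W : Opens M} {e : OpenPartialHomeomorph M (Model 𝕂 n)} (he : e ∈ atlas (Model 𝕂 n) M)
  (hW : ∀ y ∈ W, y ∈ e.source) (f : Fin n → LocalFunction 𝕂 n W)
  (hf : ∀ i (y : W), (f i).germ y ∈ L.ideal y) (T : Fin n → Fin (2 * n))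

/-- The determinant of the matrix of a frame. -/
def frameSection : L.sections W :=
  (stacked (dualRows ((bracketSection σ hinv he hW f hf).submatrix id T) T)
    (L.jacobianSection he hW f)).det

/-- Cramer's rule for the stacked matrix: the determinant times a coordinate differential is a
combination of the dual forms and the df_i, and the latter are zero in Ω¹_L. -/
theorem frameSection_smul_mem (l : Fin (2 * n)) :
    frameSection σ hinv he hW f hf T • L.coordForm he hW l ∈
      Submodule.span (L.sections W) (Set.range (dualForm σ hinv he hW f hf T)) := by
  set u := dualRows ((bracketSection σ hinv he hW f hf).submatrix id T) T with hu
  set A := L.jacobianSection he hW f with hA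
  have h1 : ∀ a, ∑ b, stacked u A a b • L.coordForm he hW (doubleEquiv n b) ∈
      Submodule.span (L.sections W) (Set.range (dualForm σ hinv he hW f hf T)) := by
    intro a
    have hs : ∑ b, stacked u A a b • L.coordForm he hW (doubleEquiv n b) =
        ∑ l, (Matrix.fromRows u A) a l • L.coordForm he hW l :=
      (doubleEquiv n).sum_comp fun l => (Matrix.fromRows u A) a l • L.coordForm he hW l
    rw [hs]
    rcases a with j | i
    · exact Submodule.subset_span ⟨j, rfl⟩
    · have : ∑ l, (Matrix.fromRows u A) (Sum.inr i) l • L.coordForm he hW l = 0 := by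
        rw [← formSection_eq_zero (L := L) (f i) (hf i), formSection_eq_sum he hW f i]
        rfl
      rw [this]
      exact zero_mem _
  have h2 : (stacked u A).det • L.coordForm he hW l =
      ∑ a, (stacked u A).adjugate ((doubleEquiv n).symm l) a •
        ∑ b, stacked u A a b • L.coordForm he hW (doubleEquiv n b) := by
    simp only [Finset.smul_sum, smul_smul]
    rw [Finset.sum_comm]
    simp only [← Finset.sum_smul, ← Matrix.mul_apply, Matrix.adjugate_mul, Matrix.smul_apply,
      Matrix.one_apply, smul_eq_mul, mul_ite, mul_one, mul_zero, ite_smul, zero_smul,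
      Finset.sum_ite_eq, Finset.mem_univ, if_true, Equiv.apply_symm_apply]
  change (stacked u A).det • L.coordForm he hW l ∈ _
  rw [h2]
  exact sum_mem fun a _ => Submodule.smul_mem _ _ (h1 a)

theorem frameSection_smul_mem_of_mem_gens {V : Opens M} (hV : V ≤ W) (t : L.oneForms.sections V)
    (ht : t.1 ∈ L.oneForms.gens V) :
    L.resSections hV (frameSection σ hinv he hW f hf T) • t ∈ Submodule.span (L.sections V)
      (Set.range fun j => L.oneForms.res hV (dualForm σ hinv he hW f hf T j)) := by
  have hV' : ∀ y ∈ V, y ∈ e.source := fun y hy => hW y (hV hy)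
  have hco : ∀ l, L.resSections hV (frameSection σ hinv he hW f hf T) • L.coordForm he hV' l ∈
      Submodule.span (L.sections V)
        (Set.range fun j => L.oneForms.res hV (dualForm σ hinv he hW f hf T j)) := by
    intro l
    obtain ⟨c, hc⟩ := (Submodule.mem_span_range_iff_exists_fun _).1
      (frameSection_smul_mem σ hinv he hW f hf T l)
    have h1 := congrArg (L.oneForms.res hV) hc
    rw [map_sum] at h1
    exact (Submodule.mem_span_range_iff_exists_fun _).2 ⟨fun j => L.resSections hV (c j), h1⟩
  obtain ⟨k, hk⟩ := ht
  have h1 : t = ∑ l, L.jacobianSection he hV' (fun _ : Fin 1 => k) 0 l •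
      L.coordForm he hV' l := by
    rw [← formSection_eq_sum he hV' (fun _ : Fin 1 => k) 0]
    exact Subtype.ext hk
  rw [h1, Finset.smul_sum]
  refine sum_mem fun l _ => ?_
  rw [smul_comm]
  exact Submodule.smul_mem _ _ (hco l)

/-- An explicit multiple of a functional on forms comes from the exterior power of the conormal
sheaf. -/
theorem exists_smul_eq_toFunctional {p : ℕ}
    (θ : dualSections (L.oneForms.exteriorPower p).toModules W) :
    ∃ ν : (L.conormal.exteriorPower p).sections W,
      IsMultiple σ hinv ((p.factorial : L.sections W) *
        ((bracketSection σ hinv he hW f hf).submatrix id T).det ^ p *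
          frameSection σ hinv he hW f hf T ^ p) θ ν := by
  set h := ((bracketSection σ hinv he hW f hf).submatrix id T).det with hh
  set g := frameSection σ hinv he hW f hf T with hg
  set u := dualForm σ hinv he hW f hf T with hu
  -- Dictated by `AlternatingMap.factorial_mul_eq_sum`: the coefficient of each wedge of equations
  -- is θ at the corresponding wedge of dual forms, and the determinant of brackets is the pairing
  -- with that wedge.
  let ν : (L.conormal.exteriorPower p).sections W := ∑ K : Fin p → Fin n,
    (g ^ p * StalkSheaf.ev θ W le_rfl (L.oneForms.wedge p W fun i => u (K i))) •
      L.conormal.wedge p W fun i => conormalSection (f (K i)) (hf (K i))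
  refine ⟨ν, ?_⟩
  have key : StalkSheaf.smulDual ((p.factorial : L.sections W) * h ^ p * g ^ p) θ =
      toFunctional σ hinv ν := by
    refine StalkSheaf.dual_ext_wedge fun V hV t ht => ?_
    change L.resSections hV ((p.factorial : L.sections W) * h ^ p * g ^ p) *
      StalkSheaf.ev θ V hV (L.oneForms.wedge p V t) = _
    have hspan := fun i => frameSection_smul_mem_of_mem_gens σ hinv he hW f hf T hV (t i) (ht i)
    have hexp := AlternatingMap.factorial_mul_eq_sum
      ((StalkSheaf.ev θ V hV).compAlternatingMap (L.oneForms.wedge p V))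
      (fun j => L.oneForms.res hV (u j))
      (fun i => (poissonPairing σ hinv).onSections V
        (L.conormal.res hV (conormalSection (f i) (hf i))))
      (L.resSections hV h) (L.resSections hV g) (fun i j => by
        have h1 := congrArg (L.resSections hV)
          (poissonPairing_dualForm σ hinv he hW f hf T i j)
        rw [apply_ite (L.resSections hV), map_zero] at h1
        exact h1) t hspan
    simp only [map_mul, map_pow, map_natCast]
    refine hexp.trans ?_
    have hν : (L.conormal.exteriorPower p).res hV ν = ∑ K : Fin p → Fin n,
        (L.resSections hV g ^ p * StalkSheaf.ev θ V hV
          (L.oneForms.wedge p V fun i => L.oneForms.res hV (u (K i)))) •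
        L.conormal.wedge p V fun i => L.conormal.res hV (conormalSection (f (K i)) (hf (K i))) := by
      rw [map_sum]
      refine Finset.sum_congr rfl fun K _ => ?_
      rw [StalkSheaf.res_smul, map_mul, map_pow, StalkSheaf.ev_res]
      rfl
    rw [ev_toFunctional, hν]
    exact (powerPairing_sum_wedge σ hinv _
      (fun j => L.conormal.res hV (conormalSection (f j) (hf j))) t).symm
  intro W' hW' τ
  exact congrArg (fun φ => StalkSheaf.ev φ W' hW' τ) key

theorem evalAt_frameSection (y : W) : evalAt y (frameSection σ hinv he hW f hf T) =
    (stacked (dualRows ((L.brackets σ he (hW y y.2) fun i => (f i).germ y).submatrix id T) T)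
      (L.jacobian he (hW y y.2) fun i => (f i).germ y)).det := by
  rw [frameSection, RingHom.map_det, RingHom.mapMatrix_apply, stacked_map, dualRows_map,
    jacobianSection_map_evalAt]
  rfl

theorem evalAt_det_bracketSection {k : ℕ} (f : Fin k → LocalFunction 𝕂 n W)
    (hf : ∀ i (y : W), (f i).germ y ∈ L.ideal y) (T : Fin k → Fin (2 * n)) (y : W) :
    evalAt y ((bracketSection σ hinv he hW f hf).submatrix id T).det =
      ((L.brackets σ he (hW y y.2) fun i => (f i).germ y).submatrix id T).det := by
  rw [RingHom.map_det]
  rfl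

end Frame

/-- Locally there are multipliers, without common zero in codimension one, which carry functionals
on forms into the exterior power of the conormal sheaf. -/
theorem exists_multipliers (hdim : L.dim = n) (hR1 : L.IsRegularInCodimOne) (p : ℕ)
    {V : Opens M} {x : M} (hx : x ∈ V) :
    ∃ (W : Opens M) (_ : W ≤ V) (_ : x ∈ W) (k : ℕ)
      (m : (Fin n → Fin k) × (Fin n → Fin (2 * n)) → L.sections W),
      (∀ i (θ : dualSections (L.oneForms.exteriorPower p).toModules W),
        ∃ ν, IsMultiple σ hinv (m i) θ ν) ∧
      ∀ (y : W) (Q : Ideal (L.Stalk (y : M))), Q.IsPrime → Q.height ≤ 1 →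
        ∃ i, (m i).1 y ∉ Q := by
  obtain ⟨V', hxV', k, f, hf⟩ := L.locally_fg x
  let e := chartAt (Model 𝕂 n) x
  have he : e ∈ atlas (Model 𝕂 n) M := chart_mem_atlas (Model 𝕂 n) x
  let W : Opens M := V ⊓ V' ⊓ ⟨e.source, e.open_source⟩
  have hW : ∀ y ∈ W, y ∈ e.source := fun y hy => hy.2
  have hWV' : W ≤ V' := inf_le_left.trans inf_le_right
  let g : Fin k → LocalFunction 𝕂 n W := fun i => (f i).res hWV'
  have hspan : ∀ y : W, L.ideal y = Ideal.span (Set.range fun i => (g i).germ y) :=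
    fun y => hf ⟨y, hWV' y.2⟩
  have hg : ∀ i (y : W), (g i).germ y ∈ L.ideal y := fun i y => by
    rw [hspan y]; exact Ideal.subset_span ⟨i, rfl⟩
  refine ⟨W, inf_le_left.trans inf_le_left, ⟨⟨hx, hxV'⟩, mem_chart_source _ x⟩, k,
    fun ST => (p.factorial : L.sections W) *
      ((bracketSection σ hinv he hW (g ∘ ST.1) fun i => hg (ST.1 i)).submatrix id ST.2).det ^ p *
        frameSection σ hinv he hW (g ∘ ST.1) (fun i => hg (ST.1 i)) ST.2 ^ p,
    fun ST θ => exists_smul_eq_toFunctional σ hinv he hW (g ∘ ST.1) _ ST.2 θ, fun y Q hQ hht => ?_⟩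
  -- One of the finitely many choices of equations and columns has both determinants outside Q; p!
  -- is a unit, so that multiplier is outside Q too.
  obtain ⟨S, T, hS, hT⟩ := L.exists_minor_notMem σ he (hW y y.2) hinv hdim hR1 _ (hspan y) Q hht
  refine ⟨(S, T), fun hmem => ?_⟩
  have h1 : evalAt y ((p.factorial : L.sections W) *
      ((bracketSection σ hinv he hW (g ∘ S) fun i => hg (S i)).submatrix id T).det ^ p *
        frameSection σ hinv he hW (g ∘ S) (fun i => hg (S i)) T ^ p) ∈ Q := hmem
  rw [map_mul, map_mul, map_pow, map_pow, map_natCast, evalAt_frameSection,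
    evalAt_det_bracketSection] at h1
  rcases hQ.mem_or_mem h1 with h2 | h2
  · rcases hQ.mem_or_mem h2 with h3 | h3
    · exact natCast_notMem_stalk Q hQ p.factorial_ne_zero h3
    · exact hS (hQ.mem_of_pow_mem p h3)
  · exact hT (hQ.mem_of_pow_mem p h2)

/-! ### The kernel of the pairing -/

section Kernel

variable {W : Opens M} {r : ℕ} (f : Fin r → LocalFunction 𝕂 n W)
  (hf : ∀ i (y : W), (f i).germ y ∈ L.ideal y)

/-- The subsheaf of the conormal sheaf generated by given functions. -/
def subConormal : StalkSheaf L where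
  stalk := L.conormal.stalk
  gens V := {s | ∃ (h : V ≤ W) (j : Fin r),
    s = fun y : V => (conormalSection (f j) (hf j)).1 ⟨y, h y.2⟩}
  gens_res h := by
    rintro _ ⟨h', j, rfl⟩
    exact ⟨h.trans h', j, rfl⟩

/-- The relation c g = ∑ b_i f_i, known at x, holds in a neighbourhood and there passes to classes
in I/I². -/
theorem exists_smul_mem_span_subConormal {x : M} (hx : x ∈ W) (c : LocalFunction 𝕂 n W)
    (hc : ∀ a ∈ L.ideal x, c.germ ⟨x, hx⟩ * a ∈ Ideal.span (Set.range fun i => (f i).germ ⟨x, hx⟩))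
    {V : Opens M} (hxV : x ∈ V) (s : ∀ y : V, L.conormal.stalk y) (hs : s ∈ L.conormal.gens V) :
    ∃ (V' : Opens M) (hV' : V' ≤ V) (hW' : V' ≤ W), x ∈ V' ∧
      L.resSections hW' ⟨L.ofFunction c, ofFunction_mem_sections c⟩ •
        (fun y : V' => s ⟨y, hV' y.2⟩) ∈
        Submodule.span (L.sections V') ((subConormal f hf).gens V') := by
  obtain ⟨g, hg, rfl⟩ := hs
  have hcg : ContMDiffOn 𝓘(𝕂, Model 𝕂 n) 𝓘(𝕂, 𝕂) ω (c.toFun * g.toFun) (V ⊓ W : Opens M) :=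
    (c.res inf_le_right).contMDiffOn.mul (g.res inf_le_left).contMDiffOn
  obtain ⟨V', hV', hxV', b, hb⟩ := exists_eq_sum_germ (V := V ⊓ W)
    (fun i => (f i).res inf_le_right) ⟨_, hcg⟩ ⟨x, hxV, hx⟩ (hc _ (hg ⟨x, hxV⟩))
  refine ⟨V', hV'.trans inf_le_left, hV'.trans inf_le_right, hxV', ?_⟩
  have key : L.resSections (hV'.trans inf_le_right) ⟨L.ofFunction c, ofFunction_mem_sections c⟩ •
      (fun y : V' => (L.ideal (y : M)).toCotangent ⟨g.germ ⟨y, (hV' y.2).1⟩, hg ⟨y, (hV' y.2).1⟩⟩) =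
      ∑ i, (⟨L.ofFunction (b i), ofFunction_mem_sections (b i)⟩ : L.sections V') •
        fun y : V' => (conormalSection (f i) (hf i)).1 ⟨y, (hV' y.2).2⟩ := by
    funext y
    rw [Finset.sum_apply]
    have h1 : (⟨c.germ ⟨y, (hV' y.2).2⟩ * g.germ ⟨y, (hV' y.2).1⟩,
        Ideal.mul_mem_left _ _ (hg ⟨y, (hV' y.2).1⟩)⟩ : L.ideal (y : M)) =
        ∑ i, (b i).germ y • ⟨(f i).germ ⟨y, (hV' y.2).2⟩, hf i ⟨y, (hV' y.2).2⟩⟩ := by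
      refine Subtype.ext ?_
      rw [Submodule.coe_sum]
      exact hb y
    have h2 := congrArg (L.ideal (y : M)).toCotangent h1
    rw [map_sum] at h2
    exact h2
  refine (congrArg (· ∈ Submodule.span (L.sections V') ((subConormal f hf).gens V')) key).mpr ?_
  exact sum_mem fun i _ => Submodule.smul_mem _ _
    (Submodule.subset_span ⟨hV'.trans inf_le_right, i, rfl⟩)

/-- Each of the p factors of a wedge costs one factor c, whence the exponent. -/
theorem exists_pow_smul_mem_span {p : ℕ} {x : M} (hx : x ∈ W) (c : LocalFunction 𝕂 n W)
    (hc : ∀ a ∈ L.ideal x, c.germ ⟨x, hx⟩ * a ∈ Ideal.span (Set.range fun i => (f i).germ ⟨x, hx⟩))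
    {V : Opens M} (hxV : x ∈ V) (s : ∀ y : V, (L.conormal.exteriorPower p).stalk y)
    (hs : s ∈ Submodule.span (L.sections V) ((L.conormal.exteriorPower p).gens V)) :
    ∃ (V' : Opens M) (hV' : V' ≤ V) (hW' : V' ≤ W), x ∈ V' ∧
      L.resSections hW' ⟨L.ofFunction c, ofFunction_mem_sections c⟩ ^ p •
        (fun y : V' => s ⟨y, hV' y.2⟩) ∈
        Submodule.span (L.sections V') (((subConormal f hf).exteriorPower p).gens V') := by
  induction hs using Submodule.span_induction with
  | mem s hs =>
    obtain ⟨t, ht, rfl⟩ := hs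
    choose U hUV hUW hxU hU using fun i =>
      exists_smul_mem_span_subConormal f hf hx c hc hxV (t i) (ht i)
    obtain ⟨V', hV', hxV', hle⟩ := exists_opens_le (V := V ⊓ W) ⟨hxV, hx⟩ U hxU
    have hW' := hV'.trans inf_le_right
    refine ⟨V', hV'.trans inf_le_left, hW', hxV', ?_⟩
    have h1 := MultilinearMap.map_mem_of_mem_span
      ((subConormal f hf).wedgeFamily p V').toMultilinearMap ((subConormal f hf).gens V')
      (Submodule.span _ (((subConormal f hf).exteriorPower p).gens V'))
      (fun s hs => Submodule.subset_span ⟨s, hs, rfl⟩)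
      (fun i => L.resSections hW' ⟨L.ofFunction c, ofFunction_mem_sections c⟩ •
        fun y : V' => t i ⟨y, (hV' y.2).1⟩)
      fun i => (subConormal f hf).res_mem_span (hle i) (hU i)
    have h2 := MultilinearMap.map_smul_univ ((subConormal f hf).wedgeFamily p V').toMultilinearMap
      (fun _ => L.resSections hW' ⟨L.ofFunction c, ofFunction_mem_sections c⟩)
      (fun i (y : V') => t i ⟨y, (hV' y.2).1⟩)
    rw [Finset.prod_const, Finset.card_univ, Fintype.card_fin] at h2
    exact (congrArg (· ∈ Submodule.span (L.sections V')
      (((subConormal f hf).exteriorPower p).gens V')) h2).mp h1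
  | zero =>
    refine ⟨V ⊓ W, inf_le_left, inf_le_right, ⟨hxV, hx⟩, ?_⟩
    have : (fun y : (V ⊓ W : Opens M) =>
      (0 : ∀ y : V, (L.conormal.exteriorPower p).stalk y) ⟨y, y.2.1⟩) = 0 := rfl
    rw [this, smul_zero]
    exact zero_mem _
  | add s t _ _ hs ht =>
    obtain ⟨V₁, h₁, h₁', hx₁, hs⟩ := hs
    obtain ⟨V₂, h₂, h₂', hx₂, ht⟩ := ht
    refine ⟨V₁ ⊓ V₂, inf_le_left.trans h₁, inf_le_left.trans h₁', ⟨hx₁, hx₂⟩, ?_⟩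
    have h3 := add_mem (((subConormal f hf).exteriorPower p).res_mem_span
      (inf_le_left : V₁ ⊓ V₂ ≤ V₁) hs) (((subConormal f hf).exteriorPower p).res_mem_span
      (inf_le_right : V₁ ⊓ V₂ ≤ V₂) ht)
    refine (congrArg (· ∈ Submodule.span (L.sections (V₁ ⊓ V₂))
      (((subConormal f hf).exteriorPower p).gens (V₁ ⊓ V₂))) ?_).mpr h3
    funext y
    exact smul_add (evalAt y (L.resSections (inf_le_left.trans h₁' : V₁ ⊓ V₂ ≤ W)
      ⟨L.ofFunction c, ofFunction_mem_sections c⟩ ^ p)) (s ⟨y, h₁ y.2.1⟩) (t ⟨y, h₂ y.2.2⟩)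
  | smul a s _ hs =>
    obtain ⟨V₁, h₁, h₁', hx₁, hs⟩ := hs
    refine ⟨V₁, h₁, h₁', hx₁, ?_⟩
    have h3 := Submodule.smul_mem _ (L.resSections h₁ a) hs
    refine (congrArg (· ∈ Submodule.span (L.sections V₁)
      (((subConormal f hf).exteriorPower p).gens V₁)) ?_).mpr h3
    funext y
    exact smul_comm (evalAt y (L.resSections h₁' ⟨L.ofFunction c, ofFunction_mem_sections c⟩ ^ p))
      (evalAt y (L.resSections h₁ a)) (s ⟨y, h₁ y.2⟩)

end Kernel

end AnalyticSubspace

end SingularLagrangian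

end Multipliers

/-! ### ### Functionals on the conormal powers vanish on the kernel of the pairing -/

noncomputable section KernelPairing

set_option linter.unusedSectionVars false

namespace SingularLagrangian

universe u

namespace AnalyticSubspace

variable {𝕂 : Type} [RCLike 𝕂] {n : ℕ} {M : Type u} [TopologicalSpace M]
  [ChartedSpace (Model 𝕂 n) M] [IsManifold 𝓘(𝕂, Model 𝕂 n) ω M]
  {L : AnalyticSubspace 𝕂 n M} (σ : SymplecticForm 𝕂 n M) (hinv : L.IsInvolutive σ)

theorem exists_mem_span_wedge {p r : ℕ} {W V : Opens M} (f : Fin r → LocalFunction 𝕂 n W)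
    (hf : ∀ i (y : W), (f i).germ y ∈ L.ideal y) (hV : V ≤ W)
    (z : (L.conormal.exteriorPower p).sections V)
    (hz : z.1 ∈ Submodule.span (L.sections V) (((subConormal f hf).exteriorPower p).gens V)) :
    z ∈ Submodule.span (L.sections V) (Set.range fun K : Fin p → Fin r =>
      L.conormal.wedge p V fun i => L.conormal.res hV (conormalSection (f (K i)) (hf (K i)))) := by
  have h1 : (((subConormal f hf).exteriorPower p).gens V) ⊆
      (((L.conormal.exteriorPower p).sections V).subtype '' Set.range fun K : Fin p → Fin r =>
        L.conormal.wedge p V fun i =>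
          L.conormal.res hV (conormalSection (f (K i)) (hf (K i)))) := by
    rintro _ ⟨t, ht, rfl⟩
    choose _ K hK using ht
    obtain rfl : t = fun i => fun y : V =>
      (conormalSection (f (K i)) (hf (K i))).1 ⟨y, hV y.2⟩ := funext hK
    exact ⟨_, ⟨K, rfl⟩, rfl⟩
  have h2 := Submodule.span_mono (R := L.sections V) h1 hz
  obtain ⟨z', hz', h3⟩ := (SetLike.ext_iff.1 (Submodule.map_span
    ((L.conormal.exteriorPower p).sections V).subtype _) _).2 h2
  rwa [← show z' = z from Subtype.ext h3]

/-- Elimination of the pairing by means of dual forms. -/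
theorem factorial_mul_ev {p r : ℕ} {U V : Opens M} (hV : V ≤ U)
    (ψ : dualSections (L.conormal.exteriorPower p).toModules U)
    (s : Fin r → L.conormal.sections V) (u : Fin r → L.oneForms.sections V) (h : L.sections V)
    (hsu : ∀ i j, (poissonPairing σ hinv).onSections V (s i) (u j) = if i = j then h else 0)
    (z : (L.conormal.exteriorPower p).sections V)
    (hz : z ∈ Submodule.span (L.sections V) (Set.range fun K : Fin p → Fin r =>
      L.conormal.wedge p V fun i => s (K i))) :
    (p.factorial : L.sections V) * h ^ p * StalkSheaf.ev ψ V hV z =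
      ∑ K : Fin p → Fin r, StalkSheaf.ev ψ V hV (L.conormal.wedge p V fun i => s (K i)) *
        (powerPairing σ hinv p).onSections V z (L.oneForms.wedge p V fun i => u (K i)) := by
  induction hz using Submodule.span_induction with
  | mem z hz =>
    obtain ⟨K', rfl⟩ := hz
    refine (AlternatingMap.sum_mul_det
      ((StalkSheaf.ev ψ V hV).compAlternatingMap (L.conormal.wedge p V)) s h K').symm.trans ?_
    refine Finset.sum_congr rfl fun K _ => ?_
    refine congrArg (StalkSheaf.ev ψ V hV (L.conormal.wedge p V fun i => s (K i)) * ·) ?_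
    refine Eq.trans ?_ (powerPairing_wedge σ hinv (fun i => s (K' i)) fun i => u (K i)).symm
    rw [← Matrix.det_transpose]
    refine congrArg Matrix.det (Matrix.ext fun i j => ?_)
    simp only [Matrix.transpose_apply, Matrix.of_apply, hsu, eq_comm]
  | zero => simp
  | add z z' _ _ hz hz' =>
    simp only [map_add, LinearMap.add_apply, mul_add, hz, hz', Finset.sum_add_distrib]
  | smul a z _ hz =>
    simp only [map_smul, LinearMap.smul_apply, smul_eq_mul] at hz ⊢
    rw [mul_left_comm, hz, Finset.mul_sum]
    exact Finset.sum_congr rfl fun K _ => by ring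

/-- A functional on the exterior power of the conormal sheaf vanishes on the kernel of the
pairing. -/
theorem ev_eq_zero_of_pairing_eq_zero (hred : L.IsReduced) (hR1 : L.IsRegularInCodimOne) {p : ℕ}
    {U V : Opens M} (hV : V ≤ U) (ψ : dualSections (L.conormal.exteriorPower p).toModules U)
    (ν : (L.conormal.exteriorPower p).sections V)
    (hν : ∀ W (hW : W ≤ V) (τ : (L.oneForms.exteriorPower p).sections W),
      (powerPairing σ hinv p).onSections W ((L.conormal.exteriorPower p).res hW ν) τ = 0) :
    StalkSheaf.ev ψ V hV ν = 0 := by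
  refine Subtype.ext <| funext fun x => ?_
  by_cases hxL : (x : M) ∈ L.carrier
  swap
  · have := L.subsingleton_stalk hxL
    exact Subsingleton.elim _ _
  have := hred x hxL
  -- In a reduced ring the minimal primes intersect in zero, so each can be treated separately.
  suffices h : (StalkSheaf.ev ψ V hV ν).1 x ∈ sInf (minimalPrimes (L.Stalk (x : M))) by
    have hs : sInf (minimalPrimes (L.Stalk (x : M))) = ⊥ := by
      rw [minimalPrimes, Ideal.sInf_minimalPrimes]; exact nilradical_eq_zero _
    rw [hs] at h
    exact h
  refine Ideal.mem_sInf.2 fun {Q} hQ => ?_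
  have hQp : Q.IsPrime := hQ.1.1
  let e := chartAt (Model 𝕂 n) (x : M)
  have he : e ∈ atlas (Model 𝕂 n) M := chart_mem_atlas (Model 𝕂 n) (x : M)
  have hxe : (x : M) ∈ e.source := mem_chart_source _ (x : M)
  obtain ⟨r, F, c, T, hF, hc, hcF, hdet⟩ := L.exists_adapted_equations σ he hxe hR1 Q hQ
  obtain ⟨W₁, hW₁, hx₁, f₁, hf₁, hf₁I⟩ := L.exists_localFunction_mem F hF
    (⟨e.source, e.open_source⟩ : Opens M) hxe
  obtain ⟨W, hW, hxW, c, rfl⟩ := exists_localFunction c W₁ hx₁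
  let f : Fin r → LocalFunction 𝕂 n W := fun i => (f₁ i).res hW
  have hf : ∀ i (y : W), (f i).germ y ∈ L.ideal y := fun i y => hf₁I i ⟨y, hW y.2⟩
  have hfF : (fun i => (f i).germ ⟨x, hxW⟩) = F := funext hf₁
  obtain ⟨V₁, hV₁, hxV₁, hs⟩ := ν.2 x
  obtain ⟨V₂, hV₂, hV₂W, hxV₂, hz⟩ := exists_pow_smul_mem_span f hf hxW c
    (by rw [hfF]; exact hcF) hxV₁ _ hs
  have he₂ : ∀ y ∈ V₂, y ∈ e.source := fun y hy => hW₁ (hW (hV₂W hy))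
  set a : L.sections V₂ := L.resSections hV₂W ⟨L.ofFunction c, ofFunction_mem_sections c⟩ with ha
  set h : L.sections V₂ := ((bracketSection σ hinv he he₂ (fun i => (f i).res hV₂W)
    fun i y => hf i ⟨y, hV₂W y.2⟩).submatrix id T).det with hh
  have key := factorial_mul_ev σ hinv ((hV₂.trans hV₁).trans hV) ψ
    (fun j => L.conormal.res hV₂W (conormalSection (f j) (hf j)))
    (dualForm σ hinv he he₂ (fun i => (f i).res hV₂W) (fun i y => hf i ⟨y, hV₂W y.2⟩) T) h
    (poissonPairing_dualForm σ hinv he he₂ (fun i => (f i).res hV₂W)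
      (fun i y => hf i ⟨y, hV₂W y.2⟩) T)
    (a ^ p • (L.conormal.exteriorPower p).res (hV₂.trans hV₁) ν)
    (exists_mem_span_wedge f hf hV₂W _ hz)
  -- The dual forms express p! h^p ψ(a^p ν) through pairings of ν with forms, all of which vanish.
  -- The factors p!, h and a are outside Q at x, so the value of ψ is in Q.
  have hzero : (p.factorial : L.sections V₂) * h ^ p * (a ^ p *
      StalkSheaf.ev ψ V₂ ((hV₂.trans hV₁).trans hV)
        ((L.conormal.exteriorPower p).res (hV₂.trans hV₁) ν)) = 0 := by
    rw [map_smul, smul_eq_mul] at key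
    rw [key]
    refine Finset.sum_eq_zero fun K _ => ?_
    rw [map_smul, LinearMap.smul_apply, hν, smul_zero, mul_zero]
  have h1 := congrArg (evalAt ⟨(x : M), hxV₂⟩) hzero
  rw [map_mul, map_mul, map_mul, map_pow, map_pow, map_natCast, map_zero] at h1
  have h2 := Q.zero_mem
  rw [← h1] at h2
  rcases hQp.mem_or_mem h2 with h3 | h3
  · rcases hQp.mem_or_mem h3 with h4 | h4
    · exact absurd h4 (natCast_notMem_stalk Q hQp p.factorial_ne_zero)
    · refine absurd (hQp.mem_of_pow_mem p h4) ?_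
      rw [hh, evalAt_det_bracketSection σ hinv he he₂ (fun i => (f i).res hV₂W)
        (fun i y => hf i ⟨y, hV₂W y.2⟩) T ⟨(x : M), hxV₂⟩]
      subst hfF
      exact hdet
  · rcases hQp.mem_or_mem h3 with h4 | h4
    · exact absurd (hQp.mem_of_pow_mem p h4) hc
    · exact (congrArg (· ∈ Q) (StalkSheaf.ev_apply_eq ψ hV (hV₂.trans hV₁) ν
        ⟨(x : M), hxV₂⟩)).mpr h4

end AnalyticSubspace

end SingularLagrangian

end KernelPairing

/-! ### The bidual of the sheaf of forms -/

noncomputable section Bidual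

set_option linter.unusedSectionVars false

namespace SingularLagrangian

universe u

namespace AnalyticSubspace

variable {𝕂 : Type} [RCLike 𝕂] {n : ℕ} {M : Type u} [TopologicalSpace M]
  [ChartedSpace (Model 𝕂 n) M] [IsManifold 𝓘(𝕂, Model 𝕂 n) ω M]
  {L : AnalyticSubspace 𝕂 n M} (σ : SymplecticForm 𝕂 n M) (hinv : L.IsInvolutive σ)

/-! #### Families of multipliers in a stalk -/

/-- A family of elements of a stalk has no common zero in codimension one. -/
def IsDense {x : M} {ι : Type*} (m : ι → L.Stalk x) : Prop :=
  ∀ Q : Ideal (L.Stalk x), Q.IsPrime → Q.height ≤ 1 → ∃ i, m i ∉ Q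

theorem IsDense.not_span_le {x : M} {ι : Type*} {m : ι → L.Stalk x} (hm : IsDense m)
    (Q : Ideal (L.Stalk x)) (hQ : Q.IsPrime) (hht : Q.height ≤ 1) :
    ¬ Ideal.span (Set.range m) ≤ Q := fun h => by
  obtain ⟨i, hi⟩ := hm Q hQ hht
  exact hi (h (Ideal.subset_span ⟨i, rfl⟩))

theorem IsDense.exists_nonzerodivisor (hred : L.IsReduced) {x : M} (hx : x ∈ L.carrier)
    {ι : Type*} {m : ι → L.Stalk x} (hm : IsDense m) :
    ∃ h ∈ Ideal.span (Set.range m), ∀ a, h * a = 0 → a = 0 := by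
  have := L.isNoetherianRing_stalk x
  have := hred x hx
  refine exists_nonzerodivisor_mem fun Q hQ => hm.not_span_le Q hQ.1.1 ?_
  have := hQ.1.1
  rw [Ideal.height_eq_zero_iff.2 hQ]
  exact zero_le_one

/-- Some combination of the multipliers is a nonzerodivisor, and it annihilates s - t. -/
theorem IsDense.eq_of_mul_eq (hred : L.IsReduced) {x : M} {ι : Type*} {m : ι → L.Stalk x}
    (hm : IsDense m) {s t : L.Stalk x} (h : ∀ i, m i * s = m i * t) : s = t := by
  by_cases hx : x ∈ L.carrier
  swap
  · have := L.subsingleton_stalk hx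
    exact Subsingleton.elim _ _
  obtain ⟨a, ha, hreg⟩ := hm.exists_nonzerodivisor hred hx
  refine sub_eq_zero.1 (hreg _ ?_)
  clear hreg
  induction ha using Submodule.span_induction with
  | mem a ha =>
    obtain ⟨i, rfl⟩ := ha
    rw [mul_sub, h i, sub_self]
  | zero => exact zero_mul _
  | add a b _ _ ha hb => rw [add_mul, ha, hb, add_zero]
  | smul c a _ ha => rw [smul_eq_mul, mul_assoc, ha, mul_zero]

/-- The fractions t_i / m_i agree. With a nonzerodivisor h = ∑ c_i m_i their common value is (∑ c_i
t_i) / h, whose numerator is divisible by h after multiplication by any m_j; the Cohen-Macaulay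
property then makes it divisible by h itself. -/
theorem IsDense.exists_mul_eq (hred : L.IsReduced) (hCM : L.IsCohenMacaulay) {x : M} {ι : Type*}
    [Fintype ι] {m : ι → L.Stalk x} (hm : IsDense m) (t : ι → L.Stalk x)
    (ht : ∀ i j, m i * t j = m j * t i) : ∃ s, ∀ i, m i * s = t i := by
  by_cases hx : x ∈ L.carrier
  swap
  · have := L.subsingleton_stalk hx
    exact ⟨0, fun i => Subsingleton.elim _ _⟩
  have := L.isNoetherianRing_stalk x
  have := L.isLocalRing_stalk hx
  obtain ⟨h, hh, hreg⟩ := hm.exists_nonzerodivisor hred hx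
  obtain ⟨c, hc⟩ := Ideal.mem_span_range_iff_exists_fun.1 hh
  have hj : ∀ j, m j * ∑ i, c i * t i = h * t j := fun j => by
    rw [← hc, Finset.mul_sum, Finset.sum_mul]
    refine Finset.sum_congr rfl fun i _ => ?_
    rw [mul_left_comm, ht j i, mul_assoc]
  have hmem : ∑ i, c i * t i ∈ Ideal.span {h} := by
    refine mem_span_singleton_of_isCohenMacaulay (hCM x hx) (J := Ideal.span (Set.range m))
      (fun Q hQ hht => hm.not_span_le Q hQ hht) hreg fun j hj' => ?_
    induction hj' using Submodule.span_induction with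
    | mem a ha =>
      obtain ⟨i, rfl⟩ := ha
      rw [hj]
      exact Ideal.mul_mem_right _ _ (Ideal.mem_span_singleton_self h)
    | zero => rw [zero_mul]; exact zero_mem _
    | add a b _ _ ha hb => rw [add_mul]; exact add_mem ha hb
    | smul c a _ ha => rw [smul_eq_mul, mul_assoc]; exact Ideal.mul_mem_left _ _ ha
  obtain ⟨s, hs⟩ := Ideal.mem_span_singleton.1 hmem
  refine ⟨s, fun i => sub_eq_zero.1 (hreg _ ?_)⟩
  rw [mul_sub, mul_left_comm, ← hs, hj, sub_self]

/-! #### Multiples of functionals -/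

variable {p : ℕ}

theorem resDual_smulDual {F : StalkSheaf L} {V W : Opens M} (hW : W ≤ V) (b : L.sections V)
    (θ : dualSections F.toModules V) : resDual _ hW (StalkSheaf.smulDual b θ) =
      StalkSheaf.smulDual (L.resSections hW b) (resDual _ hW θ) := rfl

theorem isMultiple_iff {W : Opens M} {a : L.sections W}
    {θ : dualSections (L.oneForms.exteriorPower p).toModules W}
    {ν : (L.conormal.exteriorPower p).sections W} :
    IsMultiple σ hinv a θ ν ↔ StalkSheaf.smulDual a θ = toFunctional σ hinv ν :=
  ⟨fun h => StalkSheaf.dual_ext h, fun h W' hW' τ =>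
    congrArg (fun φ => StalkSheaf.ev φ W' hW' τ) h⟩

theorem IsMultiple.res {W V : Opens M} {a : L.sections W}
    {θ : dualSections (L.oneForms.exteriorPower p).toModules W}
    {ν : (L.conormal.exteriorPower p).sections W} (h : IsMultiple σ hinv a θ ν) (hV : V ≤ W) :
    IsMultiple σ hinv (L.resSections hV a) (resDual _ hV θ)
      ((L.conormal.exteriorPower p).res hV ν) :=
  fun W' hW' τ => h W' (hW'.trans hV) τ

theorem IsMultiple.add {W : Opens M} {a : L.sections W}
    {θ θ' : dualSections (L.oneForms.exteriorPower p).toModules W}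
    {ν ν' : (L.conormal.exteriorPower p).sections W} (h : IsMultiple σ hinv a θ ν)
    (h' : IsMultiple σ hinv a θ' ν') : IsMultiple σ hinv a (θ + θ') (ν + ν') := by
  intro W' hW' τ
  refine (mul_add (L.resSections hW' a) (StalkSheaf.ev θ W' hW' τ)
    (StalkSheaf.ev θ' W' hW' τ)).trans ?_
  rw [h W' hW' τ, h' W' hW' τ, map_add, map_add, LinearMap.add_apply]

theorem IsMultiple.smul {W : Opens M} {a : L.sections W}
    {θ : dualSections (L.oneForms.exteriorPower p).toModules W}
    {ν : (L.conormal.exteriorPower p).sections W} (h : IsMultiple σ hinv a θ ν)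
    (b : L.sections W) : IsMultiple σ hinv a (StalkSheaf.smulDual b θ) (b • ν) := by
  intro W' hW' τ
  refine (mul_left_comm (L.resSections hW' a) (L.resSections hW' b)
    (StalkSheaf.ev θ W' hW' τ)).trans ?_
  rw [h W' hW' τ, StalkSheaf.res_smul, map_smul, LinearMap.smul_apply, smul_eq_mul]

/-- Both a ν' and a' ν represent a a' θ, so their difference lies in the kernel of the pairing,
where ψ vanishes. -/
theorem IsMultiple.mul_ev_eq (hred : L.IsReduced) (hR1 : L.IsRegularInCodimOne) {U W : Opens M}
    (hW : W ≤ U) (ψ : dualSections (L.conormal.exteriorPower p).toModules U)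
    {a a' : L.sections W} {θ : dualSections (L.oneForms.exteriorPower p).toModules W}
    {ν ν' : (L.conormal.exteriorPower p).sections W} (h : IsMultiple σ hinv a θ ν)
    (h' : IsMultiple σ hinv a' θ ν') :
    a * StalkSheaf.ev ψ W hW ν' = a' * StalkSheaf.ev ψ W hW ν := by
  have h0 : StalkSheaf.ev ψ W hW (a • ν' - a' • ν) = 0 := by
    refine ev_eq_zero_of_pairing_eq_zero σ hinv hred hR1 hW ψ _ fun V hV τ => ?_
    rw [map_sub, StalkSheaf.res_smul, StalkSheaf.res_smul, map_sub, map_smul, map_smul,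
      LinearMap.sub_apply, LinearMap.smul_apply, LinearMap.smul_apply, ← h V hV τ, ← h' V hV τ,
      smul_eq_mul, smul_eq_mul, mul_left_comm, sub_self]
  rw [map_sub, map_smul, map_smul, sub_eq_zero] at h0
  exact h0

/-! #### Values of the extension of a functional -/

section Values

variable {U : Opens M} (ψ : dualSections (L.conormal.exteriorPower p).toModules U)

/-- The element `s` of the stalk is the value at `θ` of the functional on the dual of the sheaf of
forms which extends `ψ`. -/
def IsValue {V : Opens M} (hV : V ≤ U)
    (θ : dualSections (L.oneForms.exteriorPower p).toModules V) (x : V)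
    (s : L.Stalk (x : M)) : Prop :=
  ∀ W (hW : W ≤ V) (hx : (x : M) ∈ W) (a : L.sections W)
    (ν : (L.conormal.exteriorPower p).sections W),
    IsMultiple σ hinv a (resDual _ hW θ) ν →
      a.1 ⟨x, hx⟩ * s = (StalkSheaf.ev ψ W (hW.trans hV) ν).1 ⟨x, hx⟩

variable {σ hinv ψ} in
-- One dense family suffices. For a further multiplier a with representative μ, m_i ψ(μ) = a ψ(ν_i)
-- = a m_i s, and the m_i can be cancelled jointly.
theorem isValue_of_multipliers (hred : L.IsReduced) (hR1 : L.IsRegularInCodimOne) {V : Opens M}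
    {hV : V ≤ U} {θ : dualSections (L.oneForms.exteriorPower p).toModules V} {x : V}
    {W : Opens M} (hW : W ≤ V) (hx : (x : M) ∈ W) {ι : Type*} {m : ι → L.sections W}
    (hm : IsDense fun i => (m i).1 ⟨x, hx⟩) {ν : ι → (L.conormal.exteriorPower p).sections W}
    (hν : ∀ i, IsMultiple σ hinv (m i) (resDual _ hW θ) (ν i)) {s : L.Stalk (x : M)}
    (hs : ∀ i, (m i).1 ⟨x, hx⟩ * s = (StalkSheaf.ev ψ W (hW.trans hV) (ν i)).1 ⟨x, hx⟩) :
    IsValue σ hinv ψ hV θ x s := by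
  intro W' hW' hx' a μ hμ
  refine hm.eq_of_mul_eq hred fun i => ?_
  have h1 := IsMultiple.mul_ev_eq σ hinv hred hR1
    ((inf_le_left : W ⊓ W' ≤ W).trans (hW.trans hV)) ψ
    ((hν i).res σ hinv (inf_le_left : W ⊓ W' ≤ W)) (hμ.res σ hinv (inf_le_right : W ⊓ W' ≤ W'))
  have h2 := congrFun (congrArg Subtype.val h1) ⟨x, hx, hx'⟩
  have h3 := StalkSheaf.ev_apply_eq ψ (hW.trans hV) (inf_le_left : W ⊓ W' ≤ W) (ν i) ⟨x, hx, hx'⟩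
  have h4 := StalkSheaf.ev_apply_eq ψ (hW'.trans hV) (inf_le_right : W ⊓ W' ≤ W') μ ⟨x, hx, hx'⟩
  have h5 : (m i).1 ⟨x, hx⟩ * (StalkSheaf.ev ψ W' (hW'.trans hV) μ).1 ⟨x, hx'⟩ =
      a.1 ⟨x, hx'⟩ * (StalkSheaf.ev ψ W (hW.trans hV) (ν i)).1 ⟨x, hx⟩ :=
    (congrArg ((m i).1 ⟨x, hx⟩ * ·) h4).trans
      (h2.trans (congrArg (a.1 ⟨x, hx'⟩ * ·) h3.symm))
  rw [h5, ← hs i, mul_left_comm]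

/-- The system m_i s = ψ(ν_i) is solved in the stalk at x. Since it consists of finitely many
equations between sections, the solution remains valid near x. -/
theorem exists_isValue_section (hred : L.IsReduced) (hdim : L.dim = n) (hCM : L.IsCohenMacaulay)
    (hR1 : L.IsRegularInCodimOne) {V : Opens M} (hV : V ≤ U)
    (θ : dualSections (L.oneForms.exteriorPower p).toModules V) (x : V) :
    ∃ (W : Opens M) (hW : W ≤ V) (s : L.sections W), (x : M) ∈ W ∧
      ∀ y : W, IsValue σ hinv ψ hV θ ⟨y, hW y.2⟩ (s.1 y) := by
  obtain ⟨W, hW, hxW, k, m, hm, hdense⟩ := exists_multipliers σ hinv hdim hR1 p x.2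
  choose ν hν using fun i => hm i (resDual _ hW θ)
  obtain ⟨s, hs⟩ := IsDense.exists_mul_eq hred hCM (hdense ⟨x, hxW⟩)
    (fun i => (StalkSheaf.ev ψ W (hW.trans hV) (ν i)).1 ⟨x, hxW⟩) fun i j =>
      congrFun (congrArg Subtype.val ((hν i).mul_ev_eq σ hinv hred hR1 (hW.trans hV) ψ (hν j)))
        ⟨x, hxW⟩
  obtain ⟨W', hW', hxW', s, rfl⟩ := L.exists_section s W hxW
  choose X hX hxX hXs using fun i => L.exists_eq_section (L.resSections hW' (m i) * s)
    (L.resSections hW' (StalkSheaf.ev ψ W (hW.trans hV) (ν i))) ⟨x, hxW'⟩ (hs i)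
  obtain ⟨Y, hY, hxY, hYX⟩ := exists_opens_le hxW' X hxX
  exact ⟨Y, (hY.trans hW').trans hW, L.resSections hY s, hxY, fun y =>
    isValue_of_multipliers (x := ⟨y, _⟩) (m := m) hred hR1 hW (hW' (hY y.2))
      (hdense ⟨y, hW' (hY y.2)⟩) hν fun i => hXs i ⟨y, hYX i y.2⟩⟩

variable {σ hinv ψ} in
theorem IsValue.unique (hred : L.IsReduced) (hdim : L.dim = n) (hR1 : L.IsRegularInCodimOne)
    {V : Opens M} {hV : V ≤ U} {θ : dualSections (L.oneForms.exteriorPower p).toModules V} {x : V}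
    {s t : L.Stalk (x : M)} (hs : IsValue σ hinv ψ hV θ x s) (ht : IsValue σ hinv ψ hV θ x t) :
    s = t := by
  obtain ⟨W, hW, hxW, k, m, hm, hdense⟩ := exists_multipliers σ hinv hdim hR1 p x.2
  choose ν hν using fun i => hm i (resDual _ hW θ)
  exact IsDense.eq_of_mul_eq hred (hdense ⟨x, hxW⟩) fun i =>
    (hs W hW hxW _ _ (hν i)).trans (ht W hW hxW _ _ (hν i)).symm

variable {σ hinv ψ} in
theorem IsValue.add (hred : L.IsReduced) (hdim : L.dim = n) (hR1 : L.IsRegularInCodimOne)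
    {V : Opens M} {hV : V ≤ U} {θ θ' : dualSections (L.oneForms.exteriorPower p).toModules V}
    {x : V} {s t : L.Stalk (x : M)} (hs : IsValue σ hinv ψ hV θ x s)
    (ht : IsValue σ hinv ψ hV θ' x t) : IsValue σ hinv ψ hV (θ + θ') x (s + t) := by
  obtain ⟨W, hW, hxW, k, m, hm, hdense⟩ := exists_multipliers σ hinv hdim hR1 p x.2
  choose ν hν using fun i => hm i (resDual _ hW θ)
  choose ν' hν' using fun i => hm i (resDual _ hW θ')
  have hadd : ∀ i, IsMultiple σ hinv (m i) (resDual _ hW (θ + θ')) (ν i + ν' i) := fun i => by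
    rw [map_add]
    exact (hν i).add σ hinv (hν' i)
  refine isValue_of_multipliers (m := m) hred hR1 hW hxW (hdense ⟨x, hxW⟩) hadd fun i => ?_
  rw [mul_add, hs W hW hxW _ _ (hν i), ht W hW hxW _ _ (hν' i), map_add]
  rfl

variable {σ hinv ψ} in
theorem IsValue.smul (hred : L.IsReduced) (hdim : L.dim = n) (hR1 : L.IsRegularInCodimOne)
    {V : Opens M} {hV : V ≤ U} {θ : dualSections (L.oneForms.exteriorPower p).toModules V}
    {x : V} {s : L.Stalk (x : M)} (hs : IsValue σ hinv ψ hV θ x s) (b : L.sections V) :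
    IsValue σ hinv ψ hV (StalkSheaf.smulDual b θ) x (b.1 x * s) := by
  obtain ⟨W, hW, hxW, k, m, hm, hdense⟩ := exists_multipliers σ hinv hdim hR1 p x.2
  choose ν hν using fun i => hm i (resDual _ hW θ)
  have hsmul : ∀ i, IsMultiple σ hinv (m i) (resDual _ hW (StalkSheaf.smulDual b θ))
      (L.resSections hW b • ν i) := fun i => by
    rw [resDual_smulDual]
    exact (hν i).smul σ hinv (L.resSections hW b)
  refine isValue_of_multipliers (m := m) hred hR1 hW hxW (hdense ⟨x, hxW⟩) hsmul fun i => ?_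
  rw [mul_left_comm, hs W hW hxW _ _ (hν i), map_smul, smul_eq_mul]
  rfl

variable {σ hinv ψ} in
theorem IsValue.res {V V' : Opens M} {hV : V ≤ U}
    {θ : dualSections (L.oneForms.exteriorPower p).toModules V} (hV' : V' ≤ V) {x : V'}
    {s : L.Stalk (x : M)} (hs : IsValue σ hinv ψ hV θ ⟨x, hV' x.2⟩ s) :
    IsValue σ hinv ψ (hV'.trans hV) (resDual _ hV' θ) x s :=
  fun W hW hx a ν h => hs W (hW.trans hV') hx a ν h

/-- The local solutions glue because the value at each point is unique. -/
theorem exists_isValue (hred : L.IsReduced) (hdim : L.dim = n) (hCM : L.IsCohenMacaulay)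
    (hR1 : L.IsRegularInCodimOne) {V : Opens M} (hV : V ≤ U)
    (θ : dualSections (L.oneForms.exteriorPower p).toModules V) :
    ∃ s : L.sections V, ∀ x, IsValue σ hinv ψ hV θ x (s.1 x) := by
  choose W hW s hxW hs using exists_isValue_section σ hinv ψ hred hdim hCM hR1 hV θ
  refine ⟨⟨fun x => (s x).1 ⟨x, hxW x⟩, mem_sections_of_local fun x =>
    ⟨W x, hW x, hxW x, ?_⟩⟩, fun x => hs x ⟨x, hxW x⟩⟩
  convert (s x).2 using 1
  funext y
  exact IsValue.unique (x := ⟨y, hW x y.2⟩) hred hdim hR1 (hs ⟨y, hW x y.2⟩ ⟨y, hxW _⟩) (hs x y)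

end Values

/-! #### Sections of the bidual -/

section Sections

variable {F : StalkSheaf L} {U : Opens M}

/-- The values of a section of the bidual. -/
def bidualEv (Φ : dualSections (dual F.toModules) U) (V : Opens M) (h : V ≤ U) :
    dualSections F.toModules V →+ L.sections V :=
  LinearMap.toAddMonoidHom (Φ.1 ⟨V, h⟩)

theorem bidualEv_smul (Φ : dualSections (dual F.toModules) U) {V : Opens M} (h : V ≤ U)
    (a : L.sections V) (θ : dualSections F.toModules V) :
    bidualEv Φ V h (StalkSheaf.smulDual a θ) = a * bidualEv Φ V h θ :=
  (Φ.1 ⟨V, h⟩).map_smul a θ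

theorem bidualEv_res (Φ : dualSections (dual F.toModules) U) {V W : Opens M} (h : V ≤ U)
    (hW : W ≤ V) (θ : dualSections F.toModules V) :
    L.resSections hW (bidualEv Φ V h θ) = bidualEv Φ W (hW.trans h) (resDual _ hW θ) :=
  Φ.2 ⟨V, h⟩ ⟨W, hW.trans h⟩ hW θ

/-- A section of the bidual from its values. -/
def mkBidual (f : ∀ V ≤ U, dualSections F.toModules V →+ L.sections V)
    (hsmul : ∀ V h a θ, f V h (StalkSheaf.smulDual a θ) = a * f V h θ)
    (hres : ∀ V h W (hW : W ≤ V) θ,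
      L.resSections hW (f V h θ) = f W (hW.trans h) (resDual _ hW θ)) :
    dualSections (dual F.toModules) U :=
  ⟨fun V => { f V.1 V.2 with map_smul' := hsmul V.1 V.2 }, fun V W h θ => hres V.1 V.2 W.1 h θ⟩

theorem bidualEv_mkBidual (f : ∀ V ≤ U, dualSections F.toModules V →+ L.sections V) (hsmul) (hres)
    {V : Opens M} (h : V ≤ U) : bidualEv (mkBidual f hsmul hres) V h = f V h := rfl

theorem bidual_ext {Φ Ψ : dualSections (dual F.toModules) U}
    (h : ∀ V (hV : V ≤ U) θ, bidualEv Φ V hV θ = bidualEv Ψ V hV θ) : Φ = Ψ :=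
  Subtype.ext <| funext fun V => LinearMap.ext fun θ => h V.1 V.2 θ

/-- The functional on the exterior power of the conormal sheaf defined by a section of the bidual
of the sheaf of forms. -/
def pullback (Φ : dualSections (dual (L.oneForms.exteriorPower p).toModules) U) :
    dualSections (L.conormal.exteriorPower p).toModules U :=
  StalkSheaf.mkDual
    (fun V h =>
      { toFun := fun ν => bidualEv Φ V h (toFunctional σ hinv ν)
        map_add' := fun ν ν' => by
          rw [← map_add]
          refine congrArg (bidualEv Φ V h) (StalkSheaf.dual_ext fun W hW τ => ?_)
          change (powerPairing σ hinv p).onSections W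
            ((L.conormal.exteriorPower p).res hW (ν + ν')) τ = _
          rw [map_add, map_add]
          rfl
        map_smul' := fun a ν => by
          rw [RingHom.id_apply, smul_eq_mul, ← bidualEv_smul]
          refine congrArg (bidualEv Φ V h) (StalkSheaf.dual_ext fun W hW τ => ?_)
          rw [ev_toFunctional, StalkSheaf.res_smul, map_smul]
          rfl })
    fun V h W hW ν => bidualEv_res Φ h hW (toFunctional σ hinv ν)

theorem ev_pullback (Φ : dualSections (dual (L.oneForms.exteriorPower p).toModules) U)
    {V : Opens M} (h : V ≤ U) (ν : (L.conormal.exteriorPower p).sections V) :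
    StalkSheaf.ev (pullback σ hinv Φ) V h ν = bidualEv Φ V h (toFunctional σ hinv ν) := rfl

/-- Each m_i θ comes from a section of the conormal power, so the pullback determines m_i Φ(θ) for
all i, and the family m_i can be cancelled. -/
theorem pullback_injective (hred : L.IsReduced) (hdim : L.dim = n)
    (hR1 : L.IsRegularInCodimOne) :
    Function.Injective (pullback σ hinv (p := p) (U := U)) := by
  intro Φ Ψ h
  refine bidual_ext fun V hV θ => Subtype.ext <| funext fun x => ?_
  obtain ⟨W, hW, hxW, k, m, hm, hdense⟩ := exists_multipliers σ hinv hdim hR1 p x.2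
  refine IsDense.eq_of_mul_eq hred (hdense ⟨x, hxW⟩) fun i => ?_
  obtain ⟨ν, hν⟩ := hm i (resDual _ hW θ)
  rw [isMultiple_iff] at hν
  have h1 : m i * bidualEv Φ W (hW.trans hV) (resDual _ hW θ) =
      m i * bidualEv Ψ W (hW.trans hV) (resDual _ hW θ) := by
    rw [← bidualEv_smul, ← bidualEv_smul, hν, ← ev_pullback, h, ev_pullback]
  rw [← bidualEv_res, ← bidualEv_res] at h1
  exact congrFun (congrArg Subtype.val h1) ⟨x, hxW⟩

/-- The extension of ψ sends θ to its unique value in the sense of `IsValue`; additivity, linearity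
and compatibility with restriction all follow from that uniqueness. -/
theorem pullback_surjective (hred : L.IsReduced) (hdim : L.dim = n) (hCM : L.IsCohenMacaulay)
    (hR1 : L.IsRegularInCodimOne) :
    Function.Surjective (pullback σ hinv (p := p) (U := U)) := by
  intro ψ
  choose f hf using fun V (hV : V ≤ U) =>
    exists_isValue σ hinv ψ hred hdim hCM hR1 hV
  refine ⟨mkBidual (fun V hV => AddMonoidHom.mk' (f V hV) fun θ θ' => ?_) (fun V hV a θ => ?_)
    fun V hV W hW θ => ?_, ?_⟩
  · exact Subtype.ext <| funext fun x => IsValue.unique hred hdim hR1 (hf V hV _ x)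
      ((hf V hV θ x).add hred hdim hR1 (hf V hV θ' x))
  · exact Subtype.ext <| funext fun x => IsValue.unique hred hdim hR1 (hf V hV _ x)
      ((hf V hV θ x).smul hred hdim hR1 a)
  · exact Subtype.ext <| funext fun x => IsValue.unique hred hdim hR1
      ((hf V hV θ ⟨x, hW x.2⟩).res hW) (hf W (hW.trans hV) _ x)
  · refine StalkSheaf.dual_ext fun V hV ν => Subtype.ext <| funext fun x => ?_
    rw [ev_pullback, bidualEv_mkBidual]
    -- For a functional that already comes from ν the multiplier 1 is admissible, so its value is
    -- ψ(ν).
    have h1 := hf V hV (toFunctional σ hinv ν) x V le_rfl x.2 1 ν fun W hW τ => by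
      rw [map_one, one_mul]
      rfl
    exact (one_mul _).symm.trans h1

/-- The restriction of functionals on the dual of the sheaf of forms to the exterior power of the
conormal sheaf. -/
def pullbackHom (p : ℕ) (U : (Opens M)ᵒᵖ) :
    (dual (dual (L.forms p))).obj U →ₗ[L.ringSheaf.obj U] (L.cochains p).obj U where
  toFun Φ := pullback σ hinv (p := p) (U := U.unop) Φ
  map_add' _ _ := rfl
  map_smul' _ _ := rfl

theorem pullbackHom_bijective (hred : L.IsReduced) (hdim : L.dim = n) (hCM : L.IsCohenMacaulay)
    (hR1 : L.IsRegularInCodimOne) (p : ℕ) (U : (Opens M)ᵒᵖ) :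
    Function.Bijective (pullbackHom σ hinv p U) :=
  ⟨pullback_injective σ hinv hred hdim hR1, pullback_surjective σ hinv hred hdim hCM hR1⟩

end Sections

end AnalyticSubspace

end SingularLagrangian

end Bidual

/-! ### ### The isomorphism between the bidual of the forms and the cochains -/

open SingularLagrangian in
theorem mainTheorem8 {𝕂 : Type} [RCLike 𝕂] {n : ℕ} {M : Type*} [TopologicalSpace M]
    [ChartedSpace (Model 𝕂 n) M] [IsManifold 𝓘(𝕂, Model 𝕂 n) ω M]
    (σ : SymplecticForm 𝕂 n M) (L : AnalyticSubspace 𝕂 n M)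
    (hred : L.IsReduced) (hdim : L.dim = n) (hinv : L.IsInvolutive σ)
    (hCM : L.IsCohenMacaulay) (hR1 : L.IsRegularInCodimOne) (p : ℕ) :
    Nonempty (dual (dual (L.forms p)) ≅ L.cochains p) := by
  refine ⟨PresheafOfModules.isoMk (fun U =>
    (LinearEquiv.ofBijective (AnalyticSubspace.pullbackHom σ hinv p U)
      (AnalyticSubspace.pullbackHom_bijective σ hinv hred hdim hCM hR1 p U)).toModuleIso) ?_⟩
  -- Compatibility with restriction is definitional: `pullback` evaluates the same family on every
  -- smaller open set.
  intro U V i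
  rfl
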